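/- All graphs are finite, simple and undirected. A matching in a graph $G$ is a set of pairwise disjoint edges; it is maximal if it is maximal with respect to inclusion. Let $\gamma_e(G)$ be the minimum size of a maximal matching in $G$. For a class $\mathcal{C}$ of graphs, a polynomial time approximation algorithm with ratio $\rho$ for the minimum maximal matching problem on $\mathcal{C}$ is an algorithm (a program for a random access machine with unit-cost addition and truncated subtraction, without multiplication) that, given the adjacency matrix of any graph $G\in\mathcal{C}$ of order $n$, halts after a number of steps bounded by a fixed polynomial in $n$, and outputs a maximal matching in $G$ of size at most $\rho\cdot\gamma_e(G)$. Let $T^*$ be the tree that arises from the claw $K_{1,3}$ by subdividing exactly two of its edges exactly once; a graph is $H$-free if it has no induced subgraph isomorphic to $H$, and claw-free if it is $K_{1,3}$-free. Let $\Delta\ge 3$ be an integer. For every fixed real $\epsilon>0$, there are polynomial time approximation algorithms for the minimum maximal matching problem (the algorithms and polynomials may depend on $\Delta$ and $\epsilon$) with the following ratios: - $\frac{25}{18}+\epsilon$ on connected cubic bipartite $T^*$-free graphs; - $2-\frac{1}{\Delta-1}+\epsilon$ on connected $\Delta$-regular graphs; - $1+\frac{4\Delta-7}{2\Delta^2-3\Delta+1}+\epsilon$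 on connected claw-free $\Delta$-regular graphs. -/

import Mathlib

/-! ### Random access machines with unit cost -/

/-- Memory of a random access machine: registers with fixed names (a program uses finitely many of
them) and an indirectly addressed memory; every register and every cell holds a natural number. -/
structure RAMState where
  reg : ℕ → ℕ
  mem : ℕ → ℕ

/-- Expressions: constants, registers, memory cells, addition and truncated subtraction. There is no
multiplication, so that unit cost is polynomially equivalent to Turing machine time. -/
inductive RAMExpr where
  | const (c : ℕ)
  | reg (x : ℕ)
  | load (a : RAMExpr)
  | add (a b : RAMExpr)
  | sub (a b : RAMExpr)

namespace RAMExpr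

/-- The value of an expression in a state. -/
def eval (s : RAMState) : RAMExpr → ℕ
  | const c => c
  | reg x => s.reg x
  | load a => s.mem (a.eval s)
  | add a b => a.eval s + b.eval s
  | sub a b => a.eval s - b.eval s

/-- The cost of evaluating an expression: one unit for every operation and every leaf. -/
def cost : RAMExpr → ℕ
  | const _ => 1
  | reg _ => 1
  | load a => a.cost + 1
  | add a b => a.cost + b.cost + 1
  | sub a b => a.cost + b.cost + 1

end RAMExpr

/-- Structured programs of the machine; tests ask whether a value is nonzero. -/
inductive RAMProg where
  | skip
  | set (x : ℕ) (e : RAMExpr)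
  | store (a e : RAMExpr)
  | seq (p q : RAMProg)
  | ite (e : RAMExpr) (p q : RAMProg)
  | loop (e : RAMExpr) (p : RAMProg)

/-- `p.Runs s t s'` : the program `p`, started in state `s`, halts after exactly `t` steps in
state `s'`. -/
inductive RAMProg.Runs : RAMProg → RAMState → ℕ → RAMState → Prop where
  | skip (s : RAMState) : Runs .skip s 1 s
  | set (x : ℕ) (e : RAMExpr) (s : RAMState) :
      Runs (.set x e) s (e.cost + 1) { s with reg := Function.update s.reg x (e.eval s) }
  | store (a e : RAMExpr) (s : RAMState) :
      Runs (.store a e) s (a.cost + e.cost + 1)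
        { s with mem := Function.update s.mem (a.eval s) (e.eval s) }
  | seq {p q : RAMProg} {s s₁ s₂ : RAMState} {t₁ t₂ : ℕ} :
      Runs p s t₁ s₁ → Runs q s₁ t₂ s₂ → Runs (.seq p q) s (t₁ + t₂) s₂
  | ite_true {e : RAMExpr} {p q : RAMProg} {s s₁ : RAMState} {t : ℕ} :
      e.eval s ≠ 0 → Runs p s t s₁ → Runs (.ite e p q) s (e.cost + 1 + t) s₁
  | ite_false {e : RAMExpr} {p q : RAMProg} {s s₁ : RAMState} {t : ℕ} :
      e.eval s = 0 → Runs q s t s₁ → Runs (.ite e p q) s (e.cost + 1 + t) s₁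
  | loop_true {e : RAMExpr} {p : RAMProg} {s s₁ s₂ : RAMState} {t₁ t₂ : ℕ} :
      e.eval s ≠ 0 → Runs p s t₁ s₁ → Runs (.loop e p) s₁ t₂ s₂ →
        Runs (.loop e p) s (e.cost + 1 + t₁ + t₂) s₂
  | loop_false {e : RAMExpr} {p : RAMProg} {s : RAMState} :
      e.eval s = 0 → Runs (.loop e p) s (e.cost + 1) s

/-! ### Minimum maximal matchings -/

/-- A maximal matching of `G`: a matching that is maximal with respect to inclusion. -/
def IsMaximalMatching {V : Type*} (G : SimpleGraph V) (M : G.Subgraph) : Prop :=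
  Maximal (fun N : G.Subgraph => N.IsMatching) M

/-- The edge domination number: the minimum size of a maximal matching. -/
noncomputable def edgeDominationNumber {V : Type*} (G : SimpleGraph V) : ℕ :=
  sInf {k : ℕ | ∃ M : G.Subgraph, IsMaximalMatching G M ∧ M.edgeSet.ncard = k}

/-! ### Approximation algorithms -/

open Classical in
/-- The input for a graph `G` on `{0, …, n - 1}`: register `0` holds `n`, and the cells
`0, …, n ^ 2 - 1` hold the adjacency matrix, row by row; everything else is `0`. -/
noncomputable def graphInput {n : ℕ} (G : SimpleGraph (Fin n)) : RAMState where
  reg x := if x = 0 then n else 0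
  mem a := if ∃ i j : Fin n, G.Adj i j ∧ a = (i : ℕ) * n + j then 1 else 0

/-- The output format: the first `n ^ 2` cells hold the adjacency matrix of the edge set of `M`. -/
def IsOutput {n : ℕ} {G : SimpleGraph (Fin n)} (s : RAMState) (M : G.Subgraph) : Prop :=
  ∀ i j : Fin n, (M.Adj i j → s.mem ((i : ℕ) * n + j) = 1) ∧
    (¬ M.Adj i j → s.mem ((i : ℕ) * n + j) = 0)

/-- The minimum maximal matching problem, restricted to the graphs in the class `C`, has a polynomial
time approximation algorithm with ratio `r`: some program halts on every graph `G` in `C` after a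
number of steps that is polynomial in the order of `G` (equivalently, in the size `n ^ 2` of the
input), and its output is a maximal matching of `G` whose size is at most `r` times the minimum. -/
def HasPolyTimeApproximation (C : (n : ℕ) → SimpleGraph (Fin n) → Prop) (r : ℝ) : Prop :=
  ∃ (P : RAMProg) (time : Polynomial ℕ), ∀ (n : ℕ) (G : SimpleGraph (Fin n)), C n G →
    ∃ (t : ℕ) (s : RAMState), P.Runs (graphInput G) t s ∧ t ≤ time.eval n ∧
      ∃ M : G.Subgraph, IsMaximalMatching G M ∧ IsOutput s M ∧
        (M.edgeSet.ncard : ℝ) ≤ r * (edgeDominationNumber G : ℝ)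

/-! ### Graph classes -/

/-- The tree that arises by subdividing exactly two edges of a claw exactly once: the centre `0` has
the neighbours `1`, `2`, `3`, and the paths `0 1 4` and `0 2 5` are the subdivided edges. -/
def TStar : SimpleGraph (Fin 6) :=
  SimpleGraph.fromEdgeSet {s(0, 1), s(0, 2), s(0, 3), s(1, 4), s(2, 5)}

/-- `G` is `H`-free: it has no induced subgraph isomorphic to `H`. -/
def InducedFree {V W : Type*} (H : SimpleGraph W) (G : SimpleGraph V) : Prop :=
  ¬ H.IsIndContained G

open Classical in
/-- Connected `Δ`-regular graphs. -/
def ConnectedRegular (Δ n : ℕ) (G : SimpleGraph (Fin n)) : Prop :=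
  G.Connected ∧ G.IsRegularOfDegree Δ

/-- Connected cubic bipartite `T*`-free graphs. -/
def ConnectedCubicBipartiteTStarFree (n : ℕ) (G : SimpleGraph (Fin n)) : Prop :=
  ConnectedRegular 3 n G ∧ G.IsBipartite ∧ InducedFree TStar G

/-- Connected claw-free `Δ`-regular graphs. -/
def ConnectedClawFreeRegular (Δ n : ℕ) (G : SimpleGraph (Fin n)) : Prop :=
  ConnectedRegular Δ n G ∧ InducedFree (completeBipartiteGraph (Fin 1) (Fin 3)) G

/-! Write `C` for the vertex set of the current matching. The algorithm is greedy and is guided by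
the potential `c * #isolated + #full`, where a vertex outside `C` is isolated if all its neighbors
lie in `C`, and full if none does. For `C = ∅` every vertex is full, so the potential is at least
`n`. If it can be kept at `n - D` or more until the matching `M` is maximal, then no full vertex
remains. Hence at least `(n - D) / c` vertices are uncovered, and `2 |M| ≤ n - (n - D) / c`.

For the lower bound, the uncovered vertices of a maximal matching are independent. If every covered
vertex of a `d`-regular graph has at most `b` uncovered neighbors, counting the edges between the
two sides gives `d n ≤ 2 γ (d + b)`. The quotient is `(c - 1)(d + b) / (c d)`; the constant `D` is
absorbed by `ε` for large `n`, and the finitely many smaller graphs are answered from a table in the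
program (`HasPolyTimeApproximation.of_eventually`). Always `b ≤ d - 1`, and `b ≤ 2` in claw-free
graphs.

It remains to maintain the potential with a bounded number of new edges. Connectivity supplies a
full vertex `y` with a neighbor `x` outside `C` that is not full. It suffices to isolate one new
vertex while at most `c` full ones are lost (`IsExtension.hasExtension`). In regular graphs an
exchange argument around `x` gives `c = (2d - 1)(d - 1)` with at most `d` edges
(`hasExtension_of_regular`). A connected cubic bipartite `T*`-free graph with more than eight
vertices is composed of copies of `K_{3,3}` minus an edge (`inBlock_of_tStarFree`), and a case
analysis of these blocks gives `c = 6` with at most three edges (`hasExtension_of_inBlock`).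

Since the number of new edges is bounded, exhaustive search finds them in polynomial time. The
machine part proves closure properties of polynomial time computable values, properties and
transformations, and assembles the program from them (`exists_greedy_program`). -/

/-! ### States -/

namespace RAMState

/-- The state after the assignment of `v` to the register `x`. -/
def setReg (s : RAMState) (x v : ℕ) : RAMState := { s with reg := Function.update s.reg x v }

/-- The state after `v` is stored in the cell `a`. -/
def setMem (s : RAMState) (a v : ℕ) : RAMState := { s with mem := Function.update s.mem a v }

@[simp] theorem reg_setReg (s : RAMState) (x v y : ℕ) :
    (s.setReg x v).reg y = if y = x then v else s.reg y := by
  simp [setReg, Function.update_apply]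

@[simp] theorem mem_setReg (s : RAMState) (x v : ℕ) : (s.setReg x v).mem = s.mem := rfl

@[simp] theorem reg_setMem (s : RAMState) (a v : ℕ) : (s.setMem a v).reg = s.reg := rfl

@[simp] theorem mem_setMem (s : RAMState) (a v b : ℕ) :
    (s.setMem a v).mem b = if b = a then v else s.mem b := by
  simp [setMem, Function.update_apply]

/-- Two states agree in the memory and in the registers below `k`. -/
def Agree (k : ℕ) (s s' : RAMState) : Prop :=
  s'.mem = s.mem ∧ ∀ x < k, s'.reg x = s.reg x

theorem Agree.symm {k : ℕ} {s s' : RAMState} (h : Agree k s s') : Agree k s' s :=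
  ⟨h.1.symm, fun x hx => (h.2 x hx).symm⟩

theorem Agree.trans {k : ℕ} {s s' s'' : RAMState} (h : Agree k s s') (h' : Agree k s' s'') :
    Agree k s s'' :=
  ⟨h'.1.trans h.1, fun x hx => (h'.2 x hx).trans (h.2 x hx)⟩

theorem Agree.mono {k l : ℕ} {s s' : RAMState} (h : Agree k s s') (hl : l ≤ k) : Agree l s s' :=
  ⟨h.1, fun x hx => h.2 x (hx.trans_le hl)⟩

theorem Agree.setReg {k : ℕ} {s s' : RAMState} (h : Agree k s s') (x v : ℕ) :
    Agree k (s.setReg x v) (s'.setReg x v) :=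
  ⟨h.1, fun y hy => by simp [h.2 y hy]⟩

theorem Agree.setMem {k : ℕ} {s s' : RAMState} (h : Agree k s s') (a v : ℕ) :
    Agree k (s.setMem a v) (s'.setMem a v) :=
  ⟨by ext b; simp [h.1], fun y hy => by simp [h.2 y hy]⟩

theorem agree_setReg {k x : ℕ} (s : RAMState) (v : ℕ) (hx : k ≤ x) : Agree k s (s.setReg x v) :=
  ⟨rfl, fun y hy => by simp [show y ≠ x by omega]⟩

end RAMState

open RAMState

namespace RAMProg

theorem runs_set (x : ℕ) (e : RAMExpr) (s : RAMState) :
    Runs (.set x e) s (e.cost + 1) (s.setReg x (e.eval s)) := Runs.set x e s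

theorem runs_store (a e : RAMExpr) (s : RAMState) :
    Runs (.store a e) s (a.cost + e.cost + 1) (s.setMem (a.eval s) (e.eval s)) := Runs.store a e s

/-- A loop whose control register is decreased by one in every iteration. -/
theorem runs_loop_countdown {x B : ℕ} {body : RAMProg} (Inv : ℕ → RAMState → Prop)
    (hbody : ∀ m s, Inv (m + 1) s → s.reg x = m + 1 →
      ∃ t s', body.Runs s t s' ∧ t ≤ B ∧ Inv m s' ∧ s'.reg x = m) :
    ∀ m s, Inv m s → s.reg x = m →
      ∃ t s', (RAMProg.loop (.reg x) body).Runs s t s' ∧ t ≤ m * (B + 2) + 2 ∧ Inv 0 s' := by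
  intro m
  induction m with
  | zero =>
    intro s hs hx
    exact ⟨_, s, Runs.loop_false (by simpa [RAMExpr.eval] using hx), by simp [RAMExpr.cost], hs⟩
  | succ m ih =>
    intro s hs hx
    obtain ⟨t, s', hr, ht, hi, hx'⟩ := hbody m s hs hx
    obtain ⟨t', s'', hr', ht', hi'⟩ := ih s' hi hx'
    refine ⟨_, s'', Runs.loop_true (by simp [RAMExpr.eval, hx]) hr hr', ?_, hi'⟩
    simp only [RAMExpr.cost]
    nlinarith

end RAMProg

/-! ### Values computable in polynomial time -/

/-- The value `f s` is computed in polynomial time with respect to the content of register `0`,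
into any sufficiently late register, without changing the memory and the earlier registers. -/
def PolyVal (f : RAMState → ℕ) : Prop :=
  ∃ k₀ : ℕ, 0 < k₀ ∧ (∀ s s', Agree k₀ s s' → f s' = f s) ∧
    ∀ k ≥ k₀, ∃ (P : RAMProg) (T : Polynomial ℕ), ∀ s, ∃ t s', P.Runs s t s' ∧
      t ≤ T.eval (s.reg 0) ∧ Agree k s s' ∧ s'.reg k = f s

namespace PolyVal

open RAMProg

variable {f g : RAMState → ℕ}

theorem const (c : ℕ) : PolyVal fun _ => c := by
  refine ⟨1, one_pos, fun _ _ _ => rfl, fun k _ => ⟨.set k (.const c), 2, fun s => ?_⟩⟩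
  exact ⟨_, _, runs_set _ _ _, by simp [RAMExpr.cost], agree_setReg _ _ le_rfl,
    by simp [RAMExpr.eval]⟩

theorem reg (x : ℕ) : PolyVal fun s => s.reg x := by
  refine ⟨x + 1, by omega, fun _ _ h => h.2 x (by omega), fun k _ =>
    ⟨.set k (.reg x), 2, fun s => ?_⟩⟩
  exact ⟨_, _, runs_set _ _ _, by simp [RAMExpr.cost], agree_setReg _ _ le_rfl,
    by simp [RAMExpr.eval]⟩

theorem load (hf : PolyVal f) : PolyVal fun s => s.mem (f s) := by
  obtain ⟨k₀, hk₀, hd, hf⟩ := hf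
  refine ⟨k₀, hk₀, fun s s' h => by simp only [hd s s' h, h.1], fun k hk => ?_⟩
  obtain ⟨P, T, hP⟩ := hf k hk
  refine ⟨.seq P (.set k (.load (.reg k))), T + 3, fun s => ?_⟩
  obtain ⟨t, s', hr, ht, ha, hv⟩ := hP s
  refine ⟨_, _, .seq hr (runs_set _ _ _), ?_, ha.trans (agree_setReg _ _ le_rfl), ?_⟩
  · simpa [RAMExpr.cost] using ht
  · simp [RAMExpr.eval, hv, ha.1]

theorem map₂ (op : ℕ → ℕ → ℕ) (e : RAMExpr → RAMExpr → RAMExpr)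
    (he : ∀ a b s, (e a b).eval s = op (a.eval s) (b.eval s))
    (hf : PolyVal f) (hg : PolyVal g) : PolyVal fun s => op (f s) (g s) := by
  obtain ⟨k₁, hk₁, hd₁, hf⟩ := hf
  obtain ⟨k₂, hk₂, hd₂, hg⟩ := hg
  refine ⟨max k₁ k₂, by omega, fun s s' h => ?_, fun k hk => ?_⟩
  · simp only
    rw [hd₁ s s' (h.mono (le_max_left _ _)), hd₂ s s' (h.mono (le_max_right _ _))]
  obtain ⟨P, T, hP⟩ := hf k (by omega)
  -- The second value goes to register `k + 1`, so that the first one in register `k` survives its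
  -- computation.
  obtain ⟨Q, U, hQ⟩ := hg (k + 1) (by omega)
  let a : RAMExpr := e (.reg k) (.reg (k + 1))
  refine ⟨.seq P (.seq Q (.set k a)), T + (U + Polynomial.C (a.cost + 1)), fun s => ?_⟩
  obtain ⟨t, s', hr, ht, ha, hv⟩ := hP s
  obtain ⟨t', s'', hr', ht', ha', hv'⟩ := hQ s'
  refine ⟨_, _, .seq hr (.seq hr' (runs_set _ _ _)), ?_,
    ha.trans ((ha'.mono (by omega)).trans (agree_setReg _ _ le_rfl)), ?_⟩
  · rw [ha.2 0 (by omega)] at ht'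
    simp only [Polynomial.eval_add, Polynomial.eval_C]
    omega
  · simp only [a, reg_setReg, if_true, he, RAMExpr.eval]
    rw [hv', ha'.2 k (by omega), hv, hd₂ s s' (ha.mono (by omega))]

theorem add (hf : PolyVal f) (hg : PolyVal g) : PolyVal fun s => f s + g s :=
  map₂ (· + ·) .add (fun _ _ _ => rfl) hf hg

theorem sub (hf : PolyVal f) (hg : PolyVal g) : PolyVal fun s => f s - g s :=
  map₂ (· - ·) .sub (fun _ _ _ => rfl) hf hg

theorem const_mul (c : ℕ) (hf : PolyVal f) : PolyVal fun s => c * f s := by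
  induction c with
  | zero => simpa using const 0
  | succ c ih => simpa [add_mul] using ih.add hf

theorem cond {h : RAMState → ℕ} (hh : PolyVal h) (hf : PolyVal f) (hg : PolyVal g) :
    PolyVal fun s => if h s = 0 then g s else f s := by
  obtain ⟨k₀, hk₀, hd₀, hh⟩ := hh
  obtain ⟨k₁, hk₁, hd₁, hf⟩ := hf
  obtain ⟨k₂, hk₂, hd₂, hg⟩ := hg
  refine ⟨max k₀ (max k₁ k₂), by omega, fun s s' a => ?_, fun k hk => ?_⟩
  · simp only
    rw [hd₀ s s' (a.mono (by omega)), hd₁ s s' (a.mono (by omega)), hd₂ s s' (a.mono (by omega))]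
  obtain ⟨R, V, hR⟩ := hh k (by omega)
  obtain ⟨P, T, hP⟩ := hf k (by omega)
  obtain ⟨Q, U, hQ⟩ := hg k (by omega)
  refine ⟨.seq R (.ite (.reg k) P Q), V + (T + U + 2), fun s => ?_⟩
  obtain ⟨t, s', hr, ht, ha, hv⟩ := hR s
  have h0 := ha.2 0 (by omega)
  by_cases hs : h s = 0
  · obtain ⟨t', s'', hr', ht', ha', hv'⟩ := hQ s'
    refine ⟨_, _, .seq hr (.ite_false (by simpa [RAMExpr.eval, hv] using hs) hr'), ?_,
      ha.trans ha', ?_⟩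
    · rw [h0] at ht'
      simp only [RAMExpr.cost, Polynomial.eval_add, Polynomial.eval_ofNat]
      omega
    · simp [hs, hv', hd₂ s s' (ha.mono (by omega))]
  · obtain ⟨t', s'', hr', ht', ha', hv'⟩ := hP s'
    refine ⟨_, _, .seq hr (.ite_true (by simpa [RAMExpr.eval, hv] using hs) hr'), ?_,
      ha.trans ha', ?_⟩
    · rw [h0] at ht'
      simp only [RAMExpr.cost, Polynomial.eval_add, Polynomial.eval_ofNat]
      omega
    · simp [hs, hv', hd₁ s s' (ha.mono (by omega))]

/-- Summation over all values below the content of register `0` of the register `x`. -/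
theorem sum {x : ℕ} (hx : x ≠ 0) (hf : PolyVal f) :
    PolyVal fun s => ∑ i ∈ Finset.range (s.reg 0), f (s.setReg x i) := by
  obtain ⟨k₀, hk₀, hd, hf⟩ := hf
  refine ⟨max k₀ (x + 1), by omega, fun s s' h => ?_, fun k hk => ?_⟩
  · simp only
    rw [h.2 0 (by omega)]
    exact Finset.sum_congr rfl fun i _ => hd _ _ ((h.mono (by omega)).setReg x i)
  obtain ⟨P, T, hP⟩ := hf (k + 2) (by omega)
  -- Register `k` accumulates the sum, `k + 1` keeps the old content of `x` for its restoration, and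
  -- `k + 2` receives the summand. The loop counter is `x` itself, so the summation index runs
  -- downwards and the invariant describes the terms from `m` on.
  let body : RAMProg := .seq (.set x (.sub (.reg x) (.const 1)))
    (.seq P (.set k (.add (.reg k) (.reg (k + 2)))))
  refine ⟨.seq (.set (k + 1) (.reg x)) (.seq (.set x (.reg 0)) (.seq (.set k (.const 0))
    (.seq (.loop (.reg x) body) (.set x (.reg (k + 1)))))),
    10 + Polynomial.X * (T + 10), fun s => ?_⟩
  let Inv : ℕ → RAMState → Prop := fun m u => m ≤ s.reg 0 ∧ u.mem = s.mem ∧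
    (∀ y < k, y ≠ x → u.reg y = s.reg y) ∧ u.reg (k + 1) = s.reg x ∧
    u.reg k = ∑ i ∈ Finset.Ico m (s.reg 0), f (s.setReg x i)
  have hbody : ∀ m u, Inv (m + 1) u → u.reg x = m + 1 →
      ∃ t u', body.Runs u t u' ∧ t ≤ T.eval (s.reg 0) + 8 ∧ Inv m u' ∧ u'.reg x = m := by
    rintro m u ⟨hm, hmem, hreg, hsave, hsum⟩ hux
    obtain ⟨t, v, hr, ht, ha, hv⟩ := hP (u.setReg x m)
    have h1 : (RAMExpr.sub (.reg x) (.const 1)).eval u = m := by simp [RAMExpr.eval, hux]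
    have h2 := runs_set x (.sub (.reg x) (.const 1)) u
    rw [h1] at h2
    refine ⟨_, _, .seq h2 (.seq hr (runs_set _ _ _)), ?_, ⟨by omega, ?_, ?_, ?_, ?_⟩, ?_⟩
    · have : (u.setReg x m).reg 0 = s.reg 0 := by
        simp [hx.symm, hreg 0 (by omega) hx.symm]
      rw [this] at ht
      simp only [RAMExpr.cost]
      omega
    · simp [ha.1, hmem]
    · intro y hy hyx
      simp [show y ≠ k by omega, ha.2 y (by omega), hyx, hreg y hy hyx]
    · simp [ha.2 (k + 1) (by omega), show k + 1 ≠ x by omega, hsave]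
    · have h3 : f (u.setReg x m) = f (s.setReg x m) := by
        refine hd _ _ ⟨by simp [hmem], fun y hy => ?_⟩
        by_cases hyx : y = x
        · simp [hyx]
        · simp [hyx, hreg y (by omega) hyx]
      rw [Finset.sum_eq_sum_Ico_succ_bot (by omega)]
      simp [RAMExpr.eval, hv, h3, ha.2 k (by omega), show k ≠ x by omega, hsum, add_comm]
    · simp [show x ≠ k by omega, ha.2 x (by omega)]
  let u₀ := ((s.setReg (k + 1) (s.reg x)).setReg x (s.reg 0)).setReg k 0
  obtain ⟨t, s', hr, ht, -, hmem, hreg, hsave, hsum⟩ :=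
    runs_loop_countdown Inv hbody (s.reg 0) u₀
      ⟨le_rfl, rfl, fun y hy hyx => by
        simp [u₀, show y ≠ k by omega, hyx, show y ≠ k + 1 by omega],
        by simp [u₀, show k + 1 ≠ x by omega], by simp [u₀]⟩
      (by simp [u₀, show x ≠ k by omega])
  have hu₀ : (RAMProg.set k (.const 0)).Runs ((s.setReg (k + 1) (s.reg x)).setReg x (s.reg 0))
      2 u₀ := runs_set _ _ _
  have hu₁ : (RAMProg.set x (.reg 0)).Runs (s.setReg (k + 1) (s.reg x)) 2
      ((s.setReg (k + 1) (s.reg x)).setReg x (s.reg 0)) := by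
    simpa [RAMExpr.eval, RAMExpr.cost] using runs_set x (.reg 0) (s.setReg (k + 1) (s.reg x))
  refine ⟨_, _, .seq (runs_set _ _ _) (.seq hu₁ (.seq hu₀ (.seq hr (runs_set _ _ _)))), ?_,
    ⟨?_, ?_⟩, ?_⟩
  · simp only [RAMExpr.cost, Polynomial.eval_add, Polynomial.eval_mul, Polynomial.eval_X,
      Polynomial.eval_ofNat]
    nlinarith
  · simp [hmem]
  · intro y hy
    by_cases hyx : y = x
    · simp [hyx, RAMExpr.eval, hsave]
    · simp [hyx, hreg y hy hyx]
  · simp [show k ≠ x by omega, hsum]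

end PolyVal

/-! ### Properties decidable in polynomial time -/

open Classical in
/-- The property `p` of states is decided in polynomial time. -/
def PolyDec (p : RAMState → Prop) : Prop := PolyVal fun s => if p s then 1 else 0

namespace PolyDec

variable {p q : RAMState → Prop} {f g : RAMState → ℕ}

theorem congr (hp : PolyDec p) (h : ∀ s, p s ↔ q s) : PolyDec q := by
  rwa [show q = p from funext fun s => propext (h s).symm]

theorem ne_zero (hf : PolyVal f) : PolyDec fun s => f s ≠ 0 := by
  have := PolyVal.cond hf (PolyVal.const 1) (PolyVal.const 0)
  unfold PolyDec
  convert this using 2 with s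
  by_cases h : f s = 0 <;> simp [h]

theorem not (hp : PolyDec p) : PolyDec fun s => ¬ p s := by
  have := PolyVal.cond hp (PolyVal.const 0) (PolyVal.const 1)
  unfold PolyDec
  convert this using 2 with s
  by_cases h : p s <;> simp [h]

theorem and (hp : PolyDec p) (hq : PolyDec q) : PolyDec fun s => p s ∧ q s := by
  have := PolyVal.cond hp hq (PolyVal.const 0)
  unfold PolyDec
  convert this using 2 with s
  by_cases h : p s <;> by_cases h' : q s <;> simp [h, h']

theorem or (hp : PolyDec p) (hq : PolyDec q) : PolyDec fun s => p s ∨ q s :=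
  (hp.not.and hq.not).not.congr fun s => by tauto

theorem imp (hp : PolyDec p) (hq : PolyDec q) : PolyDec fun s => p s → q s :=
  (hp.not.or hq).congr fun s => by tauto

theorem le (hf : PolyVal f) (hg : PolyVal g) : PolyDec fun s => f s ≤ g s :=
  (ne_zero (hf.sub hg)).not.congr fun s => by omega

theorem lt (hf : PolyVal f) (hg : PolyVal g) : PolyDec fun s => f s < g s :=
  (le hg hf).not.congr fun s => by omega

theorem eq (hf : PolyVal f) (hg : PolyVal g) : PolyDec fun s => f s = g s :=
  ((le hf hg).and (le hg hf)).congr fun s => by omega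

/-- A bounded existential quantifier says that a sum of indicators does not vanish. -/
theorem exists_lt {x : ℕ} (hx : x ≠ 0) (hp : PolyDec p) :
    PolyDec fun s => ∃ i < s.reg 0, p (s.setReg x i) := by
  refine (ne_zero (PolyVal.sum hx hp)).congr fun s => ?_
  simp

theorem forall_lt {x : ℕ} (hx : x ≠ 0) (hp : PolyDec p) :
    PolyDec fun s => ∀ i < s.reg 0, p (s.setReg x i) :=
  (exists_lt hx hp.not).not.congr fun s => by simp

theorem forall_list {ι : Type*} (l : List ι) {p : ι → RAMState → Prop}
    (hp : ∀ i ∈ l, PolyDec (p i)) : PolyDec fun s => ∀ i ∈ l, p i s := by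
  induction l with
  | nil => exact (le (PolyVal.const 0) (PolyVal.const 0)).congr fun s => by simp
  | cons i l ih =>
    exact ((hp i (by simp)).and (ih fun j hj => hp j (by simp [hj]))).congr fun s => by simp

theorem exists_list {ι : Type*} (l : List ι) {p : ι → RAMState → Prop}
    (hp : ∀ i ∈ l, PolyDec (p i)) : PolyDec fun s => ∃ i ∈ l, p i s :=
  (forall_list l fun i hi => (hp i hi).not).not.congr fun s => by push Not; rfl

end PolyDec
/-! ### Transformations of states computable in polynomial time -/

/-- There is a program that, started in a state with `pre g s`, halts after a number of steps
polynomial in the content of register `0` in a state `s'` with `post g s s'`; the program and the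
polynomial do not depend on `g` and `s`. -/
def PolyExec {γ : Type*} (pre : γ → RAMState → Prop) (post : γ → RAMState → RAMState → Prop) :
    Prop :=
  ∃ (P : RAMProg) (T : Polynomial ℕ), ∀ g s, pre g s →
    ∃ t s', P.Runs s t s' ∧ t ≤ T.eval (s.reg 0) ∧ post g s s'

namespace PolyExec

open RAMProg

variable {γ : Type*} {pre pre' : γ → RAMState → Prop} {post post' : γ → RAMState → RAMState → Prop}
  {f a : RAMState → ℕ} {p : RAMState → Prop}

theorem weaken (h : PolyExec pre post) (hpre : ∀ g s, pre' g s → pre g s)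
    (hpost : ∀ g s s', pre' g s → post g s s' → post' g s s') : PolyExec pre' post' := by
  obtain ⟨P, T, h⟩ := h
  refine ⟨P, T, fun g s hs => ?_⟩
  obtain ⟨t, s', hr, ht, hp⟩ := h g s (hpre g s hs)
  exact ⟨t, s', hr, ht, hpost g s s' hs hp⟩

theorem skip : PolyExec (fun (_ : γ) _ => True) fun _ s s' => s' = s :=
  ⟨.skip, 1, fun _ s _ => ⟨_, _, .skip s, by simp, rfl⟩⟩

theorem set (K x : ℕ) (hf : PolyVal f) :
    PolyExec (fun (_ : γ) _ => True) fun _ s s' => Agree K (s.setReg x (f s)) s' := by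
  obtain ⟨k₀, hk₀, -, hf⟩ := hf
  obtain ⟨P, T, hP⟩ := hf (max k₀ K) (le_max_left _ _)
  refine ⟨.seq P (.set x (.reg (max k₀ K))), T + 2, fun _ s _ => ?_⟩
  obtain ⟨t, s', hr, ht, ha, hv⟩ := hP s
  refine ⟨_, _, .seq hr (runs_set _ _ _), ?_, ?_⟩
  · simpa [RAMExpr.cost] using ht
  · simpa [RAMExpr.eval, hv] using (ha.mono (le_max_right _ _)).setReg x (f s)

theorem store (K : ℕ) (ha : PolyVal a) (hf : PolyVal f) :
    PolyExec (fun (_ : γ) _ => True) fun _ s s' => Agree K (s.setMem (a s) (f s)) s' := by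
  obtain ⟨k₀, hk₀, -, ha⟩ := ha
  obtain ⟨k₁, hk₁, hd, hf⟩ := hf
  set k := max k₀ (max k₁ K)
  obtain ⟨P, T, hP⟩ := ha k (by omega)
  obtain ⟨Q, U, hQ⟩ := hf (k + 1) (by omega)
  refine ⟨.seq P (.seq Q (.store (.reg k) (.reg (k + 1)))), T + (U + 3), fun _ s _ => ?_⟩
  obtain ⟨t, s', hr, ht, ha, hv⟩ := hP s
  obtain ⟨t', s'', hr', ht', ha', hv'⟩ := hQ s'
  refine ⟨_, _, .seq hr (.seq hr' (runs_store _ _ _)), ?_, ?_⟩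
  · rw [ha.2 0 (by omega)] at ht'
    simp only [RAMExpr.cost, Polynomial.eval_add, Polynomial.eval_ofNat]
    omega
  · have h1 : s''.reg k = a s := by rw [ha'.2 k (by omega), hv]
    have h2 : s''.reg (k + 1) = f s := by rw [hv', hd s s' (ha.mono (by omega))]
    simpa [RAMExpr.eval, h1, h2] using
      ((ha.mono (by omega)).trans (ha'.mono (by omega))).setMem (a s) (f s)

theorem seq {pre₂ : γ → RAMState → Prop} {post₂ : γ → RAMState → RAMState → Prop}
    (h₁ : PolyExec pre post) (h₂ : PolyExec pre₂ post₂)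
    (h : ∀ g s s', pre g s → post g s s' → pre₂ g s' ∧ s'.reg 0 = s.reg 0) :
    PolyExec pre fun g s s' => ∃ u, post g s u ∧ post₂ g u s' := by
  obtain ⟨P, T, hP⟩ := h₁
  obtain ⟨Q, U, hQ⟩ := h₂
  refine ⟨.seq P Q, T + U, fun g s hs => ?_⟩
  obtain ⟨t, u, hr, ht, hp⟩ := hP g s hs
  obtain ⟨hu, h0⟩ := h g s u hs hp
  obtain ⟨t', s', hr', ht', hp'⟩ := hQ g u hu
  refine ⟨_, _, .seq hr hr', ?_, u, hp, hp'⟩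
  rw [h0] at ht'
  simp only [Polynomial.eval_add]
  omega

/-- A conditional; the test may change late registers. -/
theorem cond (K : ℕ) (hp : PolyDec p) (h₁ : PolyExec pre post)
    {pre₀ : γ → RAMState → Prop}
    (h : ∀ g s s', pre₀ g s → Agree K s s' → (p s → pre g s') ∧ (¬ p s → pre' g s'))
    (h₂ : PolyExec pre' post') :
    PolyExec pre₀ fun g s s' => ∃ u, Agree K s u ∧ (p s → post g u s') ∧ (¬ p s → post' g u s') := by
  obtain ⟨k₀, hk₀, -, hf⟩ := hp
  obtain ⟨R, V, hR⟩ := hf (max k₀ K) (le_max_left _ _)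
  obtain ⟨P, T, hP⟩ := h₁
  obtain ⟨Q, U, hQ⟩ := h₂
  refine ⟨.seq R (.ite (.reg (max k₀ K)) P Q), V + (T + U + 2), fun g s hs => ?_⟩
  obtain ⟨t, s', hr, ht, ha, hv⟩ := hR s
  have h0 := ha.2 0 (by omega)
  have ha' := ha.mono (le_max_right k₀ K)
  by_cases hps : p s
  · obtain ⟨t', s'', hr', ht', hp'⟩ := hP g s' ((h g s s' hs ha').1 hps)
    refine ⟨_, _, .seq hr (.ite_true (by simp [RAMExpr.eval, hv, hps]) hr'), ?_, s', ha',
      fun _ => hp', fun h => absurd hps h⟩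
    rw [h0] at ht'
    simp only [RAMExpr.cost, Polynomial.eval_add, Polynomial.eval_ofNat]
    omega
  · obtain ⟨t', s'', hr', ht', hp'⟩ := hQ g s' ((h g s s' hs ha').2 hps)
    refine ⟨_, _, .seq hr (.ite_false (by simp [RAMExpr.eval, hv, hps]) hr'), ?_, s', ha',
      fun h => absurd h hps, fun _ => hp'⟩
    rw [h0] at ht'
    simp only [RAMExpr.cost, Polynomial.eval_add, Polynomial.eval_ofNat]
    omega

/-- A loop with the invariant `I` that counts the register `x` down to `0`. -/
theorem loop {x : ℕ} (hx : x ≠ 0) (N : Polynomial ℕ) {I J : γ → RAMState → Prop}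
    (hIJ : ∀ g s, I g s → s.reg x ≠ 0 → J g (s.setReg x (s.reg x - 1)))
    (hbody : PolyExec J fun g s s' => I g s' ∧ s'.reg x = s.reg x ∧ s'.reg 0 = s.reg 0) :
    PolyExec (fun g s => I g s ∧ s.reg x ≤ N.eval (s.reg 0)) fun g s s' =>
      I g s' ∧ s'.reg x = 0 ∧ s'.reg 0 = s.reg 0 := by
  obtain ⟨P, T, hP⟩ := hbody
  refine ⟨.loop (.reg x) (.seq (.set x (.sub (.reg x) (.const 1))) P), N * (T + 6) + 2,
    fun g s ⟨hs, hN⟩ => ?_⟩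
  obtain ⟨t, s', hr, ht, hI, h0, hx0⟩ := runs_loop_countdown (x := x) (B := T.eval (s.reg 0) + 4)
    (body := .seq (.set x (.sub (.reg x) (.const 1))) P)
    (fun m u => I g u ∧ u.reg 0 = s.reg 0 ∧ u.reg x = m) (by
      rintro m u ⟨hu, hu0, -⟩ hux
      have h1 := runs_set x (.sub (.reg x) (.const 1)) u
      obtain ⟨t, u', hr, ht, hI, hx', h0'⟩ := hP g _ (hIJ g u hu (by omega))
      have h2 : (u.setReg x (u.reg x - 1)).reg 0 = s.reg 0 := by simp [hx.symm, hu0]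
      have h3 : u'.reg x = m := by rw [hx']; simp [hux]
      refine ⟨_, u', .seq h1 hr, ?_, ⟨hI, by rw [h0', h2], h3⟩, h3⟩
      rw [h2] at ht
      simp only [RAMExpr.cost]
      omega) (s.reg x) s ⟨hs, rfl, rfl⟩ rfl
  refine ⟨t, s', hr, ?_, hI, hx0, h0⟩
  have := Nat.mul_le_mul_right (T.eval (s.reg 0) + 6) hN
  rw [show T.eval (s.reg 0) + 4 + 2 = T.eval (s.reg 0) + 6 by ring] at ht
  simp only [Polynomial.eval_add, Polynomial.eval_mul, Polynomial.eval_ofNat]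
  omega

end PolyExec

/-! ### Search for the contents of some registers -/

namespace RAMState

/-- The registers in the list can be given contents below the content of register `0` such that
`p` is satisfied. -/
def ExistsRegs (p : RAMState → Prop) : List ℕ → RAMState → Prop
  | [], s => p s
  | x :: l, s => ∃ i < s.reg 0, ExistsRegs p l (s.setReg x i)

theorem existsRegs_of_forall {p : RAMState → Prop} {l : List ℕ} (hl : 0 ∉ l) {v : ℕ → ℕ}
    {s : RAMState} (hv : ∀ x ∈ l, v x < s.reg 0)
    (hp : ∀ s', s'.mem = s.mem → (∀ y, s'.reg y = if y ∈ l then v y else s.reg y) → p s') :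
    ExistsRegs p l s := by
  induction l generalizing s with
  | nil => exact hp s rfl (by simp)
  | cons x l ih =>
    simp only [List.mem_cons, not_or] at hl
    refine ⟨v x, hv x (by simp), ih hl.2 (fun y hy => ?_) fun s' hm hr => hp s' hm fun y => ?_⟩
    · simpa [hl.1] using hv y (by simp [hy])
    · rw [hr y]
      by_cases h1 : y ∈ l <;> by_cases h2 : y = x <;> simp [h1, h2]

theorem existsRegs_agree {p : RAMState → Prop} {K : ℕ} (hK : 0 < K)
    (hp : ∀ s s' : RAMState, Agree K s s' → p s → p s') {l : List ℕ} {s s' : RAMState}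
    (h : Agree K s s') (hs : ExistsRegs p l s) : ExistsRegs p l s' := by
  induction l generalizing s s' with
  | nil => exact hp s s' h hs
  | cons x l ih =>
    obtain ⟨i, hi, hs⟩ := hs
    exact ⟨i, by rwa [h.2 0 hK], ih (h.setReg x i) hs⟩

end RAMState

theorem PolyDec.existsRegs {p : RAMState → Prop} (hp : PolyDec p) {l : List ℕ} (hl : 0 ∉ l) :
    PolyDec (ExistsRegs p l) := by
  induction l with
  | nil => exact hp
  | cons x l ih =>
    simp only [List.mem_cons, not_or] at hl
    exact PolyDec.exists_lt (Ne.symm hl.1) (ih hl.2)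

theorem PolyDec.agree {p : RAMState → Prop} (hp : PolyDec p) :
    ∃ K, 0 < K ∧ ∀ s s', Agree K s s' → p s → p s' := by
  obtain ⟨K, hK, hd, -⟩ := hp
  refine ⟨K, hK, fun s s' h hs => ?_⟩
  by_contra hs'
  simpa [hs, hs'] using hd s s' h

/-- The least value of the register `x` for which `p` holds is computable. -/
theorem PolyVal.least {p : RAMState → Prop} (hp : PolyDec p) {x : ℕ} (hx : x ≠ 0) :
    ∃ f, PolyVal f ∧ ∀ s : RAMState, (∃ i < s.reg 0, p (s.setReg x i)) → p (s.setReg x (f s)) := by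
  classical
  obtain ⟨K, hK, hd⟩ := hp.agree
  -- The auxiliary register `z` lies beyond all registers that influence `p`, so that its content is
  -- irrelevant for `p`.
  set z := max K (x + 1)
  have hz : z ≠ x := by omega
  have h1 := PolyDec.exists_lt hx (hp.and (PolyDec.le (PolyVal.reg x) (PolyVal.reg z)))
  refine ⟨_, PolyVal.sum (x := z) (by omega) h1.not, ?_⟩
  intro s hs
  have h2 : ∀ i j, p ((s.setReg z i).setReg x j) ↔ p (s.setReg x j) := fun i j =>
    have := (agree_setReg s i (show K ≤ z by omega)).setReg x j
    ⟨hd _ _ this.symm, hd _ _ this⟩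
  -- The least solution equals the number of indices `i` for which there is no solution `j ≤ i`.
  have h3 : ∑ i ∈ Finset.range (s.reg 0), (if ¬ ∃ j < (s.setReg z i).reg 0,
      p ((s.setReg z i).setReg x j) ∧ ((s.setReg z i).setReg x j).reg x ≤
        ((s.setReg z i).setReg x j).reg z then 1 else 0) = Nat.find hs := by
    rw [Finset.sum_boole]
    have : Finset.filter (fun i => ¬ ∃ j < (s.setReg z i).reg 0,
        p ((s.setReg z i).setReg x j) ∧ ((s.setReg z i).setReg x j).reg x ≤
        ((s.setReg z i).setReg x j).reg z) (Finset.range (s.reg 0)) =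
        Finset.range (Nat.find hs) := by
      have h0 : (0 : ℕ) ≠ z := by omega
      ext i
      simp only [Finset.mem_filter, Finset.mem_range, h2, reg_setReg, if_true, hz, if_false, h0]
      constructor
      · rintro ⟨-, hi⟩
        by_contra h
        exact hi ⟨Nat.find hs, (Nat.find_spec hs).1, (Nat.find_spec hs).2, by omega⟩
      · intro hi
        refine ⟨hi.trans (Nat.find_spec hs).1, ?_⟩
        rintro ⟨j, hj, hpj, hji⟩
        exact Nat.find_min hs (lt_of_le_of_lt hji hi) ⟨hj, hpj⟩
    rw [this]
    simp
  convert (Nat.find_spec hs).2 using 2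
  convert h3

/-- The registers are fixed one after the other, each to the least content for which the remaining
ones can still be completed; no backtracking is needed. The list is fixed, so the nested searches
take polynomial time. -/
theorem PolyExec.find {γ : Type*} {p : RAMState → Prop} (hp : PolyDec p) {K : ℕ} (hK : 0 < K)
    (hpK : ∀ s s' : RAMState, Agree K s s' → p s → p s') {l : List ℕ} (hl : 0 ∉ l) :
    PolyExec (fun (_ : γ) _ => True) fun _ s s' => s'.mem = s.mem ∧
      (∀ y < K, y ∉ l → s'.reg y = s.reg y) ∧ (ExistsRegs p l s → p s') := by
  induction l with
  | nil => exact skip.weaken (fun _ _ _ => trivial) (by rintro _ s _ - rfl; simp [ExistsRegs])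
  | cons x l ih =>
    simp only [List.mem_cons, not_or] at hl
    obtain ⟨f, hf, hfs⟩ := PolyVal.least (hp.existsRegs hl.2) (Ne.symm hl.1)
    refine ((PolyExec.set K x hf).seq (ih hl.2) fun _ s s' _ h => ⟨trivial, ?_⟩).weaken
      (fun _ _ _ => trivial) ?_
    · rw [h.2 0 hK]
      simp [hl.1]
    · rintro _ s s' - ⟨u, hu, hm, hr, he⟩
      refine ⟨hm.trans hu.1, fun y hy hyl => ?_, fun hs => he ?_⟩
      · simp only [List.mem_cons, not_or] at hyl
        rw [hr y hy hyl.2, hu.2 y hy]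
        simp [hyl.1]
      · exact existsRegs_agree hK hpK hu (hfs s hs)
/-! ### Extensions of matchings -/

section Extension

variable {V : Type*}

open Classical in
/-- The vertices that are isolated in `G - C`. -/
noncomputable def isolatedOutside [Fintype V] (G : SimpleGraph V) (C : Finset V) : Finset V :=
  {v | v ∉ C ∧ ∀ w, G.Adj v w → w ∈ C}

open Classical in
/-- The vertices of `G - C` all of whose neighbors belong to `G - C`. -/
noncomputable def fullOutside [Fintype V] (G : SimpleGraph V) (C : Finset V) : Finset V :=
  {v | v ∉ C ∧ ∀ w, G.Adj v w → w ∉ C}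

/-- The potential that guides the greedy algorithm. -/
noncomputable def potential [Fintype V] (c : ℕ) (G : SimpleGraph V) (C : Finset V) : ℕ :=
  c * (isolatedOutside G C).card + (fullOutside G C).card

/-- The set `N` represents a matching in `G - C`. -/
structure IsExtension (G : SimpleGraph V) (C : Finset V) (N : Finset (V × V)) : Prop where
  adj : ∀ e ∈ N, G.Adj e.1 e.2
  fst_notMem : ∀ e ∈ N, e.1 ∉ C
  snd_notMem : ∀ e ∈ N, e.2 ∉ C
  disjoint : ∀ e ∈ N, ∀ f ∈ N, e = f ∨ (e.1 ≠ f.1 ∧ e.1 ≠ f.2 ∧ e.2 ≠ f.1 ∧ e.2 ≠ f.2)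

open Classical in
/-- The vertices covered by a set of pairs. -/
noncomputable def pairVerts (N : Finset (V × V)) : Finset V := N.image Prod.fst ∪ N.image Prod.snd

theorem mem_pairVerts {N : Finset (V × V)} {v : V} :
    v ∈ pairVerts N ↔ ∃ e ∈ N, v = e.1 ∨ v = e.2 := by
  simp only [pairVerts, Finset.mem_union, Finset.mem_image]
  constructor
  · rintro (⟨e, he, rfl⟩ | ⟨e, he, rfl⟩)
    exacts [⟨e, he, .inl rfl⟩, ⟨e, he, .inr rfl⟩]
  · rintro ⟨e, he, rfl | rfl⟩
    exacts [.inl ⟨e, he, rfl⟩, .inr ⟨e, he, rfl⟩]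

/-- A matching covering `C` whose potential is not too small can be extended, by at most `k` edges,
to a matching whose potential is not too small, unless it is maximal. -/
def GreedyExtendable [Fintype V] [DecidableEq V] (k c D : ℕ) (G : SimpleGraph V) : Prop :=
  ∀ C : Finset V, Fintype.card V ≤ potential c G C + D → (∃ u v, G.Adj u v ∧ u ∉ C ∧ v ∉ C) →
    ∃ N : Finset (V × V), N.Nonempty ∧ N.card ≤ k ∧ IsExtension G C N ∧
      Fintype.card V ≤ potential c G (C ∪ pairVerts N) + D

end Extension

/-! ### The greedy algorithm: one step -/

open Classical in
theorem PolyVal.count {p : RAMState → ℕ → Prop} {x : ℕ} (hx : x ≠ 0)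
    (hp : PolyDec fun s => p s (s.reg x)) (hpx : ∀ s i, p (s.setReg x i) = p s) :
    PolyVal fun s => ((Finset.range (s.reg 0)).filter fun i => p s i).card := by
  have := PolyVal.sum hx hp
  convert this using 2 with s
  rw [Finset.card_filter]
  refine Finset.sum_congr rfl fun i _ => if_congr ?_ rfl rfl
  simp [hpx]

namespace RAMState

/-- The entry in row `a` and column `b` of the matrix in the memory. -/
def cell (s : RAMState) (a b : ℕ) : ℕ := s.mem (a * s.reg 0 + b)

/-- Row `a` of the matrix contains the entry `2`. -/
def Covered (s : RAMState) (a : ℕ) : Prop := ∃ b < s.reg 0, s.cell a b = 2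

/-- The register for the first vertex of the `i`th pair. -/
def fstReg (s : RAMState) (i : ℕ) : ℕ := s.reg (5 + 2 * i)

/-- The register for the second vertex of the `i`th pair. -/
def sndReg (s : RAMState) (i : ℕ) : ℕ := s.reg (6 + 2 * i)

/-- The vertex is covered, or belongs to one of the first `k` pairs. -/
def NewCovered (k : ℕ) (s : RAMState) (a : ℕ) : Prop :=
  s.Covered a ∨ ∃ i ∈ List.range k, a = s.fstReg i ∨ a = s.sndReg i

def NewIsolated (k : ℕ) (s : RAMState) (v : ℕ) : Prop :=
  ¬ s.NewCovered k v ∧ ∀ w < s.reg 0, s.cell v w ≠ 0 → s.NewCovered k w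

def NewFull (k : ℕ) (s : RAMState) (v : ℕ) : Prop :=
  ¬ s.NewCovered k v ∧ ∀ w < s.reg 0, s.cell v w ≠ 0 → ¬ s.NewCovered k w

open Classical in
/-- The first `k` pairs represent an extension of large potential. -/
def GoodPairs (k c D : ℕ) (s : RAMState) : Prop :=
  (∀ i ∈ List.range k, s.fstReg i < s.reg 0 ∧ s.sndReg i < s.reg 0 ∧
    s.cell (s.fstReg i) (s.sndReg i) ≠ 0 ∧ ¬ s.Covered (s.fstReg i) ∧ ¬ s.Covered (s.sndReg i)) ∧
  (∀ i ∈ List.range k, ∀ j ∈ List.range k,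
    (s.fstReg i = s.fstReg j ∧ s.sndReg i = s.sndReg j) ∨
    (s.fstReg i ≠ s.fstReg j ∧ s.fstReg i ≠ s.sndReg j ∧ s.sndReg i ≠ s.fstReg j ∧
      s.sndReg i ≠ s.sndReg j)) ∧
  s.reg 0 ≤ c * ((Finset.range (s.reg 0)).filter fun v => s.NewIsolated k v).card +
    ((Finset.range (s.reg 0)).filter fun v => s.NewFull k v).card + D

variable {s : RAMState} {x v : ℕ}

theorem cell_setReg (hx : x ≠ 0) : (s.setReg x v).cell = s.cell := by
  ext a b
  simp [cell, hx.symm]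

theorem covered_setReg (hx : x ≠ 0) : (s.setReg x v).Covered = s.Covered := by
  ext a
  simp [Covered, cell_setReg hx, hx.symm]

theorem newCovered_setReg (k : ℕ) (hx : x ≠ 0) (hx' : x < 5) :
    (s.setReg x v).NewCovered k = s.NewCovered k := by
  ext a
  have h1 : ∀ i, 5 + 2 * i ≠ x := by omega
  have h2 : ∀ i, 6 + 2 * i ≠ x := by omega
  simp [NewCovered, covered_setReg hx, fstReg, sndReg, h1, h2]

end RAMState

/-- The machine cannot multiply, but adding the content of register `a` up `n` times has the same
effect; this makes matrix cells addressable. -/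
theorem PolyVal.mul_reg_zero (a : ℕ) : PolyVal fun s => s.reg a * s.reg 0 := by
  have := PolyVal.sum (x := a + 1) (by omega) (PolyVal.reg a)
  simpa [mul_comm] using this

theorem PolyVal.cell (a b : ℕ) : PolyVal fun s => s.cell (s.reg a) (s.reg b) :=
  ((PolyVal.mul_reg_zero a).add (PolyVal.reg b)).load

theorem PolyDec.covered (a : ℕ) : PolyDec fun s => s.Covered (s.reg a) := by
  refine (PolyDec.exists_lt (x := a + 1) (by omega)
    (PolyDec.eq (PolyVal.cell a (a + 1)) (PolyVal.const 2))).congr fun s => ?_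
  simp [Covered, cell_setReg]

theorem PolyDec.newCovered (k a : ℕ) : PolyDec fun s => s.NewCovered k (s.reg a) :=
  (PolyDec.covered a).or (PolyDec.exists_list (List.range k) fun i _ =>
    (PolyDec.eq (PolyVal.reg a) (PolyVal.reg (5 + 2 * i))).or
      (PolyDec.eq (PolyVal.reg a) (PolyVal.reg (6 + 2 * i))))

theorem PolyDec.newIsolated (k : ℕ) : PolyDec fun s => s.NewIsolated k (s.reg 1) := by
  refine (PolyDec.newCovered k 1).not.and ((PolyDec.forall_lt (x := 2) (by omega)
    ((PolyDec.ne_zero (PolyVal.cell 1 2)).imp (PolyDec.newCovered k 2))).congr fun s => ?_)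
  simp [cell_setReg, newCovered_setReg]

theorem PolyDec.newFull (k : ℕ) : PolyDec fun s => s.NewFull k (s.reg 1) := by
  refine (PolyDec.newCovered k 1).not.and ((PolyDec.forall_lt (x := 2) (by omega)
    ((PolyDec.ne_zero (PolyVal.cell 1 2)).imp (PolyDec.newCovered k 2).not)).congr fun s => ?_)
  simp [cell_setReg, newCovered_setReg]

theorem PolyDec.goodPairs (k c D : ℕ) : PolyDec (GoodPairs k c D) := by
  refine (PolyDec.forall_list _ fun i _ => ?_).and
    ((PolyDec.forall_list _ fun i _ => PolyDec.forall_list _ fun j _ => ?_).and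
      (PolyDec.le (PolyVal.reg 0) (((PolyVal.const_mul c ?_).add ?_).add (PolyVal.const D))))
  · have h0 : PolyVal fun s => s.reg 0 := PolyVal.reg 0
    have hx : PolyVal fun s => s.fstReg i := PolyVal.reg _
    have hy : PolyVal fun s => s.sndReg i := PolyVal.reg _
    exact (PolyDec.lt hx h0).and ((PolyDec.lt hy h0).and ((PolyDec.ne_zero (PolyVal.cell _ _)).and
      ((PolyDec.covered _).not.and (PolyDec.covered _).not)))
  · have hx : ∀ i, PolyVal fun s => s.fstReg i := fun i => PolyVal.reg _
    have hy : ∀ i, PolyVal fun s => s.sndReg i := fun i => PolyVal.reg _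
    exact ((PolyDec.eq (hx i) (hx j)).and (PolyDec.eq (hy i) (hy j))).or
      ((PolyDec.eq (hx i) (hx j)).not.and ((PolyDec.eq (hx i) (hy j)).not.and
        ((PolyDec.eq (hy i) (hx j)).not.and (PolyDec.eq (hy i) (hy j)).not)))
  · refine PolyVal.count (x := 1) (by omega) (PolyDec.newIsolated k) fun s i => ?_
    ext v
    simp [NewIsolated, cell_setReg, newCovered_setReg]
  · refine PolyVal.count (x := 1) (by omega) (PolyDec.newFull k) fun s i => ?_
    ext v
    simp [NewFull, cell_setReg, newCovered_setReg]

/-- The entries given by the pairs in the list are set to `2`. -/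
theorem PolyExec.storePairs {γ : Type*} (K : ℕ) (l : List ℕ) (hl : ∀ i ∈ l, 6 + 2 * i < K) :
    PolyExec (fun (_ : γ) _ => True) fun _ s s' => (∀ y < K, s'.reg y = s.reg y) ∧
      ∀ a, ((∃ i ∈ l, a = s.fstReg i * s.reg 0 + s.sndReg i ∨
        a = s.sndReg i * s.reg 0 + s.fstReg i) → s'.mem a = 2) ∧
        ((¬ ∃ i ∈ l, a = s.fstReg i * s.reg 0 + s.sndReg i ∨
        a = s.sndReg i * s.reg 0 + s.fstReg i) → s'.mem a = s.mem a) := by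
  induction l with
  | nil => exact skip.weaken (fun _ _ _ => trivial) (by rintro _ s _ - rfl; simp)
  | cons i l ih =>
    have hi := hl i (by simp)
    have h1 : PolyVal fun s => s.fstReg i * s.reg 0 + s.sndReg i :=
      (PolyVal.mul_reg_zero _).add (PolyVal.reg _)
    have h2 : PolyVal fun s => s.sndReg i * s.reg 0 + s.fstReg i :=
      (PolyVal.mul_reg_zero _).add (PolyVal.reg _)
    refine (((PolyExec.store K h1 (PolyVal.const 2)).seq (PolyExec.store K h2 (PolyVal.const 2))
      fun _ s s' _ h => ⟨trivial, ?_⟩).seq (ih fun j hj => hl j (by simp [hj]))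
      fun _ s s' _ h => ⟨trivial, ?_⟩).weaken (fun _ _ _ => trivial) ?_
    · rw [h.2 0 (by omega)]; rfl
    · obtain ⟨u, h, h'⟩ := h
      rw [h'.2 0 (by omega)]
      simp [h.2 0 (by omega)]
    · rintro _ s s' - ⟨u, ⟨w, hw, hu⟩, hr, hm⟩
      have hw' : ∀ y < K, w.reg y = s.reg y := hw.2
      have hu' : ∀ y < K, u.reg y = s.reg y := fun y hy => (hu.2 y hy).trans (hw' y hy)
      refine ⟨fun y hy => (hr y hy).trans (hu' y hy), fun a => ?_⟩
      have hx : ∀ j ∈ i :: l, u.fstReg j = s.fstReg j := fun j hj =>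
        hu' _ (by have := hl j hj; omega)
      have hy : ∀ j ∈ i :: l, u.sndReg j = s.sndReg j := fun j hj => hu' _ (hl j hj)
      have hwx : w.fstReg i = s.fstReg i := hw' _ (by omega)
      have hwy : w.sndReg i = s.sndReg i := hw' _ (by omega)
      have h0 : w.reg 0 = s.reg 0 := hw' 0 (by omega)
      have h0' : u.reg 0 = s.reg 0 := hu' 0 (by omega)
      have hex : (∃ j ∈ l, a = u.fstReg j * u.reg 0 + u.sndReg j ∨
          a = u.sndReg j * u.reg 0 + u.fstReg j) ↔ ∃ j ∈ l, a = s.fstReg j * s.reg 0 + s.sndReg j ∨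
          a = s.sndReg j * s.reg 0 + s.fstReg j := by
        refine exists_congr fun j => and_congr_right fun hj => ?_
        rw [hx j (by simp [hj]), hy j (by simp [hj]), h0']
      have hum : u.mem a = if a = s.sndReg i * s.reg 0 + s.fstReg i then 2 else
          if a = s.fstReg i * s.reg 0 + s.sndReg i then 2 else s.mem a := by
        rw [hu.1, mem_setMem, hw.1, mem_setMem, hwx, hwy, h0]
      have := hm a
      rw [hex, hum] at this
      constructor
      · rintro ⟨j, hj, hja⟩
        by_cases h : ∃ j ∈ l, a = s.fstReg j * s.reg 0 + s.sndReg j ∨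
          a = s.sndReg j * s.reg 0 + s.fstReg j
        · exact this.1 h
        · rw [this.2 h]
          rcases List.mem_cons.1 hj with rfl | hj
          · rcases hja with h | h <;> simp [← h]
          · exact absurd ⟨j, hj, hja⟩ h
      · intro h
        simp only [List.mem_cons, exists_eq_or_imp, not_or] at h
        rw [this.2 h.2, if_neg h.1.2, if_neg h.1.1]
/-! ### The greedy algorithm: correctness -/

section Represents

variable {n : ℕ} {G : SimpleGraph (Fin n)} {R : Fin n → Fin n → Prop} {s : RAMState}

/-- `R` is the adjacency relation of a matching in `G`. -/
structure IsMatchingRel (G : SimpleGraph (Fin n)) (R : Fin n → Fin n → Prop) : Prop where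
  adj : ∀ {a b}, R a b → G.Adj a b
  symm : ∀ {a b}, R a b → R b a
  unique : ∀ {a b b'}, R a b → R a b' → b = b'

open Classical in
/-- The vertices covered by a matching. -/
noncomputable def relVerts (R : Fin n → Fin n → Prop) : Finset (Fin n) := {a | ∃ b, R a b}

theorem mem_relVerts {a : Fin n} : a ∈ relVerts R ↔ ∃ b, R a b := by simp [relVerts]

open Classical in
/-- The matrix in the memory has the entry `2` for the edges in `R`, the entry `1` for the other
edges of `G`, and the entry `0` otherwise. -/
def Represents (G : SimpleGraph (Fin n)) (R : Fin n → Fin n → Prop) (s : RAMState) : Prop :=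
  s.reg 0 = n ∧ ∀ i j : Fin n, s.cell i j = if R i j then 2 else if G.Adj i j then 1 else 0

theorem Represents.cell_eq_two (h : Represents G R s) (i j : Fin n) : s.cell i j = 2 ↔ R i j := by
  rw [h.2]
  split_ifs <;> simp_all

theorem Represents.cell_ne_zero (h : Represents G R s) (hR : IsMatchingRel G R) (i j : Fin n) :
    s.cell i j ≠ 0 ↔ G.Adj i j := by
  rw [h.2]
  have := @hR.adj i j
  split_ifs <;> simp_all

theorem Represents.covered (h : Represents G R s) (a : Fin n) :
    s.Covered a ↔ a ∈ relVerts R := by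
  rw [mem_relVerts]
  constructor
  · rintro ⟨b, hb, hab⟩
    rw [h.1] at hb
    exact ⟨⟨b, hb⟩, (h.cell_eq_two a ⟨b, hb⟩).1 hab⟩
  · rintro ⟨b, hab⟩
    exact ⟨b, h.1 ▸ b.2, (h.cell_eq_two a b).2 hab⟩

theorem Represents.newCovered (h : Represents G R s) {k : ℕ} {N : Finset (Fin n × Fin n)}
    (hN : ∀ e : Fin n × Fin n, e ∈ N ↔ ∃ i < k, s.fstReg i = e.1 ∧ s.sndReg i = e.2)
    (hlt : ∀ i < k, s.fstReg i < n ∧ s.sndReg i < n) (a : Fin n) :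
    s.NewCovered k a ↔ a ∈ relVerts R ∪ pairVerts N := by
  rw [NewCovered, h.covered, Finset.mem_union, mem_pairVerts]
  refine or_congr Iff.rfl ⟨?_, ?_⟩
  · rintro ⟨i, hi, hia⟩
    rw [List.mem_range] at hi
    refine ⟨(⟨s.fstReg i, (hlt i hi).1⟩, ⟨s.sndReg i, (hlt i hi).2⟩),
      (hN _).2 ⟨i, hi, rfl, rfl⟩, ?_⟩
    rcases hia with h | h
    · exact .inl (Fin.ext h)
    · exact .inr (Fin.ext h)
  · rintro ⟨e, he, hea⟩
    obtain ⟨i, hi, h1, h2⟩ := (hN e).1 he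
    refine ⟨i, List.mem_range.2 hi, ?_⟩
    rcases hea with rfl | rfl
    · exact .inl h1.symm
    · exact .inr h2.symm

theorem card_filter_range_eq {n : ℕ} {p : ℕ → Prop} [DecidablePred p] {S : Finset (Fin n)}
    (h : ∀ a : Fin n, p a ↔ a ∈ S) : ((Finset.range n).filter p).card = S.card := by
  rw [← Finset.card_map Fin.valEmbedding]
  congr 1
  ext x
  simp only [Finset.mem_filter, Finset.mem_range, Finset.mem_map, Fin.valEmbedding_apply]
  constructor
  · rintro ⟨hx, hp⟩
    exact ⟨⟨x, hx⟩, (h ⟨x, hx⟩).1 hp, rfl⟩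
  · rintro ⟨a, ha, rfl⟩
    exact ⟨a.2, (h a).2 ha⟩

/-- This links the numerical test made by the machine with the combinatorial notion of an extension.
`N` is the set of pairs listed in the registers, possibly with repetitions. -/
theorem Represents.goodPairs (h : Represents G R s) (hR : IsMatchingRel G R) {k c D : ℕ}
    {N : Finset (Fin n × Fin n)}
    (hN : ∀ e : Fin n × Fin n, e ∈ N ↔ ∃ i < k, s.fstReg i = e.1 ∧ s.sndReg i = e.2)
    (hlt : ∀ i < k, s.fstReg i < n ∧ s.sndReg i < n) :
    s.GoodPairs k c D ↔ IsExtension G (relVerts R) N ∧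
      n ≤ potential c G (relVerts R ∪ pairVerts N) + D := by
  classical
  have hc := h.newCovered hN hlt
  have hiso : ∀ a : Fin n, s.NewIsolated k a ↔
      a ∈ isolatedOutside G (relVerts R ∪ pairVerts N) := by
    intro a
    simp only [NewIsolated, isolatedOutside, Finset.mem_filter, Finset.mem_univ, true_and, hc, h.1]
    refine and_congr Iff.rfl ⟨fun H w hw => ?_, fun H w hw hw' => ?_⟩
    · exact (hc w).1 (H w w.2 ((h.cell_ne_zero hR a w).2 hw))
    · exact (hc ⟨w, hw⟩).2 (H ⟨w, hw⟩ ((h.cell_ne_zero hR a ⟨w, hw⟩).1 hw'))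
  have hfull : ∀ a : Fin n, s.NewFull k a ↔ a ∈ fullOutside G (relVerts R ∪ pairVerts N) := by
    intro a
    simp only [NewFull, fullOutside, Finset.mem_filter, Finset.mem_univ, true_and, hc, h.1]
    refine and_congr Iff.rfl ⟨fun H w hw => ?_, fun H w hw hw' => ?_⟩
    · exact mt (hc w).2 (H w w.2 ((h.cell_ne_zero hR a w).2 hw))
    · exact mt (hc ⟨w, hw⟩).1 (H ⟨w, hw⟩ ((h.cell_ne_zero hR a ⟨w, hw⟩).1 hw'))
  rw [RAMState.GoodPairs, h.1, card_filter_range_eq hiso, card_filter_range_eq hfull, ← and_assoc]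
  refine and_congr ⟨fun ⟨H1, H2⟩ => ?_, fun H => ⟨fun i hi => ?_, fun i hi j hj => ?_⟩⟩ Iff.rfl
  · have key : ∀ e ∈ N, G.Adj e.1 e.2 ∧ e.1 ∉ relVerts R ∧ e.2 ∉ relVerts R := by
      intro e he
      obtain ⟨i, hi, h1, h2⟩ := (hN e).1 he
      have := H1 i (List.mem_range.2 hi)
      rw [h1, h2, h.cell_ne_zero hR, h.covered, h.covered] at this
      exact this.2.2
    refine ⟨fun e he => (key e he).1, fun e he => (key e he).2.1, fun e he => (key e he).2.2,
      fun e he f hf => ?_⟩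
    obtain ⟨i, hi, h1, h2⟩ := (hN e).1 he
    obtain ⟨j, hj, h3, h4⟩ := (hN f).1 hf
    have := H2 i (List.mem_range.2 hi) j (List.mem_range.2 hj)
    rw [h1, h2, h3, h4] at this
    simpa only [Prod.ext_iff, Fin.ext_iff, ne_eq] using this
  · rw [List.mem_range] at hi
    obtain ⟨h1, h2⟩ := hlt i hi
    have he := (hN (⟨_, h1⟩, ⟨_, h2⟩)).2 ⟨i, hi, rfl, rfl⟩
    exact ⟨h1, h2, (h.cell_ne_zero hR ⟨_, h1⟩ ⟨_, h2⟩).2 (H.adj _ he),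
      mt (h.covered ⟨_, h1⟩).1 (H.fst_notMem _ he), mt (h.covered ⟨_, h2⟩).1 (H.snd_notMem _ he)⟩
  · rw [List.mem_range] at hi hj
    obtain ⟨h1, h2⟩ := hlt i hi
    obtain ⟨h3, h4⟩ := hlt j hj
    have he := (hN (⟨_, h1⟩, ⟨_, h2⟩)).2 ⟨i, hi, rfl, rfl⟩
    have hf := (hN (⟨_, h3⟩, ⟨_, h4⟩)).2 ⟨j, hj, rfl, rfl⟩
    simpa only [Prod.ext_iff, Fin.ext_iff, ne_eq] using H.disjoint _ he _ hf

/-- The relation of a matching after an extension. -/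
def extendRel (R : Fin n → Fin n → Prop) (N : Finset (Fin n × Fin n)) : Fin n → Fin n → Prop :=
  fun a b => R a b ∨ (a, b) ∈ N ∨ (b, a) ∈ N

theorem relVerts_extendRel (N : Finset (Fin n × Fin n)) :
    relVerts (extendRel R N) = relVerts R ∪ pairVerts N := by
  ext a
  simp only [mem_relVerts, Finset.mem_union, mem_pairVerts, extendRel]
  constructor
  · rintro ⟨b, h | h | h⟩
    exacts [.inl ⟨b, h⟩, .inr ⟨_, h, .inl rfl⟩, .inr ⟨_, h, .inr rfl⟩]
  · rintro (⟨b, h⟩ | ⟨e, he, rfl | rfl⟩)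
    exacts [⟨b, .inl h⟩, ⟨e.2, .inr (.inl he)⟩, ⟨e.1, .inr (.inr he)⟩]

theorem IsExtension.isMatchingRel (hR : IsMatchingRel G R) {N : Finset (Fin n × Fin n)}
    (hN : IsExtension G (relVerts R) N) : IsMatchingRel G (extendRel R N) where
  adj := by
    rintro a b (h | h | h)
    exacts [hR.adj h, hN.adj _ h, (hN.adj _ h).symm]
  symm := by
    rintro a b (h | h | h)
    exacts [.inl (hR.symm h), .inr (.inr h), .inr (.inl h)]
  unique := by
    have key : ∀ {a b b'}, R a b → (a, b') ∈ N ∨ (b', a) ∈ N → False := by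
      rintro a b b' h (h' | h')
      · exact hN.fst_notMem _ h' (mem_relVerts.2 ⟨b, h⟩)
      · exact hN.snd_notMem _ h' (mem_relVerts.2 ⟨b, h⟩)
    rintro a b b' (h | h) (h' | h')
    · exact hR.unique h h'
    · exact (key h h').elim
    · exact (key h' h).elim
    · rcases h with h | h <;> rcases h' with h' | h' <;>
        have := hN.disjoint _ h _ h' <;> simp at this <;> aesop

end Represents

/-- The invariant of the greedy algorithm; `m` iterations are still to be done. -/
structure GreedyInvariant (c D m : ℕ) {n : ℕ} (G : SimpleGraph (Fin n))
    (R : Fin n → Fin n → Prop) : Prop where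
  isMatchingRel : IsMatchingRel G R
  le_potential : n ≤ potential c G (relVerts R) + D
  progress : (∀ u v, G.Adj u v → u ∈ relVerts R ∨ v ∈ relVerts R) ∨ n ≤ (relVerts R).card + m

theorem GreedyInvariant.maximal {c D n : ℕ} {G : SimpleGraph (Fin n)} {R : Fin n → Fin n → Prop}
    (h : GreedyInvariant c D 0 G R) : ∀ u v, G.Adj u v → u ∈ relVerts R ∨ v ∈ relVerts R := by
  rcases h.progress with h | h
  · exact h
  · intro u v _
    have : relVerts R = Finset.univ := by
      rw [← Finset.card_eq_iff_eq_univ]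
      exact le_antisymm (Finset.card_le_univ _) (by simpa using h)
    simp [this]

/-- The registers that contain the first `k` pairs. -/
def pairRegs (k : ℕ) : List ℕ := (List.range (2 * k)).map (5 + ·)

theorem mem_pairRegs {k x : ℕ} : x ∈ pairRegs k ↔ 5 ≤ x ∧ x < 5 + 2 * k := by
  simp only [pairRegs, List.mem_map, List.mem_range]
  constructor
  · rintro ⟨i, hi, rfl⟩
    omega
  · intro h
    exact ⟨x - 5, by omega, by omega⟩

theorem Represents.existsRegs {n k c D : ℕ} {G : SimpleGraph (Fin n)} {R : Fin n → Fin n → Prop}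
    {s : RAMState} (h : Represents G R s) (hR : IsMatchingRel G R) {N : Finset (Fin n × Fin n)}
    (hN : N.Nonempty) (hk : N.card ≤ k) (hext : IsExtension G (relVerts R) N)
    (hpot : n ≤ potential c G (relVerts R ∪ pairVerts N) + D) :
    ExistsRegs (GoodPairs k c D) (pairRegs k) s := by
  obtain ⟨e₀, he₀⟩ := hN
  -- If `N` has fewer than `k` pairs, the list is padded with copies of `e₀`; the test tolerates
  -- equal pairs.
  let τ : ℕ → Fin n × Fin n := fun i => N.toList.getD i e₀
  have hτ : ∀ e, e ∈ N ↔ ∃ i < k, τ i = e := by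
    intro e
    constructor
    · intro he
      obtain ⟨i, hi, hie⟩ := List.getElem_of_mem (Finset.mem_toList.2 he)
      refine ⟨i, ?_, ?_⟩
      · rw [Finset.length_toList] at hi
        omega
      · simp only [τ]
        rw [List.getD_eq_getElem _ _ hi, hie]
    · rintro ⟨i, -, rfl⟩
      by_cases hi : i < N.toList.length
      · simp only [τ]
        rw [List.getD_eq_getElem _ _ hi]
        exact Finset.mem_toList.1 (List.getElem_mem _)
      · simp only [τ]
        rwa [List.getD_eq_default _ _ (by omega)]
  -- The odd registers `5 + 2 i` hold first vertices and the even registers `6 + 2 i` second ones;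
  -- `(x - 5) / 2` recovers `i` in both cases.
  refine existsRegs_of_forall (v := fun x => if x % 2 = 1 then (τ ((x - 5) / 2)).1 else
    (τ ((x - 5) / 2)).2) (by simp [mem_pairRegs]) (fun x _ => ?_) fun s' hm hr => ?_
  · rw [h.1]
    split_ifs
    exacts [(τ _).1.2, (τ _).2.2]
  · have h0 : s'.reg 0 = s.reg 0 := by simp [hr, mem_pairRegs]
    have hfst : ∀ i < k, s'.fstReg i = (τ i).1 := by
      intro i hi
      rw [fstReg, hr, if_pos (mem_pairRegs.2 (by omega)), if_pos (by omega)]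
      congr
      omega
    have hsnd : ∀ i < k, s'.sndReg i = (τ i).2 := by
      intro i hi
      rw [sndReg, hr, if_pos (mem_pairRegs.2 (by omega)), if_neg (by omega)]
      congr
      omega
    have h' : Represents G R s' := ⟨h0.trans h.1, fun i j => by
      rw [← h.2 i j, RAMState.cell, RAMState.cell, hm, h0]⟩
    refine (h'.goodPairs hR (N := N) (fun e => ?_) fun i hi => ?_).2 ⟨hext, hpot⟩
    · rw [hτ]
      refine exists_congr fun i => and_congr_right fun hi => ?_
      rw [hfst i hi, hsnd i hi, Prod.ext_iff, Fin.ext_iff, Fin.ext_iff]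
    · rw [hfst i hi, hsnd i hi]
      exact ⟨(τ i).1.2, (τ i).2.2⟩

theorem row_col_inj {n : ℕ} {a b c d : Fin n} :
    (a : ℕ) * n + b = c * n + d ↔ a = c ∧ b = d := by
  constructor
  · intro h
    have h1 : finProdFinEquiv (a, b) = finProdFinEquiv (c, d) := by
      apply Fin.ext
      simp only [finProdFinEquiv_apply_val]
      linarith
    simpa using h1
  · rintro ⟨rfl, rfl⟩
    rfl

/-- One iteration searches for `k` good pairs and marks them if the search succeeds. The counter in
register `4` has been decreased already when the iteration begins, which explains the `+ 1` in the
precondition. -/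
theorem PolyExec.greedyStep (k c D : ℕ) (hk : 0 < k) :
    PolyExec (fun (g : Σ n, SimpleGraph (Fin n)) s => GreedyExtendable k c D g.2 ∧
        ∃ R, Represents g.2 R s ∧ GreedyInvariant c D (s.reg 4 + 1) g.2 R)
      fun g s s' => (GreedyExtendable k c D g.2 ∧
        ∃ R, Represents g.2 R s' ∧ GreedyInvariant c D (s'.reg 4) g.2 R) ∧
        s'.reg 4 = s.reg 4 ∧ s'.reg 0 = s.reg 0 := by
  have hp := PolyDec.goodPairs k c D
  obtain ⟨K₀, hK₀, hpK⟩ := hp.agree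
  set K := max K₀ (6 + 2 * k)
  have hpK' : ∀ s s' : RAMState, Agree K s s' → GoodPairs k c D s → GoodPairs k c D s' :=
    fun s s' h => hpK s s' (h.mono (le_max_left _ _))
  refine ((PolyExec.find hp (by omega) hpK' (l := pairRegs k) (by simp [mem_pairRegs])).seq
    (PolyExec.cond K hp (PolyExec.storePairs K (List.range k) (by
      intro i hi
      rw [List.mem_range] at hi
      omega)) (pre₀ := fun _ _ => True) (fun _ _ _ _ _ => ⟨fun _ => trivial, fun _ => trivial⟩)
      PolyExec.skip) fun _ s s' _ h => ⟨trivial, h.2.1 0 (by omega) (by simp [mem_pairRegs])⟩).weaken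
      (fun _ _ _ => trivial) ?_
  rintro ⟨n, G⟩ s s' ⟨hG, R, hrep, hinv⟩ ⟨u, ⟨hum, hur, hue⟩, w, huw, h1, h2⟩
  dsimp only at *
  have hR := hinv.isMatchingRel
  have hu0 : u.reg 0 = s.reg 0 := hur 0 (by omega) (by simp [mem_pairRegs])
  have hu4 : u.reg 4 = s.reg 4 := hur 4 (by omega) (by simp [mem_pairRegs])
  have hw0 : w.reg 0 = s.reg 0 := (huw.2 0 (by omega)).trans hu0
  have hw4 : w.reg 4 = s.reg 4 := (huw.2 4 (by omega)).trans hu4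
  have hwrep : Represents G R w := ⟨hw0.trans hrep.1, fun i j => by
    rw [← hrep.2 i j, RAMState.cell, RAMState.cell, huw.1, hum, hw0]⟩
  by_cases hgood : GoodPairs k c D u
  · obtain ⟨hreg, hmem⟩ := h1 hgood
    have hgw := hpK' _ _ huw hgood
    have hlt : ∀ i < k, w.fstReg i < n ∧ w.sndReg i < n := by
      intro i hi
      have := hgw.1 i (List.mem_range.2 hi)
      rw [hwrep.1] at this
      exact ⟨this.1, this.2.1⟩
    classical
    let N : Finset (Fin n × Fin n) := Finset.univ.filter fun e =>
      ∃ i < k, w.fstReg i = e.1 ∧ w.sndReg i = e.2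
    have hN : ∀ e : Fin n × Fin n, e ∈ N ↔ ∃ i < k, w.fstReg i = e.1 ∧ w.sndReg i = e.2 := by
      simp [N]
    obtain ⟨hext, hpot⟩ := (hwrep.goodPairs hR hN hlt).1 hgw
    have hs0 : s'.reg 0 = w.reg 0 := hreg 0 (by omega)
    have hs4 : s'.reg 4 = w.reg 4 := hreg 4 (by omega)
    refine ⟨⟨hG, extendRel R N, ⟨hs0.trans hwrep.1, fun i j => ?_⟩,
      ⟨hext.isMatchingRel hR, by rwa [relVerts_extendRel], ?_⟩⟩, hs4.trans hw4, hs0.trans hw0⟩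
    · have hex : (∃ l ∈ List.range k, (i : ℕ) * n + j = w.fstReg l * w.reg 0 + w.sndReg l ∨
          (i : ℕ) * n + j = w.sndReg l * w.reg 0 + w.fstReg l) ↔ (i, j) ∈ N ∨ (j, i) ∈ N := by
        rw [hN, hN, ← exists_or]
        refine exists_congr fun l => ?_
        rw [List.mem_range, ← and_or_left]
        refine and_congr_right fun hl => ?_
        have e1 := @row_col_inj n i j ⟨_, (hlt l hl).1⟩ ⟨_, (hlt l hl).2⟩
        have e2 := @row_col_inj n i j ⟨_, (hlt l hl).2⟩ ⟨_, (hlt l hl).1⟩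
        simp only [Fin.ext_iff] at e1 e2
        rw [hwrep.1, e1, e2]
        constructor <;> rintro (⟨h, h'⟩ | ⟨h, h'⟩)
        exacts [.inl ⟨h.symm, h'.symm⟩, .inr ⟨h'.symm, h.symm⟩, .inl ⟨h.symm, h'.symm⟩,
          .inr ⟨h'.symm, h.symm⟩]
      have hc := hwrep.2 i j
      have := hmem ((i : ℕ) * n + j)
      rw [hex] at this
      rw [RAMState.cell, hwrep.1] at hc
      rw [RAMState.cell, hs0, hwrep.1]
      by_cases hij : (i, j) ∈ N ∨ (j, i) ∈ N
      · rw [this.1 hij, if_pos (show extendRel R N i j from Or.inr hij)]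
      · rw [this.2 hij, hc]
        simp [extendRel, hij]
    · rcases hinv.progress with h | h
      · refine .inl fun a b hab => ?_
        rw [relVerts_extendRel]
        rcases h a b hab with h | h <;> simp [h]
      · right
        rw [relVerts_extendRel]
        -- Since `0 < k`, there is a pair number `0`, and its first vertex is newly covered.
        have hlt' : (relVerts R).card < (relVerts R ∪ pairVerts N).card := by
          obtain ⟨h1, h2⟩ := hlt 0 hk
          have he := (hN (⟨_, h1⟩, ⟨_, h2⟩)).2 ⟨0, hk, rfl, rfl⟩
          refine Finset.card_lt_card (Finset.ssubset_iff_of_subset Finset.subset_union_left |>.2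
            ⟨⟨_, h1⟩, ?_, hext.fst_notMem _ he⟩)
          exact Finset.mem_union_right _ (mem_pairVerts.2 ⟨_, he, .inl rfl⟩)
        omega
  · obtain rfl := h2 hgood
    refine ⟨⟨hG, R, hwrep, ⟨hR, hinv.le_potential, .inl ?_⟩⟩, hw4, hw0⟩
    -- An unsuccessful search certifies maximality: otherwise extendability would supply pairs that
    -- the search had to find.
    by_contra hmax
    push Not at hmax
    obtain ⟨a, b, hab, ha, hb⟩ := hmax
    obtain ⟨N, hN, hNk, hext, hpot⟩ := hG (relVerts R) (by simpa using hinv.le_potential)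
      ⟨a, b, hab, ha, hb⟩
    exact hgood (hue (hrep.existsRegs hR hN hNk hext (by simpa using hpot)))

/-! ### The complete program: initialization, main loop, output -/

theorem potential_empty {V : Type*} [Fintype V] (c : ℕ) (G : SimpleGraph V) :
    Fintype.card V ≤ potential c G ∅ := by
  simp [potential, fullOutside]

/-- The matching given by a relation. -/
def relSubgraph {n : ℕ} {G : SimpleGraph (Fin n)} {R : Fin n → Fin n → Prop}
    (hR : IsMatchingRel G R) : G.Subgraph where
  verts := {a | ∃ b, R a b}
  Adj := R
  adj_sub := hR.adj
  edge_vert h := ⟨_, h⟩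
  symm := ⟨fun _ _ => hR.symm⟩

/-- Let `N` be a larger matching that covers `v ∉ M.verts`. The partner `w` of `v` in `N` lies in
`M.verts`, and its partner in `M` is also its partner in `N`, hence equals `v`, a contradiction. -/
theorem isMaximalMatching_of_covers {V : Type*} {G : SimpleGraph V} {M : G.Subgraph}
    (hM : M.IsMatching) (h : ∀ u v, G.Adj u v → u ∈ M.verts ∨ v ∈ M.verts) :
    IsMaximalMatching G M := by
  refine ⟨hM, fun N hN hMN => ?_⟩
  have hv : N.verts ⊆ M.verts := by
    intro v hv
    by_contra hvM
    obtain ⟨w, hw, -⟩ := hN hv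
    obtain ⟨x, hx, -⟩ := hM ((h v w hw.adj_sub).resolve_left hvM)
    have := hN.eq_of_adj_left hw.symm (hMN.2 hx)
    exact hvM (this ▸ M.edge_vert hx.symm)
  refine ⟨hv, fun a b hab => ?_⟩
  obtain ⟨x, hx, -⟩ := hM (hv (N.edge_vert hab))
  rwa [hN.eq_of_adj_left hab (hMN.2 hx)]

/-- The counter starts at `n`. Each iteration covers a new vertex unless the matching is maximal
already, so `n` iterations suffice. -/
theorem PolyExec.greedyLoop (k c D : ℕ) (hk : 0 < k) :
    PolyExec (fun (g : Σ n, SimpleGraph (Fin n)) s => GreedyExtendable k c D g.2 ∧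
        s = graphInput g.2)
      fun g _ s' => s'.reg 0 = g.1 ∧ ∃ R, Represents g.2 R s' ∧ GreedyInvariant c D 0 g.2 R := by
  have hloop := PolyExec.loop (x := 4) (by omega) Polynomial.X
    (I := fun (g : Σ n, SimpleGraph (Fin n)) s => GreedyExtendable k c D g.2 ∧
      ∃ R, Represents g.2 R s ∧ GreedyInvariant c D (s.reg 4) g.2 R)
    (fun g s ⟨h, R, hr, hi⟩ h4 => ⟨h, R, ⟨hr.1, fun i j => by
      rw [cell_setReg (by omega), hr.2]⟩, by
        rwa [reg_setReg, if_pos rfl, Nat.sub_add_cancel (by omega)]⟩)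
    (PolyExec.greedyStep k c D hk)
  refine (((PolyExec.set 5 4 (PolyVal.reg 0)).weaken
    (pre' := fun (g : Σ n, SimpleGraph (Fin n)) s => GreedyExtendable k c D g.2 ∧
      s = graphInput g.2) (fun _ _ _ => trivial) fun _ _ _ _ h => h).seq hloop ?_).weaken
      (fun _ _ h => h) ?_
  · rintro ⟨n, G⟩ s s' ⟨hG, rfl⟩ h
    dsimp only at *
    have hn : (graphInput G).reg 0 = n := by simp [graphInput]
    have h0 : s'.reg 0 = n := (h.2 0 (by omega)).trans (by simp [hn])
    have h4 : s'.reg 4 = n := (h.2 4 (by omega)).trans (by simp [hn])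
    have he : relVerts (fun _ _ : Fin n => False) = ∅ := by simp [relVerts]
    refine ⟨⟨⟨hG, fun _ _ => False, ⟨h0, fun i j => ?_⟩, ⟨⟨fun h => h.elim, fun h => h.elim,
      fun h => h.elim⟩, ?_, ?_⟩⟩, by simp [h0, h4]⟩, h0.trans hn.symm⟩
    · rw [RAMState.cell, h0, h.1]
      have key : (∃ a b : Fin n, G.Adj a b ∧ (i : ℕ) * n + j = a * n + b) ↔ G.Adj i j := by
        refine ⟨?_, fun hij => ⟨i, j, hij, rfl⟩⟩
        rintro ⟨a, b, hab, he⟩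
        obtain ⟨rfl, rfl⟩ := row_col_inj.1 he
        exact hab
      simp only [mem_setReg, graphInput, if_false]
      by_cases hij : G.Adj i j
      · rw [if_pos (key.2 hij), if_pos hij]
      · rw [if_neg (mt key.1 hij), if_neg hij]
    · rw [he]
      simpa using (potential_empty c G).trans (Nat.le_add_right _ D)
    · right
      simp [h4]
  · rintro ⟨n, G⟩ s s' - ⟨u, -, ⟨-, R, hr, hi⟩, h4, h0⟩
    dsimp only at *
    exact ⟨hr.1, R, hr, h4 ▸ hi⟩

/-- The conversion of the matrix in the memory to the output format. -/
theorem PolyExec.cleanUp (c D : ℕ) :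
    PolyExec (fun (g : Σ n, SimpleGraph (Fin n)) s => s.reg 0 = g.1 ∧
        ∃ R, Represents g.2 R s ∧ GreedyInvariant c D 0 g.2 R)
      fun g _ s' => ∃ R, GreedyInvariant c D 0 g.2 R ∧ ∀ i j : Fin g.1,
        (R i j → s'.mem ((i : ℕ) * g.1 + j) = 1) ∧ (¬ R i j → s'.mem ((i : ℕ) * g.1 + j) = 0) := by
  classical
  -- Truncated subtraction of `1` turns the entries `2`, `1`, `0` into `1`, `0`, `0`. Register `4`
  -- runs down through all `n ^ 2` cells, and the cells from its content on have been converted.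
  let I : (Σ n, SimpleGraph (Fin n)) → RAMState → Prop := fun g s => s.reg 0 = g.1 ∧
    ∃ R, GreedyInvariant c D 0 g.2 R ∧ ∀ i j : Fin g.1, s.mem ((i : ℕ) * g.1 + j) =
      (if R i j then 2 else if g.2.Adj i j then 1 else 0) -
        (if s.reg 4 ≤ (i : ℕ) * g.1 + j then 1 else 0)
  -- The loop decreases the counter before the body runs, so inside the body the invariant refers to
  -- a counter larger by one.
  have hclean := PolyExec.loop (x := 4) (by omega) (Polynomial.X * Polynomial.X) (I := I)
    (J := fun g s => I g (s.setReg 4 (s.reg 4 + 1))) (fun g s hs h4 => by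
      have : (s.setReg 4 (s.reg 4 - 1)).setReg 4 ((s.setReg 4 (s.reg 4 - 1)).reg 4 + 1) = s := by
        have h : s.reg 4 - 1 + 1 = s.reg 4 := by omega
        simp [RAMState.setReg, h]
      rwa [this])
    ((PolyExec.store 5 (PolyVal.reg 4) ((PolyVal.reg 4).load.sub (PolyVal.const 1))).weaken
      (fun _ _ _ => trivial) (by
        rintro ⟨n, G⟩ s s' ⟨h0, R, hR, hc⟩ h
        dsimp only at *
        have h0' : s'.reg 0 = s.reg 0 := h.2 0 (by omega)
        have h4' : s'.reg 4 = s.reg 4 := h.2 4 (by omega)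
        have hs0 : s.reg 0 = n := by simpa using h0
        refine ⟨⟨h0'.trans hs0, R, hR, fun i j => ?_⟩, h4', h0'⟩
        have := hc i j
        rw [mem_setReg, reg_setReg, if_pos rfl] at this
        dsimp only
        rw [h4', h.1, mem_setMem]
        by_cases hij : (i : ℕ) * n + j = s.reg 4
        · rw [if_pos hij, ← hij, this, if_neg (show ¬ s.reg 4 + 1 ≤ (i : ℕ) * n + j by omega), if_pos le_rfl, Nat.sub_zero]
        · rw [if_neg hij, this]
          congr 1
          exact if_congr (by omega) rfl rfl))
  refine (((PolyExec.set 5 4 (PolyVal.mul_reg_zero 0)).weaken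
    (pre' := fun (g : Σ n, SimpleGraph (Fin n)) s => s.reg 0 = g.1 ∧
      ∃ R, Represents g.2 R s ∧ GreedyInvariant c D 0 g.2 R)
      (fun _ _ _ => trivial) fun _ _ _ _ h => h).seq hclean ?_).weaken (fun _ _ h => h) ?_
  · rintro ⟨n, G⟩ s s' ⟨hn, R, hrep, hinv⟩ h
    dsimp only at *
    have h0 : s'.reg 0 = n := (h.2 0 (by omega)).trans (by simp [hn])
    have h4 : s'.reg 4 = n * n := (h.2 4 (by omega)).trans (by simp [hn])
    refine ⟨⟨⟨h0, R, hinv, fun i j => ?_⟩, by simp [h0, h4]⟩, h0.trans hn.symm⟩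
    have hlt : (i : ℕ) * n + j < n * n := by nlinarith [i.2, j.2]
    have := hrep.2 i j
    rw [RAMState.cell, hn] at this
    dsimp only
    rw [h4, if_neg (show ¬ n * n ≤ (i : ℕ) * n + j by omega), Nat.sub_zero, ← this, h.1, mem_setReg]
  · rintro ⟨n, G⟩ s s' - ⟨u, -, ⟨-, R, hR, hc⟩, h4, -⟩
    dsimp only at *
    refine ⟨R, hR, fun i j => ⟨fun h => ?_, fun h => ?_⟩⟩
    · rw [hc, if_pos h, h4, if_pos (Nat.zero_le _)]
    · rw [hc, if_neg h, h4, if_pos (Nat.zero_le _)]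
      split_ifs <;> rfl

/-- The greedy algorithm, with the guarantee that it gives for the potential. -/
theorem exists_greedy_program (k c D : ℕ) (hk : 0 < k) :
    ∃ (P : RAMProg) (T : Polynomial ℕ), ∀ (n : ℕ) (G : SimpleGraph (Fin n)),
      GreedyExtendable k c D G → ∃ (t : ℕ) (s : RAMState), P.Runs (graphInput G) t s ∧
        t ≤ T.eval n ∧ ∃ M : G.Subgraph, IsMaximalMatching G M ∧ IsOutput s M ∧
          ∃ C : Finset (Fin n), (C : Set (Fin n)) = M.verts ∧ n ≤ potential c G C + D := by
  obtain ⟨P, T, h⟩ := (PolyExec.greedyLoop k c D hk).seq (PolyExec.cleanUp c D)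
    fun g s s' hs h => ⟨h, by rw [h.1, hs.2]; simp [graphInput]⟩
  refine ⟨P, T, fun n G hG => ?_⟩
  obtain ⟨t, s, hr, ht, u, -, R, hR, ho⟩ := h ⟨n, G⟩ _ ⟨hG, rfl⟩
  have hverts : ((relVerts R : Finset (Fin n)) : Set (Fin n)) =
      (relSubgraph hR.isMatchingRel).verts := by
    ext a
    simp [mem_relVerts, relSubgraph]
  refine ⟨t, s, hr, by simpa [graphInput] using ht, relSubgraph hR.isMatchingRel,
    isMaximalMatching_of_covers ?_ ?_, fun i j => ho i j, relVerts R, hverts, hR.le_potential⟩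
  · rintro a ⟨b, hab⟩
    exact ⟨b, hab, fun b' hab' => hR.isMatchingRel.unique hab' hab⟩
  · intro a b hab
    rw [← hverts]
    exact hR.maximal a b hab
/-! ### Finitely many inputs -/

namespace RAMExpr

/-- The distance between a value and a constant. -/
def distConst (e : RAMExpr) (c : ℕ) : RAMExpr := .add (.sub e (.const c)) (.sub (.const c) e)

theorem eval_distConst_eq_zero {e : RAMExpr} {c : ℕ} {s : RAMState} :
    (distConst e c).eval s = 0 ↔ e.eval s = c := by
  simp only [distConst, eval]
  omega

/-- An expression that vanishes if and only if the first `m` cells have the given contents. -/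
def testCells (f : ℕ → ℕ) : ℕ → RAMExpr
  | 0 => .const 0
  | m + 1 => .add (testCells f m) (distConst (.load (.const m)) (f m))

theorem eval_testCells_eq_zero {f : ℕ → ℕ} {m : ℕ} {s : RAMState} :
    (testCells f m).eval s = 0 ↔ ∀ a < m, s.mem a = f a := by
  induction m with
  | zero => simp [testCells, eval]
  | succ m ih =>
    simp only [testCells, eval, Nat.add_eq_zero_iff, ih, eval_distConst_eq_zero,
      Nat.lt_succ_iff_lt_or_eq, or_imp, forall_and, forall_eq]

end RAMExpr

theorem RAMProg.exists_write (f : ℕ → ℕ) (m : ℕ) : ∃ (P : RAMProg) (B : ℕ), ∀ s, ∃ t s',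
    P.Runs s t s' ∧ t ≤ B ∧ ∀ a < m, s'.mem a = f a := by
  induction m with
  | zero => exact ⟨.skip, 1, fun s => ⟨_, _, .skip s, le_rfl, by simp⟩⟩
  | succ m ih =>
    obtain ⟨P, B, h⟩ := ih
    refine ⟨.seq P (.store (.const m) (.const (f m))), B + 3, fun s => ?_⟩
    obtain ⟨t, s', hr, ht, hs⟩ := h s
    refine ⟨_, _, .seq hr (runs_store _ _ _), by simp only [RAMExpr.cost]; omega, fun a ha => ?_⟩
    rcases Nat.lt_succ_iff_lt_or_eq.1 ha with h | rfl
    · simp [RAMExpr.eval, hs a h, show a ≠ m by omega]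
    · simp [RAMExpr.eval]

theorem graphInput_eq_one {n : ℕ} {G : SimpleGraph (Fin n)} {i j : Fin n} :
    (graphInput G).mem ((i : ℕ) * n + j) = 1 ↔ G.Adj i j := by
  classical
  have key : (∃ a b : Fin n, G.Adj a b ∧ (i : ℕ) * n + j = a * n + b) ↔ G.Adj i j := by
    refine ⟨?_, fun hij => ⟨i, j, hij, rfl⟩⟩
    rintro ⟨a, b, hab, he⟩
    obtain ⟨rfl, rfl⟩ := row_col_inj.1 he
    exact hab
  by_cases hij : G.Adj i j
  · simp only [graphInput, if_pos (key.2 hij), hij]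
  · simp only [graphInput, if_neg (mt key.1 hij), hij, zero_ne_one]

theorem graphInput_injective {n : ℕ} {G H : SimpleGraph (Fin n)}
    (h : ∀ a < n * n, (graphInput G).mem a = (graphInput H).mem a) : G = H := by
  ext i j
  rw [← graphInput_eq_one, ← graphInput_eq_one, h _ (by nlinarith [i.2, j.2])]

theorem exists_maximalMatching_card_eq {n : ℕ} (G : SimpleGraph (Fin n)) :
    ∃ M : G.Subgraph, IsMaximalMatching G M ∧ M.edgeSet.ncard = edgeDominationNumber G := by
  have hne : {k : ℕ | ∃ M : G.Subgraph, IsMaximalMatching G M ∧ M.edgeSet.ncard = k}.Nonempty := by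
    obtain ⟨M, hM⟩ := (Set.toFinite {M : G.Subgraph | M.IsMatching}).exists_maximal
      ⟨⊥, fun v hv => by simp at hv⟩
    exact ⟨_, M, hM, rfl⟩
  exact Nat.sInf_mem hne

/-- The output for a single graph can be stored in the program. -/
theorem RAMProg.exists_hardwire {n : ℕ} (G : SimpleGraph (Fin n)) (P : RAMProg) :
    ∃ (Q : RAMProg) (B : ℕ), (∃ t s, Q.Runs (graphInput G) t s ∧ t ≤ B ∧
      ∃ M : G.Subgraph, IsMaximalMatching G M ∧ IsOutput s M ∧
        M.edgeSet.ncard = edgeDominationNumber G) ∧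
      ∀ (m : ℕ) (H : SimpleGraph (Fin m)), (⟨m, H⟩ : Σ n, SimpleGraph (Fin n)) ≠ ⟨n, G⟩ →
        ∀ t s, P.Runs (graphInput H) t s → ∃ t', Q.Runs (graphInput H) t' s ∧ t' ≤ t + B := by
  classical
  obtain ⟨M, hM, hcard⟩ := exists_maximalMatching_card_eq G
  obtain ⟨W, B, hW⟩ := RAMProg.exists_write
    (fun a => if ∃ i j : Fin n, M.Adj i j ∧ a = i * n + j then 1 else 0) (n * n)
  let e : RAMExpr := .add (.distConst (.reg 0) n) (.testCells (graphInput G).mem (n * n))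
  have he : ∀ s, e.eval s = 0 ↔ s.reg 0 = n ∧ ∀ a < n * n, s.mem a = (graphInput G).mem a := by
    intro s
    simp only [e, RAMExpr.eval, Nat.add_eq_zero_iff, RAMExpr.eval_distConst_eq_zero,
      RAMExpr.eval_testCells_eq_zero]
  -- The expression `e` vanishes exactly on the input for `G`, so the branch for zero writes the
  -- stored answer and the other one runs `P` on an untouched state.
  refine ⟨.ite e P W, e.cost + 1 + B, ?_, ?_⟩
  · obtain ⟨t, s, hr, ht, hs⟩ := hW (graphInput G)
    refine ⟨_, s, .ite_false ((he _).2 ⟨by simp [graphInput], fun _ _ => rfl⟩) hr, by omega, M, hM,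
      fun i j => ?_, hcard⟩
    rw [hs _ (by nlinarith [i.2, j.2])]
    have key : (∃ a b : Fin n, M.Adj a b ∧ (i : ℕ) * n + j = a * n + b) ↔ M.Adj i j := by
      refine ⟨?_, fun hij => ⟨i, j, hij, rfl⟩⟩
      rintro ⟨a, b, hab, he⟩
      obtain ⟨rfl, rfl⟩ := row_col_inj.1 he
      exact hab
    exact ⟨fun h => if_pos (key.2 h), fun h => if_neg (mt key.1 h)⟩
  · intro m H hne t s hr
    refine ⟨_, .ite_true (fun h => hne ?_) hr, by omega⟩
    obtain ⟨h0, hc⟩ := (he _).1 h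
    obtain rfl : m = n := by simpa [graphInput] using h0
    rw [graphInput_injective hc]

theorem RAMProg.exists_hardwire_list (l : List (Σ n, SimpleGraph (Fin n))) (P : RAMProg) :
    ∃ (Q : RAMProg) (B : ℕ), (∀ g ∈ l, ∃ t s, Q.Runs (graphInput g.2) t s ∧ t ≤ B ∧
      ∃ M : g.2.Subgraph, IsMaximalMatching g.2 M ∧ IsOutput s M ∧
        M.edgeSet.ncard = edgeDominationNumber g.2) ∧
      ∀ g ∉ l, ∀ t s, P.Runs (graphInput g.2) t s →
        ∃ t', Q.Runs (graphInput g.2) t' s ∧ t' ≤ t + B := by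
  classical
  induction l with
  | nil => exact ⟨P, 0, by simp, fun g _ t s h => ⟨t, h, le_rfl⟩⟩
  | cons g l ih =>
    obtain ⟨Q, B, h1, h2⟩ := ih
    obtain ⟨Q', B', h3, h4⟩ := RAMProg.exists_hardwire g.2 Q
    refine ⟨Q', B + B', fun g' hg' => ?_, fun g' hg' t s hr => ?_⟩
    · by_cases hgg : g' = g
      · subst hgg
        obtain ⟨t, s, hr, ht, h⟩ := h3
        exact ⟨t, s, hr, by omega, h⟩
      · obtain ⟨t, s, hr, ht, h⟩ := h1 g' ((List.mem_cons.1 hg').resolve_left hgg)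
        obtain ⟨t', hr', ht'⟩ := h4 g'.1 g'.2 hgg t s hr
        exact ⟨t', s, hr', by omega, h⟩
    · simp only [List.mem_cons, not_or] at hg'
      obtain ⟨t', hr', ht'⟩ := h2 g' hg'.2 t s hr
      obtain ⟨t'', hr'', ht''⟩ := h4 g'.1 g'.2 hg'.1 t' s hr'
      exact ⟨t'', hr'', by omega⟩

/-- Finitely many graphs are irrelevant for the existence of an approximation algorithm. -/
theorem HasPolyTimeApproximation.of_eventually {C : (n : ℕ) → SimpleGraph (Fin n) → Prop} {r : ℝ}
    (hr : 1 ≤ r) (n₀ : ℕ)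
    (h : HasPolyTimeApproximation (fun n G => n₀ ≤ n ∧ C n G) r) :
    HasPolyTimeApproximation C r := by
  classical
  obtain ⟨P, T, h⟩ := h
  let l : List (Σ n, SimpleGraph (Fin n)) :=
    ((Finset.range n₀).sigma fun n => (Finset.univ : Finset (SimpleGraph (Fin n)))).toList
  have hl : ∀ g, g ∈ l ↔ g.1 < n₀ := by simp [l]
  obtain ⟨Q, B, h1, h2⟩ := RAMProg.exists_hardwire_list l P
  refine ⟨Q, T + Polynomial.C B, fun n G hG => ?_⟩
  simp only [Polynomial.eval_add, Polynomial.eval_C]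
  by_cases hn : n < n₀
  · obtain ⟨t, s, hrun, ht, M, hM, ho, hcard⟩ := h1 ⟨n, G⟩ ((hl _).2 hn)
    refine ⟨t, s, hrun, by omega, M, hM, ho, ?_⟩
    rw [hcard]
    exact le_mul_of_one_le_left (Nat.cast_nonneg _) hr
  · obtain ⟨t, s, hrun, ht, hM⟩ := h n G ⟨by omega, hG⟩
    obtain ⟨t', hrun', ht'⟩ := h2 ⟨n, G⟩ (by simp [hl]; omega) t s hrun
    exact ⟨t', s, hrun', by omega, hM⟩

/-! ### Lower bounds on the edge domination number -/

/-- This is the handshake lemma for the spanning subgraph, whose degrees are `1` on `M.verts` and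
`0` elsewhere. -/
theorem SimpleGraph.Subgraph.IsMatching.two_mul_ncard_edgeSet {V : Type*} [Fintype V]
    {G : SimpleGraph V} {M : G.Subgraph} (hM : M.IsMatching) :
    2 * M.edgeSet.ncard = M.verts.ncard := by
  classical
  have h := M.spanningCoe.sum_degrees_eq_twice_card_edges
  have h1 : M.edgeSet.ncard = M.spanningCoe.edgeFinset.card := by
    rw [← Set.ncard_coe_finset, SimpleGraph.coe_edgeFinset, Subgraph.edgeSet_spanningCoe]
  have h2 : ∀ v, M.spanningCoe.degree v = if v ∈ M.verts then 1 else 0 := by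
    intro v
    split_ifs with hv
    · obtain ⟨w, hw, hu⟩ := hM hv
      rw [← SimpleGraph.card_neighborFinset_eq_degree, Finset.card_eq_one]
      refine ⟨w, ?_⟩
      ext x
      simp only [SimpleGraph.mem_neighborFinset, Subgraph.spanningCoe_adj, Finset.mem_singleton]
      exact ⟨fun h => hu x h, fun h => h ▸ hw⟩
    · rw [← SimpleGraph.card_neighborFinset_eq_degree, Finset.card_eq_zero]
      ext x
      simp only [SimpleGraph.mem_neighborFinset, Subgraph.spanningCoe_adj, Finset.notMem_empty,
        iff_false]
      exact fun h => hv (M.edge_vert h)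
  rw [h1, ← h, Finset.sum_congr rfl fun v _ => h2 v, Finset.sum_boole, Set.ncard_eq_toFinset_card']
  simp [Set.toFinset]

/-- An edge with both ends uncovered could be added to `M`. -/
theorem IsMaximalMatching.covers {V : Type*} {G : SimpleGraph V} {M : G.Subgraph}
    (hM : IsMaximalMatching G M) {u v : V} (huv : G.Adj u v) : u ∈ M.verts ∨ v ∈ M.verts := by
  by_contra h
  push Not at h
  have h1 : (M ⊔ G.subgraphOfAdj huv).IsMatching := by
    refine hM.prop.sup (.subgraphOfAdj huv) ?_
    rw [hM.prop.support_eq_verts, SimpleGraph.support_subgraphOfAdj, Set.disjoint_right]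
    rintro x (rfl | rfl)
    exacts [h.1, h.2]
  have h2 := (hM.le_of_ge h1 le_sup_left).1
  exact h.1 (h2 (by simp))

/-- If every covered vertex has at most `b` uncovered neighbors, then a maximal matching in a
regular graph is large. -/
theorem IsMaximalMatching.regular_bound {V : Type*} [Fintype V] {G : SimpleGraph V}
    [DecidableRel G.Adj] {d b : ℕ} (hG : ∀ v, (G.neighborFinset v).card = d) {M : G.Subgraph}
    (hM : IsMaximalMatching G M)
    (hb : ∀ v ∈ M.verts, ∀ S : Finset V, (∀ w ∈ S, G.Adj v w ∧ w ∉ M.verts) → S.card ≤ b) :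
    d * Fintype.card V ≤ 2 * M.edgeSet.ncard * (d + b) := by
  classical
  have h2 := hM.prop.two_mul_ncard_edgeSet
  let C : Finset V := Finset.univ.filter (· ∈ M.verts)
  have hC : C.card = M.verts.ncard := by
    rw [Set.ncard_eq_toFinset_card']
    congr 1
    ext
    simp [C]
  have hCc : Cᶜ.card + C.card = Fintype.card V := by
    rw [Finset.card_compl, Nat.sub_add_cancel (Finset.card_le_univ C)]
  -- Double counting of the edges between `Cᶜ` and `C`: uncovered vertices are independent, so each
  -- of them sends all its `d` edges to `C`.
  have h3 : Cᶜ.card * d ≤ C.card * b := by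
    refine Finset.card_mul_le_card_mul G.Adj (fun u hu => ?_) fun v hv => ?_
    · rw [← hG u]
      refine Finset.card_le_card fun w hw => ?_
      rw [SimpleGraph.mem_neighborFinset] at hw
      simp only [Finset.bipartiteAbove, Finset.mem_filter]
      refine ⟨?_, hw⟩
      have := hM.covers hw
      simp_all [C]
    · refine hb v (by simpa [C] using hv) _ fun w hw => ?_
      simp only [Finset.bipartiteBelow, Finset.mem_filter, C, Finset.mem_compl, Finset.mem_univ,
        true_and] at hw
      exact ⟨hw.2.symm, hw.1⟩
  rw [h2, ← hC, ← hCc]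
  nlinarith

/-- One of the `d` neighbors of `v` is its partner in `M`, which is covered. -/
theorem IsMaximalMatching.card_uncovered_neighbors_le {V : Type*} [Fintype V] {G : SimpleGraph V}
    [DecidableRel G.Adj] {d : ℕ} (hG : ∀ v, (G.neighborFinset v).card = d) {M : G.Subgraph}
    (hM : IsMaximalMatching G M) {v : V} (hv : v ∈ M.verts) {S : Finset V}
    (hS : ∀ w ∈ S, G.Adj v w ∧ w ∉ M.verts) : S.card ≤ d - 1 := by
  classical
  obtain ⟨w, hw, -⟩ := hM.prop hv
  rw [← hG v, ← Finset.card_erase_of_mem (by simpa using hw.adj_sub)]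
  refine Finset.card_le_card fun x hx => Finset.mem_erase.2 ⟨?_, by simpa using (hS x hx).1⟩
  rintro rfl
  exact (hS x hx).2 (M.edge_vert hw.symm)

/-- Three uncovered neighbors of `v` are pairwise nonadjacent by maximality and would form an
induced claw with center `v`. -/
theorem IsMaximalMatching.card_uncovered_neighbors_le_two {V : Type*} {G : SimpleGraph V}
    (hG : InducedFree (completeBipartiteGraph (Fin 1) (Fin 3)) G) {M : G.Subgraph}
    (hM : IsMaximalMatching G M) {v : V} {S : Finset V}
    (hS : ∀ w ∈ S, G.Adj v w ∧ w ∉ M.verts) : S.card ≤ 2 := by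
  classical
  by_contra! h
  obtain ⟨T, hT, hT3⟩ := Finset.exists_subset_card_eq (show 3 ≤ S.card by omega)
  let e : Fin 3 ≃ T := (Finset.equivFinOfCardEq hT3).symm
  have he : ∀ i, G.Adj v (e i) ∧ (e i : V) ∉ M.verts := fun i => hS _ (hT (e i).2)
  refine hG ⟨⟨⟨Sum.elim (fun _ => v) fun i => (e i : V), ?_⟩, ?_⟩⟩
  · rintro (i | i) (j | j) hij
    · rw [Subsingleton.elim i j]
    · exact absurd hij (he j).1.ne
    · exact absurd hij.symm (he i).1.ne
    · rw [e.injective (Subtype.ext hij)]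
  · rintro (i | i) (j | j)
    · exact iff_of_false (G.loopless.irrefl v) (by simp [completeBipartiteGraph])
    · exact iff_of_true (he j).1 (by simp [completeBipartiteGraph])
    · exact iff_of_true (he i).1.symm (by simp [completeBipartiteGraph])
    · refine iff_of_false ?_ (by simp [completeBipartiteGraph])
      intro h
      rcases hM.covers h with h | h
      exacts [(he i).2 h, (he j).2 h]

/-! ### The approximation ratio of the greedy algorithm -/

theorem card_isolatedOutside_le {V : Type*} [Fintype V] (G : SimpleGraph V) (C : Finset V) :
    (isolatedOutside G C).card + C.card ≤ Fintype.card V := by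
  classical
  rw [← Finset.card_union_of_disjoint]
  · exact Finset.card_le_univ _
  · rw [Finset.disjoint_left]
    intro v hv
    simp only [isolatedOutside, Finset.mem_filter] at hv
    exact hv.2.1

open Classical in
/-- The ratio of the greedy algorithm on regular graphs in which a covered vertex has at most `b`
uncovered neighbors. -/
theorem hasPolyTimeApproximation_of_greedyExtendable {C : (n : ℕ) → SimpleGraph (Fin n) → Prop}
    {k c D d b n₀ : ℕ} (hk : 0 < k) (hd : 0 < d) {r ε : ℝ} (hr : 1 ≤ r) (hε : 0 < ε)
    (hreg : ∀ n G, C n G → ∀ v, (G.neighborFinset v).card = d)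
    (hext : ∀ n G, n₀ ≤ n → C n G → GreedyExtendable k c D G)
    (hb : ∀ n G, C n G → ∀ M : G.Subgraph, IsMaximalMatching G M → ∀ v ∈ M.verts,
      ∀ S : Finset (Fin n), (∀ w ∈ S, G.Adj v w ∧ w ∉ M.verts) → S.card ≤ b)
    (hc : 0 < c) (hratio : ((c : ℝ) - 1) * (d + b) = r * (c * d)) :
    HasPolyTimeApproximation C (r + ε) := by
  -- From this order on, the lower bound on `γ`, which is linear in `n`, makes the error due to `D`
  -- at most `ε γ`.
  obtain ⟨n₁, hn₁⟩ := exists_nat_gt ((D : ℝ) * (d + b) / (ε * (c * d)))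
  refine HasPolyTimeApproximation.of_eventually (by linarith) (max n₀ n₁) ?_
  obtain ⟨P, T, h⟩ := exists_greedy_program k c D hk
  refine ⟨P, T, fun n G ⟨hn, hG⟩ => ?_⟩
  obtain ⟨t, s, hrun, ht, M, hM, ho, S, hS, hpot⟩ := h n G (hext n G (by omega) hG)
  refine ⟨t, s, hrun, ht, M, hM, ho, ?_⟩
  obtain ⟨M₀, hM₀, hcard⟩ := exists_maximalMatching_card_eq G
  have hlow := hM₀.regular_bound (hreg n G hG) (hb n G hG M₀ hM₀)
  rw [hcard, Fintype.card_fin] at hlow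
  have hSM : S.card = 2 * M.edgeSet.ncard := by
    rw [hM.prop.two_mul_ncard_edgeSet, ← hS, Set.ncard_coe_finset]
  -- A full vertex has a neighbor because `0 < d`, and the edge between them would be uncovered.
  have hfull : fullOutside G S = ∅ := by
    rw [Finset.eq_empty_iff_forall_notMem]
    intro v hv
    simp only [fullOutside, Finset.mem_filter, Finset.mem_univ, true_and] at hv
    obtain ⟨w, hw⟩ := Finset.card_pos.1 ((hreg n G hG v).symm ▸ hd)
    rw [SimpleGraph.mem_neighborFinset] at hw
    rcases hM.covers hw with h | h
    · exact hv.1 (by rwa [← hS] at h)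
    · exact hv.2 w hw (by rwa [← hS] at h)
  have hiso := card_isolatedOutside_le G S
  rw [Fintype.card_fin, hSM] at hiso
  rw [potential, hfull, Finset.card_empty] at hpot
  set m := M.edgeSet.ncard
  set γ := edgeDominationNumber G
  -- With `i` isolated vertices, `n ≤ c * i + D` and `i + 2 * m ≤ n`; eliminate `i`.
  have h1 : n + c * (2 * m) ≤ c * n + D := by nlinarith
  have h1' : (n : ℝ) + c * (2 * m) ≤ c * n + D := by exact_mod_cast h1
  have h2 : (d : ℝ) * n ≤ 2 * γ * (d + b) := by exact_mod_cast hlow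
  have hc' : (0 : ℝ) < c := by exact_mod_cast hc
  have hd' : (0 : ℝ) < d := by exact_mod_cast hd
  have hb' : (0 : ℝ) ≤ b := Nat.cast_nonneg b
  have hc1 : (1 : ℝ) ≤ c := by exact_mod_cast hc
  have h3 : (n₁ : ℝ) ≤ n := by exact_mod_cast (le_max_right n₀ n₁).trans hn
  have h4 : (D : ℝ) * (d + b) ≤ n * (ε * (c * d)) :=
    ((div_lt_iff₀ (by positivity)).1 (hn₁.trans_le h3)).le
  have hpos : (0 : ℝ) < 2 * c * d := by positivity
  have h5 : (D : ℝ) * d ≤ ε * (2 * c * d) * γ := by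
    have h6 : (D : ℝ) * (d + b) * d ≤ (ε * c * d) * (2 * γ * (d + b)) := by
      calc (D : ℝ) * (d + b) * d ≤ n * (ε * (c * d)) * d := by gcongr
        _ = (ε * c * d) * (d * n) := by ring
        _ ≤ _ := by gcongr
    have h7 : (0 : ℝ) < d + b := by positivity
    refine le_of_mul_le_mul_right ?_ h7
    nlinarith
  refine le_of_mul_le_mul_left ?_ hpos
  have h8 : ((c : ℝ) - 1) * (d * n) ≤ (c - 1) * (2 * γ * (d + b)) := by
    have : (0 : ℝ) ≤ c - 1 := by linarith
    gcongr
  have h9 : (2 * c * d : ℝ) * m ≤ (c - 1) * (d * n) + D * d := by nlinarith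
  have h10 : ((c : ℝ) - 1) * (2 * γ * (d + b)) = 2 * c * d * (r * γ) := by
    linear_combination (2 * γ : ℝ) * hratio
  nlinarith

/-! ### Extensions in regular graphs -/

section Extend

variable {V : Type*}

theorem pairVerts_insert [DecidableEq V] {N : Finset (V × V)} {a b t : V} :
    t ∈ pairVerts (insert (a, b) N) ↔ t = a ∨ t = b ∨ t ∈ pairVerts N := by
  simp only [mem_pairVerts, Finset.exists_mem_insert, or_assoc]

theorem fst_mem_pairVerts {N : Finset (V × V)} {e : V × V} (he : e ∈ N) : e.1 ∈ pairVerts N :=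
  mem_pairVerts.2 ⟨e, he, .inl rfl⟩

theorem snd_mem_pairVerts {N : Finset (V × V)} {e : V × V} (he : e ∈ N) : e.2 ∈ pairVerts N :=
  mem_pairVerts.2 ⟨e, he, .inr rfl⟩

variable {G : SimpleGraph V} {C : Finset V} {N : Finset (V × V)}

theorem isExtension_empty : IsExtension G C ∅ where
  adj := by simp
  fst_notMem := by simp
  snd_notMem := by simp
  disjoint := by simp

theorem IsExtension.mono (h : IsExtension G C N) {N' : Finset (V × V)} (hN' : N' ⊆ N) :
    IsExtension G C N' where
  adj e he := h.adj e (hN' he)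
  fst_notMem e he := h.fst_notMem e (hN' he)
  snd_notMem e he := h.snd_notMem e (hN' he)
  disjoint e he f hf := h.disjoint e (hN' he) f (hN' hf)

theorem IsExtension.insert_pair [DecidableEq V] (h : IsExtension G C N) {a b : V} (hab : G.Adj a b)
    (ha : a ∉ C) (hb : b ∉ C) (haN : a ∉ pairVerts N) (hbN : b ∉ pairVerts N) :
    IsExtension G C (insert (a, b) N) where
  adj := by
    rw [Finset.forall_mem_insert]
    exact ⟨hab, h.adj⟩
  fst_notMem := by
    rw [Finset.forall_mem_insert]
    exact ⟨ha, h.fst_notMem⟩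
  snd_notMem := by
    rw [Finset.forall_mem_insert]
    exact ⟨hb, h.snd_notMem⟩
  disjoint := by
    have key : ∀ e ∈ N, a ≠ e.1 ∧ a ≠ e.2 ∧ b ≠ e.1 ∧ b ≠ e.2 := fun e he =>
      ⟨fun h => haN (h ▸ fst_mem_pairVerts he), fun h => haN (h ▸ snd_mem_pairVerts he),
        fun h => hbN (h ▸ fst_mem_pairVerts he), fun h => hbN (h ▸ snd_mem_pairVerts he)⟩
    rw [Finset.forall_mem_insert]
    refine ⟨fun f hf => ?_, fun e he f hf => ?_⟩
    · rcases Finset.mem_insert.1 hf with rfl | hf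
      · exact .inl rfl
      · exact .inr (key f hf)
    · rcases Finset.mem_insert.1 hf with rfl | hf
      · obtain ⟨h1, h2, h3, h4⟩ := key e he
        exact .inr ⟨h1.symm, h3.symm, h2.symm, h4.symm⟩
      · exact h.disjoint e he f hf

theorem IsExtension.notMem_pairVerts_erase [DecidableEq V] (h : IsExtension G C N) {e : V × V}
    (he : e ∈ N) : e.1 ∉ pairVerts (N.erase e) ∧ e.2 ∉ pairVerts (N.erase e) := by
  simp only [mem_pairVerts, not_exists, not_and, Finset.mem_erase]
  refine ⟨fun f hf => ?_, fun f hf => ?_⟩ <;>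
    have := h.disjoint e he f hf.2 <;> have := hf.1 <;> tauto

theorem pairVerts_erase_subset [DecidableEq V] {e : V × V} {t : V}
    (ht : t ∈ pairVerts (N.erase e)) : t ∈ pairVerts N := by
  rw [mem_pairVerts] at ht ⊢
  obtain ⟨f, hf, h⟩ := ht
  exact ⟨f, Finset.mem_of_mem_erase hf, h⟩

theorem mem_pairVerts_erase [DecidableEq V] {e : V × V} {t : V}
    (ht : t ∈ pairVerts N) : t = e.1 ∨ t = e.2 ∨ t ∈ pairVerts (N.erase e) := by
  rw [mem_pairVerts] at ht
  obtain ⟨f, hf, h⟩ := ht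
  by_cases hfe : f = e
  · subst hfe
    tauto
  · exact .inr (.inr (mem_pairVerts.2 ⟨f, Finset.mem_erase.2 ⟨hfe, hf⟩, h⟩))

theorem mem_isolatedOutside [Fintype V] {v : V} :
    v ∈ isolatedOutside G C ↔ v ∉ C ∧ ∀ w, G.Adj v w → w ∈ C := by
  simp [isolatedOutside]

theorem mem_fullOutside [Fintype V] {v : V} :
    v ∈ fullOutside G C ↔ v ∉ C ∧ ∀ w, G.Adj v w → w ∉ C := by
  simp [fullOutside]

/-- All neighbors of an isolated vertex lie in `C`, so no new edge can cover it. -/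
theorem IsExtension.isolatedOutside_subset [Fintype V] [DecidableEq V] (hN : IsExtension G C N) :
    isolatedOutside G C ⊆ isolatedOutside G (C ∪ pairVerts N) := by
  intro v hv
  rw [mem_isolatedOutside] at hv ⊢
  refine ⟨fun h => ?_, fun w hw => Finset.mem_union_left _ (hv.2 w hw)⟩
  rcases Finset.mem_union.1 h with h | h
  · exact hv.1 h
  · obtain ⟨e, he, rfl | rfl⟩ := mem_pairVerts.1 h
    · exact hN.snd_notMem e he (hv.2 _ (hN.adj e he))
    · exact hN.fst_notMem e he (hv.2 _ (hN.adj e he).symm)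

/-- A vertex can only cease to be full if it is adjacent to an end of a new edge; this includes the
ends themselves, each adjacent to the other. Thus `L` contains all the losses. -/
theorem IsExtension.fullOutside_subset [Fintype V] [DecidableEq V] (hN : IsExtension G C N)
    {L : Finset V}
    (hL : ∀ v ∈ fullOutside G C, (∃ e ∈ N, G.Adj e.1 v ∨ G.Adj e.2 v) → v ∈ L) :
    fullOutside G C ⊆ fullOutside G (C ∪ pairVerts N) ∪ L := by
  intro v hv
  rw [Finset.mem_union]
  by_cases h : ∃ e ∈ N, G.Adj e.1 v ∨ G.Adj e.2 v
  · exact .inr (hL v hv h)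
  · left
    push Not at h
    rw [mem_fullOutside] at hv ⊢
    refine ⟨fun hv' => ?_, fun w hw hw' => ?_⟩
    · rcases Finset.mem_union.1 hv' with h' | h'
      · exact hv.1 h'
      · obtain ⟨e, he, rfl | rfl⟩ := mem_pairVerts.1 h'
        · exact (h e he).2 (hN.adj e he).symm
        · exact (h e he).1 (hN.adj e he)
    · rcases Finset.mem_union.1 hw' with h' | h'
      · exact hv.2 w hw h'
      · obtain ⟨e, he, rfl | rfl⟩ := mem_pairVerts.1 h'
        · exact (h e he).1 hw.symm
        · exact (h e he).2 hw.symm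

/-- There is an extension that does not decrease the potential. -/
def HasExtension [Fintype V] [DecidableEq V] (k c : ℕ) (G : SimpleGraph V) (C : Finset V) : Prop :=
  ∃ N : Finset (V × V), N.Nonempty ∧ N.card ≤ k ∧ IsExtension G C N ∧
    potential c G C ≤ potential c G (C ∪ pairVerts N)

/-- The vertex `u` becomes isolated, which gains `c`; it was not isolated before because of its
neighbor `x`. The loss is at most `L.card ≤ c`. -/
theorem IsExtension.hasExtension [Fintype V] [DecidableEq V] {k c : ℕ} (hN : IsExtension G C N)
    (hk : N.card ≤ k) {u : V} (huC : u ∉ C) (huN : u ∉ pairVerts N)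
    (hu : ∀ w, G.Adj u w → w ∉ C → w ∈ pairVerts N) {x : V} (hux : G.Adj u x) (hx : x ∉ C)
    {L : Finset V} (hLc : L.card ≤ c)
    (hL : ∀ v ∈ fullOutside G C, ∀ e ∈ N, G.Adj e.1 v ∨ G.Adj e.2 v → v ∈ L) :
    HasExtension k c G C := by
  refine ⟨N, ?_, hk, hN, ?_⟩
  · obtain ⟨e, he, -⟩ := mem_pairVerts.1 (hu x hux hx)
    exact ⟨e, he⟩
  have h1 : insert u (isolatedOutside G C) ⊆ isolatedOutside G (C ∪ pairVerts N) := by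
    refine Finset.insert_subset (mem_isolatedOutside.2 ⟨by simp [huC, huN], fun w hw => ?_⟩)
      hN.isolatedOutside_subset
    by_cases hwC : w ∈ C
    · exact Finset.mem_union_left _ hwC
    · exact Finset.mem_union_right _ (hu w hw hwC)
  have h2 := Finset.card_le_card h1
  rw [Finset.card_insert_of_notMem fun h => hx ((mem_isolatedOutside.1 h).2 x hux)] at h2
  have h3 := Finset.card_le_card
    (hN.fullOutside_subset (L := L) fun v hv ⟨e, he, h⟩ => hL v hv e he h)
  have h4 := Finset.card_union_le (fullOutside G (C ∪ pairVerts N)) L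
  have h5 := Nat.mul_le_mul_left c h2
  rw [potential, potential]
  linarith

/-- The greedy algorithm makes progress if the potential can be maintained whenever some vertex
has full degree and one of its neighbors has not. -/
theorem greedyExtendable_of_hasExtension [Fintype V] [DecidableEq V] [DecidableRel G.Adj]
    {k c d : ℕ} (hk : 0 < k) (hG : G.Connected) (hd : ∀ v, (G.neighborFinset v).card = d)
    (h : ∀ (C : Finset V) (x y : V), x ∉ C → x ∉ fullOutside G C → y ∈ fullOutside G C →
      G.Adj x y → HasExtension k c G C) :
    GreedyExtendable k c (2 * d) G := by
  intro C hC ⟨u, v, huv, hu, hv⟩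
  -- In both cases a single edge will do. For `C = ∅` it destroys at most `2 * d` full vertices,
  -- which is what the slack `2 * d` is for; without full vertices, only the isolated ones count,
  -- and these persist.
  by_cases hCe : C = ∅ ∨ fullOutside G C = ∅
  · have hN : IsExtension G C {(u, v)} := by
      simpa using (isExtension_empty (G := G) (C := C)).insert_pair huv hu hv
        (by simp [mem_pairVerts]) (by simp [mem_pairVerts])
    refine ⟨{(u, v)}, by simp, by simpa using Nat.succ_le_of_lt hk, hN, ?_⟩
    rcases hCe with hCe | hCe
    · have h1 := Finset.card_le_card (hN.fullOutside_subset
        (L := G.neighborFinset u ∪ G.neighborFinset v) (by simp))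
      have h2 := Finset.card_union_le (G.neighborFinset u) (G.neighborFinset v)
      have h3 := Finset.card_union_le (fullOutside G (C ∪ pairVerts {(u, v)}))
        (G.neighborFinset u ∪ G.neighborFinset v)
      have h4 : fullOutside G C = Finset.univ := by
        ext
        simp [mem_fullOutside, hCe]
      rw [h4, Finset.card_univ] at h1
      rw [hd, hd] at h2
      rw [potential]
      nlinarith
    · refine hC.trans ?_
      have := Nat.mul_le_mul_left c (Finset.card_le_card hN.isolatedOutside_subset)
      simp only [potential, hCe, Finset.card_empty]
      omega
  · push Not at hCe
    obtain ⟨⟨z, hz⟩, ⟨f, hf⟩⟩ := hCe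
    have hzf : z ∉ fullOutside G C := fun h => (mem_fullOutside.1 h).1 hz
    obtain ⟨p⟩ := hG.preconnected f z
    -- A walk from a full vertex to `C` leaves the set of full vertices; the first vertex outside is
    -- still not in `C`, being a neighbor of a full one.
    obtain ⟨e, -, h1, h2⟩ := p.exists_boundary_dart (fullOutside G C : Set V) hf hzf
    obtain ⟨N, h3, h4, h5, h6⟩ := h C e.snd e.fst ((mem_fullOutside.1 h1).2 _ e.adj) h2 h1
      e.adj.symm
    exact ⟨N, h3, h4, h5, hC.trans (by omega)⟩

/-! ### The exchange argument around a vertex -/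

/-- An extension of `C` by edges that avoid `x` and start in a neighbor of `x`. -/
structure IsExtensionAt (G : SimpleGraph V) (C : Finset V) (x : V) (N : Finset (V × V)) : Prop
    extends IsExtension G C N where
  adj_fst : ∀ e ∈ N, G.Adj x e.1
  notMem : x ∉ pairVerts N

/-- The exchange move: the edge `e` gives way to `ab`, which may reuse an end of `e`. -/
theorem IsExtensionAt.insert_erase [DecidableEq V] {x : V} (h : IsExtensionAt G C x N)
    (e : V × V) {a b : V} (hxa : G.Adj x a) (hbx : b ≠ x) (hab : G.Adj a b) (ha : a ∉ C)
    (hb : b ∉ C) (haN : a ∉ pairVerts (N.erase e)) (hbN : b ∉ pairVerts (N.erase e)) :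
    IsExtensionAt G C x (insert (a, b) (N.erase e)) where
  toIsExtension := (h.toIsExtension.mono (Finset.erase_subset _ _)).insert_pair hab ha hb haN hbN
  adj_fst := by
    rw [Finset.forall_mem_insert]
    exact ⟨hxa, fun f hf => h.adj_fst f (Finset.mem_of_mem_erase hf)⟩
  notMem := by
    rw [pairVerts_insert]
    rintro (rfl | rfl | hx)
    · exact hxa.ne rfl
    · exact hbx rfl
    · exact h.notMem (pairVerts_erase_subset hx)

theorem card_biUnion_neighborFinset_le [Fintype V] [DecidableEq V] [DecidableRel G.Adj] {d : ℕ}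
    (hd : ∀ v, (G.neighborFinset v).card = d) (N : Finset (V × V)) :
    (N.biUnion fun e => G.neighborFinset e.1 ∪ G.neighborFinset e.2).card ≤ N.card * (2 * d) := by
  refine Finset.card_biUnion_le_card_mul _ _ _ fun e _ => (Finset.card_union_le _ _).trans ?_
  rw [hd, hd]
  omega

/-- Let `A` be the set of neighbors of `x` outside `C`; `A.card ≤ d - 1` because `x` is not full.
Take edges outside `C` that avoid `x`, start in `A`, and cover as much of `A` as possible. If they
cover `A`, they isolate `x`. Otherwise some `w ∈ A` is left; if no vertex could be isolated cheaply,
then every optimal choice would cover `y`, but exchanging the edge at `y` for one at `w` gives an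
optimal choice that misses `y`. -/
theorem hasExtension_of_regular [Fintype V] [DecidableEq V] [DecidableRel G.Adj] {d : ℕ}
    (hd3 : 3 ≤ d) (hd : ∀ v, (G.neighborFinset v).card = d) {x y : V} (hx : x ∉ C)
    (hxf : x ∉ fullOutside G C) (hy : y ∈ fullOutside G C) (hxy : G.Adj x y) :
    HasExtension d ((2 * d - 1) * (d - 1)) G C := by
  classical
  set A : Finset V := (G.neighborFinset x).filter (· ∉ C) with hA
  have memA : ∀ {v}, v ∈ A ↔ G.Adj x v ∧ v ∉ C := by simp [hA]
  have hyC : y ∉ C := (mem_fullOutside.1 hy).1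
  have hyA : y ∈ A := memA.2 ⟨hxy, hyC⟩
  have hAd : A.card + 1 ≤ d := by
    rw [mem_fullOutside] at hxf
    push Not at hxf
    obtain ⟨z, hxz, hz⟩ := hxf hx
    rw [← hd x]
    exact Finset.card_lt_card (Finset.filter_ssubset.2 ⟨z, by simpa using hxz, by simpa using hz⟩)
  let cov : Finset (V × V) → ℕ := fun N => (A.filter (· ∈ pairVerts N)).card
  -- The number of edges is at most the number of covered neighbors.
  have hcov : ∀ N, IsExtensionAt G C x N → N.card ≤ cov N := by
    intro N hN
    refine Finset.card_le_card_of_injOn Prod.fst (fun e he => ?_) fun e he f hf hef => ?_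
    · simp only [Finset.coe_filter, Set.mem_ofPred_eq]
      exact ⟨memA.2 ⟨hN.adj_fst e he, hN.fst_notMem e he⟩, fst_mem_pairVerts he⟩
    · have := hN.disjoint e he f hf
      tauto
  have hcovA : ∀ N w, w ∈ A → w ∉ pairVerts N → cov N + 1 ≤ A.card := fun N w hw hwN =>
    Finset.card_lt_card (Finset.filter_ssubset.2 ⟨w, hw, hwN⟩)
  obtain ⟨N, hN, hmax⟩ := Finset.exists_max_image
    (Finset.univ.filter fun N => IsExtensionAt G C x N) cov ⟨∅, by
      simp only [Finset.mem_filter, Finset.mem_univ, true_and]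
      exact ⟨isExtension_empty, by simp, by simp [mem_pairVerts]⟩⟩
  simp only [Finset.mem_filter, Finset.mem_univ, true_and] at hN hmax
  by_cases hall : ∀ w ∈ A, w ∈ pairVerts N
  · -- All neighbors are covered, so `x` becomes isolated.
    have hNd : N.card ≤ d - 1 := (hcov N hN).trans (by
      have : cov N ≤ A.card := Finset.card_filter_le _ _
      omega)
    -- Each edge has an end adjacent to `x`, which is not full, so it destroys at most `2 * d - 1`
    -- full vertices; there are at most `d - 1` edges.
    refine hN.hasExtension (by omega) hx hN.notMem (fun w hw hwC => hall w (memA.2 ⟨hw, hwC⟩))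
      hxy hyC (L := N.biUnion fun e => (G.neighborFinset e.1 ∪ G.neighborFinset e.2).erase x) ?_ ?_
    · refine (Finset.card_biUnion_le_card_mul _ _ (2 * d - 1) fun e he => ?_).trans ?_
      · have hxe : x ∈ G.neighborFinset e.1 ∪ G.neighborFinset e.2 := by
          simpa using .inl (hN.adj_fst e he).symm
        rw [Finset.card_erase_of_mem hxe]
        have := Finset.card_union_le (G.neighborFinset e.1) (G.neighborFinset e.2)
        rw [hd, hd] at this
        omega
      · rw [mul_comm]
        exact Nat.mul_le_mul_left _ hNd
    · intro v hv e he h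
      rw [Finset.mem_biUnion]
      refine ⟨e, he, Finset.mem_erase.2 ⟨?_, by simpa using h⟩⟩
      rintro rfl
      exact hxf hv
  push Not at hall
  obtain ⟨w, hwA, hwN⟩ := hall
  -- Few edges that isolate a vertex suffice.
  have hfew : ∀ N' : Finset (V × V), IsExtension G C N' → N'.card + 1 ≤ A.card → ∀ w ∈ A,
      w ∉ pairVerts N' → (∀ t, G.Adj w t → t ∉ C → t ∈ pairVerts N') →
      HasExtension d ((2 * d - 1) * (d - 1)) G C := by
    intro N' hN' hcard w hw hwN' ht
    refine hN'.hasExtension (by omega) (memA.1 hw).2 hwN' ht (memA.1 hw).1.symm hx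
      (L := N'.biUnion fun e => G.neighborFinset e.1 ∪ G.neighborFinset e.2) ?_
      fun v _ e he h => Finset.mem_biUnion.2 ⟨e, he, by simpa using h⟩
    refine (card_biUnion_neighborFinset_le hd N').trans ?_
    obtain ⟨d, rfl⟩ := Nat.exists_eq_add_of_le hd3
    rw [show 2 * (3 + d) - 1 = 2 * d + 5 by omega, show 3 + d - 1 = d + 2 by omega]
    have : N'.card ≤ d + 1 := by omega
    nlinarith
  by_contra hcon
  -- The neighbors of an uncovered neighbor of `x`.
  have hnbr : ∀ N, IsExtensionAt G C x N → (∀ N', IsExtensionAt G C x N' → cov N' ≤ cov N) →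
      ∀ w ∈ A, w ∉ pairVerts N → ∀ t, G.Adj w t → t ∉ C → t = x ∨ t ∈ pairVerts N := by
    intro N hN hmax w hw hwN t hwt htC
    by_contra! ht
    have hN' : IsExtensionAt G C x (insert (w, t) N) :=
      ⟨hN.toIsExtension.insert_pair hwt (memA.1 hw).2 htC hwN ht.2, by
        rw [Finset.forall_mem_insert]
        exact ⟨(memA.1 hw).1, hN.adj_fst⟩, by
        rw [pairVerts_insert]
        rintro (h | h | h)
        exacts [(memA.1 hw).1.ne h, ht.1 h.symm, hN.notMem h]⟩
    refine absurd (hmax _ hN') (not_le.2 (Finset.card_lt_card ?_))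
    rw [Finset.ssubset_iff_of_subset]
    · exact ⟨w, by simp [hw, pairVerts_insert], by simp [hwN]⟩
    · intro a ha
      rw [Finset.mem_filter] at ha ⊢
      exact ⟨ha.1, pairVerts_insert.2 (.inr (.inr ha.2))⟩
  -- If `w` were not adjacent to `z'`, replacing `zz'` by `zx` would cover all neighbors of `w`
  -- outside `C`, with at most `A.card - 1` edges.
  have hpartner : ∀ N, IsExtensionAt G C x N → (∀ N', IsExtensionAt G C x N' → cov N' ≤ cov N) →
      ∀ w ∈ A, w ∉ pairVerts N → ∀ e ∈ N, ∀ z z', (z = e.1 ∧ z' = e.2 ∨ z = e.2 ∧ z' = e.1) →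
      z ∈ A → G.Adj w z' := by
    intro N hN hmax w hw hwN e he z z' hz hzA
    by_contra hwz
    have hzN : z ∉ pairVerts (N.erase e) := by
      have := hN.notMem_pairVerts_erase he
      rcases hz with h | h
      exacts [h.1 ▸ this.1, h.1 ▸ this.2]
    have hwe : w ≠ z := by
      rintro rfl
      rcases hz with h | h
      exacts [hwN (h.1 ▸ fst_mem_pairVerts he), hwN (h.1 ▸ snd_mem_pairVerts he)]
    refine hcon (hfew (insert (z, x) (N.erase e))
      ((hN.toIsExtension.mono (Finset.erase_subset _ _)).insert_pair (memA.1 hzA).1.symm (memA.1 hzA).2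
        hx hzN fun h => hN.notMem (pairVerts_erase_subset h)) ?_ w hw ?_ ?_)
    · have h1 := Finset.card_insert_le (z, x) (N.erase e)
      rw [Finset.card_erase_of_mem he] at h1
      have := Finset.card_pos.2 ⟨e, he⟩
      have := hcov N hN
      have := hcovA N w hw hwN
      omega
    · rw [pairVerts_insert]
      rintro (h | h | h)
      exacts [hwe h, (memA.1 hw).1.ne h.symm, hwN (pairVerts_erase_subset h)]
    · intro t hwt htC
      rw [pairVerts_insert]
      rcases hnbr N hN hmax w hw hwN t hwt htC with h | h
      · exact .inr (.inl h)
      · have htz' : t ≠ z' := by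
          rintro rfl
          exact hwz hwt
        rcases mem_pairVerts_erase (e := e) h with h | h | h
        · rcases hz with h' | h'
          exacts [.inl (h.trans h'.1.symm), absurd (h.trans h'.2.symm) htz']
        · rcases hz with h' | h'
          exacts [absurd (h.trans h'.2.symm) htz', .inl (h.trans h'.1.symm)]
        · exact .inr (.inr h)
  -- The vertex `y` of full degree is covered.
  have hycov : ∀ N, IsExtensionAt G C x N → (∀ N', IsExtensionAt G C x N' → cov N' ≤ cov N) →
      y ∈ pairVerts N := by
    intro N hN hmax
    by_contra hyN
    -- Otherwise replacing `e` by the edge from `y` to `e.1` would cover `y` in addition and lose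
    -- nothing in `A`.
    have hin : ∀ e ∈ N, e.2 ∉ A → ¬ G.Adj y e.1 := by
      intro e he he2 hye
      have hN' := hN.insert_erase e hxy (hN.adj_fst e he).ne' hye hyC
        (hN.fst_notMem e he) (fun h => hyN (pairVerts_erase_subset h))
        (hN.notMem_pairVerts_erase he).1
      refine absurd (hmax _ hN') (not_le.2 (Finset.card_lt_card ?_))
      rw [Finset.ssubset_iff_of_subset]
      · exact ⟨y, by simp [hyA, pairVerts_insert], by simp [hyN]⟩
      · intro a ha
        rw [Finset.mem_filter] at ha ⊢
        refine ⟨ha.1, pairVerts_insert.2 ?_⟩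
        rcases mem_pairVerts_erase (e := e) ha.2 with h | h | h
        exacts [.inr (.inl h), absurd (h ▸ ha.1) he2, .inr (.inr h)]
    -- Map a neighbor of `y` in `A` to itself, and one outside `A` to its partner, which lies in
    -- `A`. By `hin` this is injective. As `y` is full, its `d - 1` neighbors other than `x` are all
    -- available, but `cov N ≤ d - 2`.
    have hle : ((G.neighborFinset y).erase x).card ≤ cov N := by
      refine Finset.card_le_card_of_forall_subsingleton
        (fun t b => t ∈ A ∧ b = t ∨ t ∉ A ∧ (b, t) ∈ N) (fun t ht => ?_) fun b hb => ?_
      · rw [Finset.mem_erase, SimpleGraph.mem_neighborFinset] at ht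
        have htN := (hnbr N hN hmax y hyA hyN t ht.2
          ((mem_fullOutside.1 hy).2 t ht.2)).resolve_left ht.1
        by_cases htA : t ∈ A
        · exact ⟨t, Finset.mem_filter.2 ⟨htA, htN⟩, .inl ⟨htA, rfl⟩⟩
        · obtain ⟨e, he, h⟩ := mem_pairVerts.1 htN
          have he1 : e.1 ∈ A := memA.2 ⟨hN.adj_fst e he, hN.fst_notMem e he⟩
          rcases h with rfl | rfl
          · exact absurd he1 htA
          · exact ⟨e.1, Finset.mem_filter.2 ⟨he1, fst_mem_pairVerts he⟩, .inr ⟨htA, he⟩⟩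
      · rintro t ⟨ht, h⟩ t' ⟨ht', h'⟩
        rw [Finset.mem_erase, SimpleGraph.mem_neighborFinset] at ht ht'
        rcases h with ⟨h1, rfl⟩ | ⟨h1, h2⟩ <;> rcases h' with ⟨h3, rfl⟩ | ⟨h3, h4⟩
        · rfl
        · exact absurd ht.2 (hin _ h4 h3)
        · exact absurd ht'.2 (hin _ h2 h1)
        · have := hN.disjoint _ h2 _ h4
          simpa using this
    rw [Finset.card_erase_of_mem (by simpa using hxy.symm), hd] at hle
    have := hcovA N y hyA hyN
    omega
  obtain ⟨e, he, hye⟩ := mem_pairVerts.1 (hycov N hN hmax)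
  obtain ⟨y', hy'⟩ : ∃ y', y = e.1 ∧ y' = e.2 ∨ y = e.2 ∧ y' = e.1 := by
    rcases hye with h | h
    exacts [⟨_, .inl ⟨h, rfl⟩⟩, ⟨_, .inr ⟨h, rfl⟩⟩]
  have hwy' := hpartner N hN hmax w hwA hwN e he y y' hy' hyA
  have hnot := hN.notMem_pairVerts_erase he
  have hyw : y ≠ w := by
    rintro rfl
    exact hwN (hycov N hN hmax)
  have hyy' : y ≠ y' := by
    have := (hN.adj e he).ne
    rcases hy' with ⟨rfl, rfl⟩ | ⟨rfl, rfl⟩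
    exacts [this, this.symm]
  have hy'N : y' ∈ pairVerts N ∧ y' ∉ C ∧ y' ∉ pairVerts (N.erase e) ∧
      y ∉ pairVerts (N.erase e) := by
    rcases hy' with ⟨rfl, rfl⟩ | ⟨rfl, rfl⟩
    exacts [⟨snd_mem_pairVerts he, hN.snd_notMem e he, hnot.2, hnot.1⟩,
      ⟨fst_mem_pairVerts he, hN.fst_notMem e he, hnot.1, hnot.2⟩]
  have hN₂ := hN.insert_erase e (memA.1 hwA).1 (fun h => hN.notMem (h ▸ hy'N.1)) hwy'
    (memA.1 hwA).2 hy'N.2.1 (fun h => hwN (pairVerts_erase_subset h)) hy'N.2.2.1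
  have hcov₂ : cov N ≤ cov (insert (w, y') (N.erase e)) := by
    have h1 : insert w ((A.filter (· ∈ pairVerts N)).erase y) ⊆
        A.filter (· ∈ pairVerts (insert (w, y') (N.erase e))) := by
      refine Finset.insert_subset (by simp [hwA, pairVerts_insert]) fun a ha => ?_
      rw [Finset.mem_erase, Finset.mem_filter] at ha
      refine Finset.mem_filter.2 ⟨ha.2.1, pairVerts_insert.2 ?_⟩
      rcases mem_pairVerts_erase (e := e) ha.2.2 with h | h | h
      · rcases hy' with h' | h'
        exacts [absurd (h.trans h'.1.symm) ha.1, .inr (.inl (h.trans h'.2.symm))]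
      · rcases hy' with h' | h'
        exacts [.inr (.inl (h.trans h'.2.symm)), absurd (h.trans h'.1.symm) ha.1]
      · exact .inr (.inr h)
    have h2 := Finset.card_le_card h1
    have h3 : y ∈ A.filter fun a => a ∈ pairVerts N :=
      Finset.mem_filter.2 ⟨hyA, hycov N hN hmax⟩
    rw [Finset.card_insert_of_notMem (by simp [hwN]), Finset.card_erase_of_mem h3] at h2
    simp only [cov]
    omega
  have := hycov _ hN₂ fun N' hN' => (hmax N' hN').trans hcov₂
  rcases pairVerts_insert.1 this with h | h | h
  exacts [hyw h, hyy' h, hy'N.2.2.2 h]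

end Extend

/-! ### The structure of cubic bipartite `T*`-free graphs -/

section TStarFree

variable {V : Type*} {G : SimpleGraph V}

/-- The vertex `v` has exactly the three neighbors `a`, `b`, and `c`. -/
structure HasNeighbors (G : SimpleGraph V) (v a b c : V) : Prop where
  ne₁₂ : a ≠ b
  ne₁₃ : a ≠ c
  ne₂₃ : b ≠ c
  adj_iff : ∀ w, G.Adj v w ↔ w = a ∨ w = b ∨ w = c

namespace HasNeighbors

variable {v a b c : V}

theorem swap₁₂ (h : HasNeighbors G v a b c) : HasNeighbors G v b a c :=
  ⟨h.ne₁₂.symm, h.ne₂₃, h.ne₁₃, fun w => by rw [h.adj_iff]; tauto⟩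

theorem swap₂₃ (h : HasNeighbors G v a b c) : HasNeighbors G v a c b :=
  ⟨h.ne₁₃, h.ne₁₂, h.ne₂₃.symm, fun w => by rw [h.adj_iff]; tauto⟩

theorem rotate (h : HasNeighbors G v a b c) : HasNeighbors G v b c a := h.swap₁₂.swap₂₃

theorem adj₁ (h : HasNeighbors G v a b c) : G.Adj v a := (h.adj_iff a).2 (.inl rfl)

theorem adj₂ (h : HasNeighbors G v a b c) : G.Adj v b := (h.adj_iff b).2 (.inr (.inl rfl))

theorem adj₃ (h : HasNeighbors G v a b c) : G.Adj v c := (h.adj_iff c).2 (.inr (.inr rfl))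

theorem exists_third (h : HasNeighbors G v a b c) {x y : V} (hx : G.Adj v x) (hy : G.Adj v y)
    (hxy : x ≠ y) : ∃ z, HasNeighbors G v x y z := by
  rw [h.adj_iff] at hx hy
  rcases hx with rfl | rfl | rfl <;> rcases hy with rfl | rfl | rfl
  exacts [absurd rfl hxy, ⟨_, h⟩, ⟨_, h.swap₂₃⟩, ⟨_, h.swap₁₂⟩, absurd rfl hxy, ⟨_, h.rotate⟩,
    ⟨_, h.rotate.rotate⟩, ⟨_, h.rotate.swap₁₂⟩, absurd rfl hxy]

theorem exists_others (h : HasNeighbors G v a b c) {x : V} (hx : G.Adj v x) :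
    ∃ y z, HasNeighbors G v x y z := by
  rw [h.adj_iff] at hx
  rcases hx with rfl | rfl | rfl
  exacts [⟨_, _, h⟩, ⟨_, _, h.swap₁₂⟩, ⟨_, _, h.rotate.rotate⟩]

theorem eq_third (h : HasNeighbors G v a b c) {x : V} (hx : G.Adj v x) (ha : x ≠ a) (hb : x ≠ b) :
    x = c :=
  (((h.adj_iff x).1 hx).resolve_left ha).resolve_left hb

theorem congr_third (h : HasNeighbors G v a b c) {x : V} (hx : G.Adj v x) (ha : x ≠ a)
    (hb : x ≠ b) : HasNeighbors G v a b x :=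
  h.eq_third hx ha hb ▸ h

end HasNeighbors

/-- A complete bipartite graph with three vertices in both classes, without one edge, that is
attached to the rest of the cubic graph by the edges `r r'` and `c c'`. -/
structure IsBlock (G : SimpleGraph V) (p q r a b c r' c' : V) : Prop where
  nbrs_p : HasNeighbors G p a b c
  nbrs_q : HasNeighbors G q a b c
  nbrs_r : HasNeighbors G r a b r'
  nbrs_a : HasNeighbors G a p q r
  nbrs_b : HasNeighbors G b p q r
  nbrs_c : HasNeighbors G c p q c'
  ne_rc : r ≠ c

namespace IsBlock

variable {p q r a b c r' c' : V}

theorem swap_pq (h : IsBlock G p q r a b c r' c') : IsBlock G q p r a b c r' c' :=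
  ⟨h.nbrs_q, h.nbrs_p, h.nbrs_r, h.nbrs_a.swap₁₂, h.nbrs_b.swap₁₂, h.nbrs_c.swap₁₂, h.ne_rc⟩

theorem swap_ab (h : IsBlock G p q r a b c r' c') : IsBlock G p q r b a c r' c' :=
  ⟨h.nbrs_p.swap₁₂, h.nbrs_q.swap₁₂, h.nbrs_r.swap₁₂, h.nbrs_b, h.nbrs_a, h.nbrs_c, h.ne_rc⟩

/-- Interchanging the color classes makes every statement about `p`, `q`, `r` available for `a`,
`b`, `c`. -/
theorem dual (h : IsBlock G p q r a b c r' c') : IsBlock G a b c p q r c' r' :=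
  ⟨h.nbrs_a, h.nbrs_b, h.nbrs_c, h.nbrs_p, h.nbrs_q, h.nbrs_r, h.ne_rc.symm⟩

end IsBlock

/-- The vertex `v` belongs to a block. -/
def InBlock (G : SimpleGraph V) (v : V) : Prop :=
  ∃ p q r a b c r' c', IsBlock G p q r a b c r' c' ∧ (v = p ∨ v = q ∨ v = r)

theorem card_le_of_closed [Fintype V] (hG : G.Connected) {S : Finset V} {v : V} (hv : v ∈ S)
    (hS : ∀ x ∈ S, ∀ y, G.Adj x y → y ∈ S) : Fintype.card V ≤ S.card := by
  classical
  refine Finset.card_le_card fun x _ => ?_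
  by_contra hx
  obtain ⟨p⟩ := hG.preconnected v x
  obtain ⟨e, -, h1, h2⟩ := p.exists_boundary_dart (S : Set V) hv hx
  exact h2 (hS _ h1 _ e.adj)

/-- In a bipartite `T*`-free graph, at most one neighbor of a vertex has a neighbor that is not
adjacent to the other two neighbors. -/
theorem adj_of_tStarFree {f : V → Bool} (hf : ∀ u v, G.Adj u v → f u ≠ f v)
    (hT : InducedFree TStar G) {v a b c a' b' : V} (hv : HasNeighbors G v a b c)
    (ha : G.Adj a a') (hav : a' ≠ v) (hb : G.Adj b b') (hbv : b' ≠ v) :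
    (G.Adj a' b ∨ G.Adj a' c) ∨ (G.Adj b' a ∨ G.Adj b' c) := by
  by_contra! h
  obtain ⟨⟨h1, h2⟩, h3, h4⟩ := h
  have hfa := hf _ _ hv.adj₁
  have hfb := hf _ _ hv.adj₂
  have hfc := hf _ _ hv.adj₃
  have hfa' := hf _ _ ha
  have hfb' := hf _ _ hb
  have same : ∀ {x y}, f x = f y → ¬ G.Adj x y := fun h h' => hf _ _ h' h
  -- The coloring excludes all edges inside the two classes; the four remaining nonedges of `T*` are
  -- the negated conclusion.
  have e1 : f a = f b := by revert hfa hfb; cases f v <;> cases f a <;> cases f b <;> simp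
  have e2 : f a = f c := by revert hfa hfc; cases f v <;> cases f a <;> cases f c <;> simp
  have e3 : f v = f a' := by revert hfa hfa'; cases f v <;> cases f a <;> cases f a' <;> simp
  have e4 : f v = f b' := by revert hfb hfb'; cases f v <;> cases f b <;> cases f b' <;> simp
  have n1 := same e1
  have n2 := same e2
  have n3 := same (e1.symm.trans e2)
  have n4 := same e3
  have n5 := same e4
  have n6 := same (e3.symm.trans e4)
  have a1 := hv.adj₁
  have a2 := hv.adj₂
  have a3 := hv.adj₃
  have c1 : a' ≠ b' := by rintro rfl; exact h3 ha.symm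
  have ne : ∀ {x y}, f x ≠ f y → x ≠ y := fun h h' => h (congrArg f h')
  have m1 : a' ≠ a := ha.ne'
  have m2 : a' ≠ b := ne (e3 ▸ hfb)
  have m3 : a' ≠ c := ne (e3 ▸ hfc)
  have m4 : b' ≠ a := ne (e4 ▸ hfa)
  have m5 : b' ≠ b := hb.ne'
  have m6 : b' ≠ c := ne (e4 ▸ hfc)
  have d1 := hv.ne₁₂
  have d2 := hv.ne₁₃
  have d3 := hv.ne₂₃
  have inj : Function.Injective ![v, a, b, c, a', b'] := by
    intro i j
    fin_cases i <;> fin_cases j <;>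
      simp [a1.ne, a1.ne', a2.ne, a2.ne', a3.ne, a3.ne', hav, hav.symm, hbv, hbv.symm, c1, c1.symm,
        m1, m1.symm, m2, m2.symm, m3, m3.symm, m4, m4.symm, m5, m5.symm, m6, m6.symm,
        d1, d1.symm, d2, d2.symm, d3, d3.symm]
  have adj : ∀ i j : Fin 6, G.Adj (![v, a, b, c, a', b'] i) (![v, a, b, c, a', b'] j) ↔
      TStar.Adj i j := by
    have key : ∀ x y : V, G.Adj x y ↔ G.Adj y x := fun x y => G.adj_comm x y
    intro i j
    fin_cases i <;> fin_cases j <;>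
      simp [TStar, a1, a1.symm, a2, a2.symm, a3, a3.symm, ha, ha.symm, hb, hb.symm, n1, n2, n3, n4,
        n5, n6, h1, h2, h3, h4, key b a, key c a, key c b, key a' v, key b' v, key b' a',
        key b a', key c a', key a b', key c b']
  exact hT ⟨⟨⟨_, inj⟩, fun {i j} => adj i j⟩⟩

/-- The first two neighbors `a` and `b` of `v` have no neighbors besides `v` that are not adjacent
to another neighbor of `v`. -/
def NoPrivate (G : SimpleGraph V) (v a b c : V) : Prop :=
  (∀ w, G.Adj a w → w ≠ v → G.Adj w b ∨ G.Adj w c) ∧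
    ∀ w, G.Adj b w → w ≠ v → G.Adj w a ∨ G.Adj w c

/-- At most one neighbor of `v` has a private neighbor besides `v`; it is named last. -/
theorem exists_noPrivate {f : V → Bool} (hf : ∀ u v, G.Adj u v → f u ≠ f v)
    (hT : InducedFree TStar G) {v a b c : V} (hv : HasNeighbors G v a b c) :
    ∃ a b c, HasNeighbors G v a b c ∧ NoPrivate G v a b c := by
  have h1 := fun a' b' h1 h2 => @adj_of_tStarFree _ _ f hf hT v a b c a' b' hv h1 h2
  have h2 := fun a' b' h1 h2 => @adj_of_tStarFree _ _ f hf hT v a c b a' b' hv.swap₂₃ h1 h2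
  have h3 := fun a' b' h1 h2 => @adj_of_tStarFree _ _ f hf hT v b c a a' b' hv.rotate h1 h2
  by_cases ha : ∀ w, G.Adj a w → w ≠ v → G.Adj w b ∨ G.Adj w c
  · by_cases hb : ∀ w, G.Adj b w → w ≠ v → G.Adj w a ∨ G.Adj w c
    · exact ⟨a, b, c, hv, ha, hb⟩
    · push Not at hb
      obtain ⟨w, hw, hwv, hwa, hwc⟩ := hb
      exact ⟨a, c, b, hv.swap₂₃, fun x hx hxv => (ha x hx hxv).symm, fun x hx hxv => by
        have := h3 w x hw hwv hx hxv
        tauto⟩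
  · push Not at ha
    obtain ⟨w, hw, hwv, hwb, hwc⟩ := ha
    refine ⟨b, c, a, hv.rotate, fun x hx hxv => ?_, fun x hx hxv => ?_⟩
    · have := h1 w x hw hwv hx hxv
      tauto
    · have := h2 w x hw hwv hx hxv
      tauto

/-- The neighborhood of a vertex of a cube. -/
structure IsCubeCorner (G : SimpleGraph V) (v a b c s t u : V) : Prop where
  nbrs_v : HasNeighbors G v a b c
  nbrs_a : HasNeighbors G a v s t
  nbrs_b : HasNeighbors G b v t u
  nbrs_c : HasNeighbors G c v s u

theorem IsCubeCorner.swap {v a b c s t u : V} (h : IsCubeCorner G v a b c s t u) :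
    IsCubeCorner G v b a c u t s :=
  ⟨h.nbrs_v.swap₁₂, h.nbrs_b.swap₂₃, h.nbrs_a.swap₂₃, h.nbrs_c.swap₂₃⟩

variable [Fintype V]

/-- Two vertices with the same neighbors belong to a block together with their neighbors. -/
theorem inBlock_of_twins {f : V → Bool} (hf : ∀ u v, G.Adj u v → f u ≠ f v)
    (hT : InducedFree TStar G) (hG : G.Connected) (hcub : ∀ v, ∃ a b c, HasNeighbors G v a b c)
    (hn : 6 < Fintype.card V) {x y v s t : V} (hxy : x ≠ y) (hx : HasNeighbors G x v s t)
    (hy : HasNeighbors G y v s t) : InBlock G v := by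
  classical
  have third : ∀ z, G.Adj x z → G.Adj y z → ∃ z', HasNeighbors G z x y z' := by
    intro z hxz hyz
    obtain ⟨a, b, c, h⟩ := hcub z
    exact h.exists_third hxz.symm hyz.symm hxy
  obtain ⟨v', hv⟩ := third v hx.adj₁ hy.adj₁
  obtain ⟨s', hs⟩ := third s hx.adj₂ hy.adj₂
  obtain ⟨t', ht⟩ := third t hx.adj₃ hy.adj₃
  -- If two of the three common neighbors of the twins have the same third neighbor, this vertex
  -- completes a block.
  have mk : ∀ {v s t v' t' : V}, HasNeighbors G x v s t → HasNeighbors G y v s t →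
      HasNeighbors G v x y v' → HasNeighbors G s x y v' → HasNeighbors G t x y t' → v' ≠ t' →
      ∃ c', IsBlock G v s t x y v' t' c' := by
    intro v s t v' t' hx hy hv hs ht hne
    obtain ⟨a, b, c, h⟩ := hcub v'
    obtain ⟨c', hc'⟩ := h.exists_third hv.adj₃.symm hs.adj₃.symm hx.ne₁₂
    refine ⟨c', hv, hs, ht, hx, hy, hc', ?_⟩
    rintro rfl
    exact absurd (hf _ _ hx.adj₃) (by
      have h1 := hf _ _ hx.adj₁
      have h2 := hf _ _ hv.adj₃
      revert h1 h2
      cases f x <;> cases f v <;> cases f t <;> simp)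
  by_cases hvs : v' = s'
  · subst hvs
    -- If all third neighbors coincide, the graph is `K_{3,3}`, which has only six vertices.
    by_cases hvt : v' = t'
    · subst hvt
      obtain ⟨a, b, c, h⟩ := hcub v'
      obtain ⟨z, hz⟩ := h.exists_third hv.adj₃.symm hs.adj₃.symm hx.ne₁₂
      have hz' := hz.congr_third ht.adj₃.symm hx.ne₁₃.symm hx.ne₂₃.symm
      have h6 : ({v, s, t, x, y, v'} : Finset V).card ≤ 6 := Finset.card_le_six
      refine absurd (card_le_of_closed hG (S := {v, s, t, x, y, v'}) (v := v) (by simp) ?_) (by omega)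
      intro z hz w hzw
      simp only [Finset.mem_insert, Finset.mem_singleton] at hz ⊢
      rcases hz with rfl | rfl | rfl | rfl | rfl | rfl
      · have := (hv.adj_iff w).1 hzw; tauto
      · have := (hs.adj_iff w).1 hzw; tauto
      · have := (ht.adj_iff w).1 hzw; tauto
      · have := (hx.adj_iff w).1 hzw; tauto
      · have := (hy.adj_iff w).1 hzw; tauto
      · have := (hz'.adj_iff w).1 hzw; tauto
    · obtain ⟨c', h⟩ := mk hx hy hv hs ht hvt
      exact ⟨_, _, _, _, _, _, _, _, h, .inl rfl⟩
  · by_cases hvt : v' = t'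
    · subst hvt
      obtain ⟨c', h⟩ := mk hx.swap₂₃ hy.swap₂₃ hv ht hs hvs
      exact ⟨_, _, _, _, _, _, _, _, h, .inl rfl⟩
    · have hst : s' = t' := by
        -- Three distinct third neighbors would be private, against `T*`-freeness at `x`; so two of
        -- them coincide.
        have key : ∀ {v s t v' s' t' : V}, HasNeighbors G x v s t → HasNeighbors G v x y v' →
            HasNeighbors G s x y s' → HasNeighbors G t x y t' → v' ≠ t' → s' ≠ t' → v' = s' := by
          intro v s t v' s' t' hx hv hs ht hvt hst
          have hv'x := hv.ne₁₃.symm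
          have hv'y := hv.ne₂₃.symm
          have hs'x := hs.ne₁₃.symm
          have hs'y := hs.ne₂₃.symm
          rcases adj_of_tStarFree hf hT hx hv.adj₃ hv'x hs.adj₃ hs'x with (h | h) | (h | h)
          · exact hs.eq_third h.symm hv'x hv'y
          · exact absurd (ht.eq_third h.symm hv'x hv'y) hvt
          · exact (hv.eq_third h.symm hs'x hs'y).symm
          · exact absurd (ht.eq_third h.symm hs'x hs'y) hst
        exact key hx.rotate hs ht hv (fun h => hvs h.symm) fun h => hvt h.symm
      subst hst
      obtain ⟨c', h⟩ := mk hx.rotate hy.rotate hs ht hv (fun h => hvs h.symm)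
      exact ⟨_, _, _, _, _, _, _, _, h, .inr (.inr rfl)⟩

/-- Let `a` and `b` have no private neighbors, and let `s`, `t` be the further neighbors of `a`. If
both are adjacent to `b`, or both to `c`, there are twins and hence a block. Otherwise one is
adjacent to `c` only and the other to `b` only, and the third neighbor `u` of `b` must be adjacent
to `c`. -/
theorem inBlock_or_isCubeCorner {f : V → Bool} (hf : ∀ u v, G.Adj u v → f u ≠ f v)
    (hT : InducedFree TStar G) (hG : G.Connected) (hcub : ∀ v, ∃ a b c, HasNeighbors G v a b c)
    (hn : 6 < Fintype.card V) (v : V) :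
    InBlock G v ∨ ∃ a b c s t u, IsCubeCorner G v a b c s t u := by
  obtain ⟨a₀, b₀, c₀, hv₀⟩ := hcub v
  obtain ⟨a, b, c, hv, hpa, hpb⟩ := exists_noPrivate hf hT hv₀
  have others : ∀ z, G.Adj v z → ∃ s t, HasNeighbors G z v s t := by
    intro z hz
    obtain ⟨_, _, _, h⟩ := hcub z
    exact h.exists_others hz.symm
  have third : ∀ z s, G.Adj v z → G.Adj z s → s ≠ v → ∃ t, HasNeighbors G z v s t := by
    intro z s hz hs hsv
    obtain ⟨_, _, _, h⟩ := hcub z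
    exact h.exists_third hz.symm hs hsv.symm
  obtain ⟨s, t, ha⟩ := others a hv.adj₁
  have hsv := ha.ne₁₂.symm
  have htv := ha.ne₁₃.symm
  have main : ∀ {s t}, HasNeighbors G a v s t → ¬ G.Adj s b →
      InBlock G v ∨ ∃ a b c s t u, IsCubeCorner G v a b c s t u := by
    intro s t ha hsb
    have hsv := ha.ne₁₂.symm
    have htv := ha.ne₁₃.symm
    have hsc := (hpa s ha.adj₂ hsv).resolve_left hsb
    by_cases htc : G.Adj t c
    · left
      obtain ⟨t', hc⟩ := third c s hv.adj₃ hsc.symm hsv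
      exact inBlock_of_twins hf hT hG hcub hn hv.ne₁₃ ha
        (hc.congr_third htc.symm htv ha.ne₂₃.symm)
    · have htb := (hpa t ha.adj₃ htv).resolve_right htc
      obtain ⟨u, hb⟩ := third b t hv.adj₂ htb.symm htv
      have huv := hb.ne₁₃.symm
      have hus : u ≠ s := by
        rintro rfl
        exact hsb hb.adj₃.symm
      have hua : ¬ G.Adj u a := by
        intro h
        rcases (ha.adj_iff u).1 h.symm with h | h | h
        exacts [huv h, hus h, hb.ne₂₃ h.symm]
      have huc := (hpb u hb.adj₃ huv).resolve_left hua
      obtain ⟨u', hc⟩ := third c s hv.adj₃ hsc.symm hsv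
      exact .inr ⟨a, b, c, s, t, u, hv, ha, hb, hc.congr_third huc.symm huv hus⟩
  by_cases hsb : G.Adj s b
  · by_cases htb : G.Adj t b
    · left
      obtain ⟨t', hb⟩ := third b s hv.adj₂ hsb.symm hsv
      exact inBlock_of_twins hf hT hG hcub hn hv.ne₁₂ ha
        (hb.congr_third htb.symm htv ha.ne₂₃.symm)
    · exact main ha.swap₂₃ htb
  · exact main ha hsb

/-- Every vertex of a sufficiently large connected cubic bipartite `T*`-free graph belongs to a
block. -/
theorem inBlock_of_tStarFree {f : V → Bool} (hf : ∀ u v, G.Adj u v → f u ≠ f v)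
    (hT : InducedFree TStar G) (hG : G.Connected) (hcub : ∀ v, ∃ a b c, HasNeighbors G v a b c)
    (hn : 8 < Fintype.card V) (v : V) : InBlock G v := by
  classical
  by_contra hvB
  have corner := fun v => inBlock_or_isCubeCorner hf hT hG hcub (by omega) v
  obtain ⟨a, b, c, s, t, u, hv⟩ := (corner v).resolve_left hvB
  have hsb : ∀ {a b c s t u}, IsCubeCorner G v a b c s t u → s ≠ u → ¬ G.Adj s b ∧ ¬ G.Adj t c := by
    intro a b c s t u h hsu
    constructor
    · intro hs
      rcases (h.nbrs_b.adj_iff s).1 hs.symm with h' | h' | h'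
      exacts [h.nbrs_a.ne₁₂ h'.symm, h.nbrs_a.ne₂₃ h', hsu h']
    · intro ht
      rcases (h.nbrs_c.adj_iff t).1 ht.symm with h' | h' | h'
      exacts [h.nbrs_a.ne₁₃ h'.symm, h.nbrs_a.ne₂₃ h'.symm, h.nbrs_b.ne₂₃ h']
  have hsu : s ≠ u := hv.nbrs_c.ne₂₃
  -- The neighbors of `v` do not belong to blocks.
  have hnbr : ∀ {a b c s t u}, IsCubeCorner G v a b c s t u → ¬ InBlock G a := by
    intro a b c s t u h hB
    have hsu : s ≠ u := h.nbrs_c.ne₂₃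
    obtain ⟨p, q, r, a₂, b₂, c₂, r', c', hblock, ha⟩ := hB
    have hin : v = a₂ ∨ v = b₂ ∨ v = c₂ → False := fun h =>
      hvB ⟨_, _, _, _, _, _, _, _, hblock.dual, h⟩
    rcases ha with rfl | rfl | rfl
    · exact hin ((hblock.nbrs_p.adj_iff v).1 h.nbrs_a.adj₁)
    · exact hin ((hblock.nbrs_q.adj_iff v).1 h.nbrs_a.adj₁)
    -- Here `a` is the attachment vertex of its block and `v` lies outside. Then `s` and `t` are the
    -- twins `a₂` and `b₂`, so `t` is adjacent to `c` like `s`, which is impossible at a cube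
    -- corner.
    · have hmem : ∀ z, G.Adj a z → z ≠ v → z = a₂ ∨ z = b₂ := by
        intro z hz hzv
        rcases (hblock.nbrs_r.adj_iff z).1 hz with h1 | h1 | h1
        · exact .inl h1
        · exact .inr h1
        · rcases (hblock.nbrs_r.adj_iff v).1 h.nbrs_a.adj₁ with h2 | h2 | h2
          exacts [(hin (.inl h2)).elim, (hin (.inr (.inl h2))).elim, absurd (h1.trans h2.symm) hzv]
      have htwin : ∀ z, z = a₂ ∨ z = b₂ → ∀ w, G.Adj z w ↔ w = p ∨ w = q ∨ w = a := by
        rintro z (rfl | rfl)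
        exacts [hblock.nbrs_a.adj_iff, hblock.nbrs_b.adj_iff]
      have hs := htwin s (hmem s h.nbrs_a.adj₂ h.nbrs_a.ne₁₂.symm)
      have ht := htwin t (hmem t h.nbrs_a.adj₃ h.nbrs_a.ne₁₃.symm)
      exact (hsb h hsu).2 ((ht c).2 ((hs c).1 h.nbrs_c.adj₂.symm))
  have common : ∀ {a b c s t u}, IsCubeCorner G v a b c s t u →
      ∃ w, HasNeighbors G s a c w ∧ HasNeighbors G t a b w := by
    intro a b c s t u h
    have hsu : s ≠ u := h.nbrs_c.ne₂₃
    obtain ⟨x, y, z, s', t', u', ha⟩ := (corner a).resolve_left (hnbr h)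
    -- As `a` is itself a cube corner, any two of its neighbors have a second common neighbor.
    have hcom : ∃ w, w ≠ a ∧ G.Adj s w ∧ G.Adj t w := by
      have hpair : ∀ {x y z s' t' u'}, IsCubeCorner G a x y z s' t' u' →
          (s = x ∧ t = y ∨ s = y ∧ t = x) → ∃ w, w ≠ a ∧ G.Adj s w ∧ G.Adj t w := by
        rintro x y z s' t' u' h (⟨rfl, rfl⟩ | ⟨rfl, rfl⟩)
        · exact ⟨t', h.nbrs_a.ne₁₃.symm, h.nbrs_a.adj₃, h.nbrs_b.adj₂⟩
        · exact ⟨t', h.nbrs_a.ne₁₃.symm, h.nbrs_b.adj₂, h.nbrs_a.adj₃⟩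
      have r1 : IsCubeCorner G a x z y t' s' u' :=
        ⟨ha.nbrs_v.swap₂₃, ha.nbrs_a.swap₂₃, ha.nbrs_c, ha.nbrs_b⟩
      have r2 : IsCubeCorner G a y z x t' u' s' :=
        ⟨ha.nbrs_v.rotate, ha.nbrs_b, ha.nbrs_c.swap₂₃, ha.nbrs_a.swap₂₃⟩
      have hne := h.nbrs_a.ne₂₃
      rcases (ha.nbrs_v.adj_iff s).1 h.nbrs_a.adj₂ with h1 | h1 | h1 <;>
        rcases (ha.nbrs_v.adj_iff t).1 h.nbrs_a.adj₃ with h2 | h2 | h2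
      · exact absurd (h1.trans h2.symm) hne
      · exact hpair ha (.inl ⟨h1, h2⟩)
      · exact hpair r1 (.inl ⟨h1, h2⟩)
      · exact hpair ha (.inr ⟨h1, h2⟩)
      · exact absurd (h1.trans h2.symm) hne
      · exact hpair r2 (.inl ⟨h1, h2⟩)
      · exact hpair r1 (.inr ⟨h1, h2⟩)
      · exact hpair r2 (.inr ⟨h1, h2⟩)
      · exact absurd (h1.trans h2.symm) hne
    obtain ⟨w, hwa, hsw, htw⟩ := hcom
    obtain ⟨h1, h2⟩ := hsb h hsu
    have hwb : w ≠ b := by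
      rintro rfl
      exact h1 hsw
    have hwc : w ≠ c := by
      rintro rfl
      exact h2 htw
    obtain ⟨_, _, _, hs⟩ := hcub s
    obtain ⟨_, _, _, ht⟩ := hcub t
    obtain ⟨_, hs⟩ := hs.exists_third h.nbrs_a.adj₂.symm h.nbrs_c.adj₂.symm h.nbrs_v.ne₁₃
    obtain ⟨_, ht⟩ := ht.exists_third h.nbrs_a.adj₃.symm h.nbrs_b.adj₂.symm h.nbrs_v.ne₁₂
    exact ⟨w, hs.congr_third hsw hwa hwc, ht.congr_third htw hwa hwb⟩
  -- The third neighbors of `s`, `t` and `u` coincide, so the graph is the cube, which has only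
  -- eight vertices.
  obtain ⟨w, hs, ht⟩ := common hv
  obtain ⟨w', hu, ht'⟩ := common hv.swap
  obtain rfl : w = w' := ht'.eq_third ht.adj₃ ht.ne₂₃.symm ht.ne₁₃.symm
  obtain ⟨_, _, _, hw⟩ := hcub w
  obtain ⟨_, hw⟩ := hw.exists_third hs.adj₃.symm ht.adj₃.symm hv.nbrs_a.ne₂₃
  have hw' := hw.congr_third hu.adj₃.symm hsu.symm hv.nbrs_b.ne₂₃.symm
  obtain ⟨S, hS, hmem⟩ : ∃ S : Finset V, S.card ≤ 8 ∧ ∀ z, z ∈ S ↔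
      z = v ∨ z = a ∨ z = b ∨ z = c ∨ z = s ∨ z = t ∨ z = u ∨ z = w :=
    ⟨(([v, a, b, c, s, t, u, w] : List V)).toFinset, List.toFinset_card_le _, fun z => by simp⟩
  refine absurd (card_le_of_closed hG ((hmem v).2 (.inl rfl)) ?_) (by omega)
  intro z hz y hzy
  rw [hmem] at hz ⊢
  rcases hz with rfl | rfl | rfl | rfl | rfl | rfl | rfl | rfl
  · have := (hv.nbrs_v.adj_iff y).1 hzy; tauto
  · have := (hv.nbrs_a.adj_iff y).1 hzy; tauto
  · have := (hv.nbrs_b.adj_iff y).1 hzy; tauto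
  · have := (hv.nbrs_c.adj_iff y).1 hzy; tauto
  · have := (hs.adj_iff y).1 hzy; tauto
  · have := (ht.adj_iff y).1 hzy; tauto
  · have := (hu.adj_iff y).1 hzy; tauto
  · have := (hw'.adj_iff y).1 hzy; tauto

end TStarFree

/-! ### Extensions in cubic bipartite `T*`-free graphs -/

section BlockExtend

variable {V : Type*} {G : SimpleGraph V}

theorem IsBlock.ne_pr' {p q r a b c r' c' : V} (h : IsBlock G p q r a b c r' c') : r' ≠ p := by
  rintro rfl
  rcases (h.nbrs_p.adj_iff r).1 h.nbrs_r.adj₃.symm with h1 | h1 | h1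
  exacts [h.nbrs_a.adj₃.ne h1.symm, h.nbrs_b.adj₃.ne h1.symm, h.ne_rc h1]

variable {C : Finset V} [Fintype V]

/-- This removes neighbors of covered vertices from the list of possible losses, which keeps its
length at most `6` in the case analysis. -/
theorem ne_of_mem_fullOutside {v a q : V} (hv : v ∈ fullOutside G C) (haq : G.Adj a q)
    (hq : q ∈ C) : v ≠ a := by
  rintro rfl
  exact (mem_fullOutside.1 hv).2 q haq hq

theorem ne_of_mem {v q : V} (hv : v ∈ fullOutside G C) (hq : q ∈ C) : v ≠ q := by
  rintro rfl
  exact (mem_fullOutside.1 hv).1 hq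

theorem HasNeighbors.mem_fullOutside {v a b c : V} (h : HasNeighbors G v a b c) (hv : v ∉ C)
    (ha : a ∉ C) (hb : b ∉ C) (hc : c ∉ C) : v ∈ fullOutside G C := by
  refine _root_.mem_fullOutside.2 ⟨hv, fun w hw => ?_⟩
  rcases (h.adj_iff w).1 hw with rfl | rfl | rfl <;> assumption

theorem HasNeighbors.exists_mem {v a b c : V} (h : HasNeighbors G v a b c) (hv : v ∉ C)
    (hvf : v ∉ fullOutside G C) : a ∈ C ∨ b ∈ C ∨ c ∈ C := by
  by_contra! hn
  exact hvf (h.mem_fullOutside hv hn.1 hn.2.1 hn.2.2)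

variable [DecidableEq V]

/-- One edge isolates the vertex `u`. -/
theorem hasExtension_of_edge {a b u : V} (hab : G.Adj a b) (ha : a ∉ C) (hb : b ∉ C) (hu : u ∉ C)
    (hua : G.Adj u a) (hub : u ≠ b) (hn : ∀ w, G.Adj u w → w ∈ C ∨ w = a ∨ w = b) (L : List V)
    (hLc : L.length ≤ 6)
    (hL : ∀ v ∈ fullOutside G C, G.Adj a v ∨ G.Adj b v → v ∈ L) : HasExtension 3 6 G C := by
  have hN : IsExtension G C {(a, b)} := by
    simpa using (isExtension_empty (G := G) (C := C)).insert_pair hab ha hb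
      (by simp [mem_pairVerts]) (by simp [mem_pairVerts])
  refine hN.hasExtension (by simp) hu (by simp [mem_pairVerts, hua.ne, hub]) (fun w hw hwC => ?_)
    hua ha (L := L.toFinset) ((List.toFinset_card_le _).trans hLc) ?_
  · simpa [mem_pairVerts] using (hn w hw).resolve_left hwC
  · simpa using hL

/-- Two edges isolate the vertex `u`. -/
theorem hasExtension_of_edges {a b a' b' u : V} (hab : G.Adj a b) (hab' : G.Adj a' b')
    (ha : a ∉ C) (hb : b ∉ C) (ha' : a' ∉ C) (hb' : b' ∉ C) (h1 : a ≠ a') (h2 : a ≠ b')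
    (h3 : b ≠ a') (h4 : b ≠ b') (hu : u ∉ C) (hua : G.Adj u a) (hub : u ≠ b) (hua' : u ≠ a')
    (hub' : u ≠ b') (hn : ∀ w, G.Adj u w → w ∈ C ∨ w = a ∨ w = b ∨ w = a' ∨ w = b') (L : List V)
    (hLc : L.length ≤ 6)
    (hL : ∀ v ∈ fullOutside G C, (G.Adj a v ∨ G.Adj b v) ∨ G.Adj a' v ∨ G.Adj b' v → v ∈ L) :
    HasExtension 3 6 G C := by
  have hN : IsExtension G C {(a, b), (a', b')} := by
    have h0 : IsExtension G C {(a', b')} := by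
      simpa using (isExtension_empty (G := G) (C := C)).insert_pair hab' ha' hb'
        (by simp [mem_pairVerts]) (by simp [mem_pairVerts])
    exact h0.insert_pair hab ha hb (by simp [mem_pairVerts, h1, h2])
      (by simp [mem_pairVerts, h3, h4])
  refine hN.hasExtension (Finset.card_le_two.trans (by omega)) hu
    (by simp [mem_pairVerts, hua.ne, hub, hua', hub']) (fun w hw hwC => ?_)
    hua ha (L := L.toFinset) ((List.toFinset_card_le _).trans hLc) ?_
  · have := (hn w hw).resolve_left hwC
    simp [mem_pairVerts]
    tauto
  · intro v hv e he h
    rw [List.mem_toFinset]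
    refine hL v hv ?_
    rcases Finset.mem_insert.1 he with rfl | he
    · exact .inl h
    · rw [Finset.mem_singleton] at he
      subst he
      exact .inr h

namespace IsBlock

variable {p q r a b c r' c' : V}

/-- The vertex `a` is isolated by `pc` if `r ∈ C`, and by `pc` and `rb` otherwise. As `q ∈ C`, none
of `a`, `b`, `c` is full. -/
theorem hasExtension_of_mem_q (h : IsBlock G p q r a b c r' c') (hp : p ∈ fullOutside G C)
    (hq : q ∈ C) : HasExtension 3 6 G C := by
  obtain ⟨hpC, hpn⟩ := mem_fullOutside.1 hp
  have ha := hpn a h.nbrs_p.adj₁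
  have hb := hpn b h.nbrs_p.adj₂
  have hc := hpn c h.nbrs_p.adj₃
  have na := fun v (hv : v ∈ fullOutside G C) => ne_of_mem_fullOutside hv h.nbrs_a.adj₂ hq
  have nb := fun v (hv : v ∈ fullOutside G C) => ne_of_mem_fullOutside hv h.nbrs_b.adj₂ hq
  have nc := fun v (hv : v ∈ fullOutside G C) => ne_of_mem_fullOutside hv h.nbrs_c.adj₂ hq
  have nq := fun v (hv : v ∈ fullOutside G C) => ne_of_mem hv hq
  by_cases hr : r ∈ C
  · have nr := fun v (hv : v ∈ fullOutside G C) => ne_of_mem hv hr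
    refine hasExtension_of_edge h.nbrs_p.adj₃ hpC hc ha h.nbrs_a.adj₁ h.nbrs_p.ne₁₃ (fun w hw => ?_)
      [p, c'] (by simp) fun v hv hv' => ?_
    · rcases (h.nbrs_a.adj_iff w).1 hw with rfl | rfl | rfl <;> simp [*]
    · have := na v hv; have := nb v hv; have := nc v hv; have := nq v hv
      rw [h.nbrs_p.adj_iff, h.nbrs_c.adj_iff] at hv'
      simp only [List.mem_cons]
      tauto
  · refine hasExtension_of_edges h.nbrs_p.adj₃ h.nbrs_r.adj₂ hpC hc hr hb h.nbrs_a.ne₁₃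
      h.nbrs_p.adj₂.ne h.ne_rc.symm h.nbrs_p.ne₂₃.symm ha h.nbrs_a.adj₁ h.nbrs_p.ne₁₃
      h.nbrs_a.adj₃.ne h.nbrs_p.ne₁₂ (fun w hw => ?_) [p, r, c', r'] (by simp) fun v hv hv' => ?_
    · rcases (h.nbrs_a.adj_iff w).1 hw with rfl | rfl | rfl <;> simp [*]
    · have := na v hv; have := nb v hv; have := nc v hv; have := nq v hv
      rw [h.nbrs_p.adj_iff, h.nbrs_c.adj_iff, h.nbrs_r.adj_iff, h.nbrs_b.adj_iff] at hv'
      simp only [List.mem_cons]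
      tauto

/-- The edges `pb` and `qc` isolate `a`. -/
theorem hasExtension_of_mem_r (h : IsBlock G p q r a b c r' c') (hp : p ∈ fullOutside G C)
    (hq : q ∉ C) (hr : r ∈ C) : HasExtension 3 6 G C := by
  obtain ⟨hpC, hpn⟩ := mem_fullOutside.1 hp
  have ha := hpn a h.nbrs_p.adj₁
  have hb := hpn b h.nbrs_p.adj₂
  have hc := hpn c h.nbrs_p.adj₃
  refine hasExtension_of_edges h.nbrs_p.adj₂ h.nbrs_q.adj₃ hpC hb hq hc h.nbrs_a.ne₁₂
    h.nbrs_p.adj₃.ne h.nbrs_b.adj₂.ne h.nbrs_p.ne₂₃ ha h.nbrs_a.adj₁ h.nbrs_p.ne₁₂ h.nbrs_a.adj₂.ne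
    h.nbrs_p.ne₁₃ (fun w hw => ?_) [p, q, c', c] (by simp) fun v hv hv' => ?_
  · rcases (h.nbrs_a.adj_iff w).1 hw with rfl | rfl | rfl <;> simp [*]
  · have := ne_of_mem_fullOutside hv h.nbrs_a.adj₃ hr
    have := ne_of_mem_fullOutside hv h.nbrs_b.adj₃ hr
    have := ne_of_mem hv hr
    rw [h.nbrs_p.adj_iff, h.nbrs_b.adj_iff, h.nbrs_q.adj_iff, h.nbrs_c.adj_iff] at hv'
    simp only [List.mem_cons]
    tauto

/-- The edges `pa` and `qb` isolate `c`. -/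
theorem hasExtension_of_mem_c' (h : IsBlock G p q r a b c r' c') (hp : p ∈ fullOutside G C)
    (hq : q ∉ C) (hc' : c' ∈ C) : HasExtension 3 6 G C := by
  obtain ⟨hpC, hpn⟩ := mem_fullOutside.1 hp
  have ha := hpn a h.nbrs_p.adj₁
  have hb := hpn b h.nbrs_p.adj₂
  have hc := hpn c h.nbrs_p.adj₃
  refine hasExtension_of_edges h.nbrs_p.adj₁ h.nbrs_q.adj₂ hpC ha hq hb h.nbrs_a.ne₁₂
    h.nbrs_p.adj₂.ne h.nbrs_a.adj₂.ne h.nbrs_p.ne₁₂ hc h.nbrs_c.adj₁ h.nbrs_p.ne₁₃.symm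
    h.nbrs_c.adj₂.ne h.nbrs_p.ne₂₃.symm (fun w hw => ?_) [p, q, r, a, b] (by simp)
    fun v hv hv' => ?_
  · rcases (h.nbrs_c.adj_iff w).1 hw with rfl | rfl | rfl <;> simp [*]
  · have := ne_of_mem_fullOutside hv h.nbrs_c.adj₃ hc'
    rw [h.nbrs_p.adj_iff, h.nbrs_a.adj_iff, h.nbrs_q.adj_iff, h.nbrs_b.adj_iff] at hv'
    simp only [List.mem_cons]
    tauto

/-- If `q` and `r` are not in `C`, then `a` and `b` are full; so `x = c`, and `c' ∈ C` is the reason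
why `x` is not full. -/
theorem hasExtension_of_p_full (h : IsBlock G p q r a b c r' c') (hp : p ∈ fullOutside G C) {x : V}
    (hx : x ∉ C) (hxf : x ∉ fullOutside G C) (hxp : G.Adj x p) : HasExtension 3 6 G C := by
  by_cases hq : q ∈ C
  · exact h.hasExtension_of_mem_q hp hq
  by_cases hr : r ∈ C
  · exact h.hasExtension_of_mem_r hp hq hr
  have hpC := (mem_fullOutside.1 hp).1
  rcases (h.nbrs_p.adj_iff x).1 hxp.symm with rfl | rfl | rfl
  · exact absurd (h.nbrs_a.mem_fullOutside hx hpC hq hr) hxf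
  · exact absurd (h.nbrs_b.mem_fullOutside hx hpC hq hr) hxf
  · have := h.nbrs_c.exists_mem hx hxf
    exact h.hasExtension_of_mem_c' hp hq (by tauto)

/-- The target is always `a`: it is isolated by `rb` if `p ∈ C`, by `pb` and `rr'` if only `c ∈ C`,
and by `pc` and `rb` otherwise. -/
theorem hasExtension_of_r_full_of_mem_q (h : IsBlock G p q r a b c r' c')
    (hcub : ∀ v, ∃ a b c, HasNeighbors G v a b c) (hr : r ∈ fullOutside G C) (hq : q ∈ C) :
    HasExtension 3 6 G C := by
  obtain ⟨hrC, hrn⟩ := mem_fullOutside.1 hr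
  have ha := hrn a h.nbrs_r.adj₁
  have hb := hrn b h.nbrs_r.adj₂
  have hr' := hrn r' h.nbrs_r.adj₃
  have na := fun v (hv : v ∈ fullOutside G C) => ne_of_mem_fullOutside hv h.nbrs_a.adj₂ hq
  have nb := fun v (hv : v ∈ fullOutside G C) => ne_of_mem_fullOutside hv h.nbrs_b.adj₂ hq
  have nc := fun v (hv : v ∈ fullOutside G C) => ne_of_mem_fullOutside hv h.nbrs_c.adj₂ hq
  have nq := fun v (hv : v ∈ fullOutside G C) => ne_of_mem hv hq
  by_cases hp : p ∈ C
  · have np := fun v (hv : v ∈ fullOutside G C) => ne_of_mem hv hp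
    refine hasExtension_of_edge h.nbrs_r.adj₂ hrC hb ha h.nbrs_a.adj₃ h.nbrs_p.ne₁₂ (fun w hw => ?_)
      [r, r'] (by simp) fun v hv hv' => ?_
    · rcases (h.nbrs_a.adj_iff w).1 hw with rfl | rfl | rfl <;> simp [*]
    · have := na v hv; have := nb v hv; have := nq v hv; have := np v hv
      rw [h.nbrs_r.adj_iff, h.nbrs_b.adj_iff] at hv'
      simp only [List.mem_cons]
      tauto
  by_cases hc : c ∈ C
  · obtain ⟨_, _, _, h0⟩ := hcub r'
    obtain ⟨y, z, h0⟩ := h0.exists_others h.nbrs_r.adj₃.symm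
    refine hasExtension_of_edges h.nbrs_p.adj₂ h.nbrs_r.adj₃ hp hb hrC hr' h.nbrs_a.ne₁₃
      h.ne_pr'.symm h.nbrs_b.adj₃.ne h.nbrs_r.ne₂₃ ha h.nbrs_a.adj₁ h.nbrs_p.ne₁₂
      h.nbrs_a.adj₃.ne h.nbrs_r.ne₁₃ (fun w hw => ?_) [r, r', y, z] (by simp) fun v hv hv' => ?_
    · rcases (h.nbrs_a.adj_iff w).1 hw with rfl | rfl | rfl <;> simp [*]
    · have := na v hv; have := nb v hv; have := nq v hv; have := ne_of_mem hv hc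
      have := ne_of_mem_fullOutside hv h.nbrs_p.adj₃ hc
      rw [h.nbrs_p.adj_iff, h.nbrs_b.adj_iff, h.nbrs_r.adj_iff, h0.adj_iff] at hv'
      simp only [List.mem_cons]
      tauto
  · refine hasExtension_of_edges h.nbrs_p.adj₃ h.nbrs_r.adj₂ hp hc hrC hb h.nbrs_a.ne₁₃
      h.nbrs_p.adj₂.ne h.ne_rc.symm h.nbrs_p.ne₂₃.symm ha h.nbrs_a.adj₁ h.nbrs_p.ne₁₃
      h.nbrs_a.adj₃.ne h.nbrs_p.ne₁₂ (fun w hw => ?_) [p, r, c', r'] (by simp) fun v hv hv' => ?_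
    · rcases (h.nbrs_a.adj_iff w).1 hw with rfl | rfl | rfl <;> simp [*]
    · have := na v hv; have := nb v hv; have := nc v hv; have := nq v hv
      rw [h.nbrs_p.adj_iff, h.nbrs_c.adj_iff, h.nbrs_r.adj_iff, h.nbrs_b.adj_iff] at hv'
      simp only [List.mem_cons]
      tauto

/-- The edges `aq` and `br` isolate `p`. -/
theorem hasExtension_of_r_full_of_mem_c (h : IsBlock G p q r a b c r' c')
    (hr : r ∈ fullOutside G C) (hp : p ∉ C) (hq : q ∉ C) (hc : c ∈ C) : HasExtension 3 6 G C := by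
  obtain ⟨hrC, hrn⟩ := mem_fullOutside.1 hr
  refine hasExtension_of_edges h.nbrs_a.adj₂ h.nbrs_b.adj₃ (hrn a h.nbrs_r.adj₁) hq
    (hrn b h.nbrs_r.adj₂) hrC h.nbrs_p.ne₁₂ h.nbrs_a.adj₃.ne h.nbrs_q.adj₂.ne h.nbrs_a.ne₂₃ hp
    h.nbrs_p.adj₁ h.nbrs_a.ne₁₂ h.nbrs_p.adj₂.ne h.nbrs_a.ne₁₃ (fun w hw => ?_) [a, b, r, r']
    (by simp) fun v hv hv' => ?_
  · rcases (h.nbrs_p.adj_iff w).1 hw with rfl | rfl | rfl <;> simp [*]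
  · have := ne_of_mem hv hc
    have := ne_of_mem_fullOutside hv h.nbrs_p.adj₃ hc
    have := ne_of_mem_fullOutside hv h.nbrs_q.adj₃ hc
    rw [h.nbrs_a.adj_iff, h.nbrs_q.adj_iff, h.nbrs_b.adj_iff, h.nbrs_r.adj_iff] at hv'
    simp only [List.mem_cons]
    tauto

variable {p₂ q₂ a₂ b₂ c₂ c₂' : V}

/-- Two blocks are joined by the edge `r r'`. -/
theorem hasExtension_of_joined (h : IsBlock G p q r a b c r' c')
    (h₂ : IsBlock G p₂ q₂ r' a₂ b₂ c₂ r c₂') (hr : r ∈ fullOutside G C) (hp : p ∉ C) (hq : q ∉ C)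
    (hb₂ : b₂ ∈ C) : HasExtension 3 6 G C := by
  obtain ⟨hrC, hrn⟩ := mem_fullOutside.1 hr
  have ha := hrn a h.nbrs_r.adj₁
  have hr' := hrn r' h.nbrs_r.adj₃
  have haf := h.nbrs_a.mem_fullOutside ha hp hq hrC
  have nr' := fun v (hv : v ∈ fullOutside G C) => ne_of_mem_fullOutside hv h₂.nbrs_r.adj₂ hb₂
  have nb₂ := fun v (hv : v ∈ fullOutside G C) => ne_of_mem hv hb₂
  -- If `a₂ ∈ C`, the edge `ra` isolates `r'`. Otherwise, if exactly one of `p₂`, `q₂` is in `C`, an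
  -- edge from `a₂` to the other one is used in addition; if both are, `r'r` isolates `a₂`; if
  -- neither is, `a₂` is full, and the dual block with `b₂ ∈ C` has been treated before.
  by_cases ha₂ : a₂ ∈ C
  · refine hasExtension_of_edge h.nbrs_r.adj₁ hrC ha hr' h₂.nbrs_r.adj₃ h.nbrs_r.ne₁₃.symm
      (fun w hw => ?_) [a, b, p, q, r] (by simp) fun v hv hv' => ?_
    · rcases (h₂.nbrs_r.adj_iff w).1 hw with rfl | rfl | rfl <;> simp [*]
    · have := nr' v hv
      rw [h.nbrs_r.adj_iff, h.nbrs_a.adj_iff] at hv'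
      simp only [List.mem_cons]
      tauto
  have key : ∀ {p₂ q₂}, IsBlock G p₂ q₂ r' a₂ b₂ c₂ r c₂' → p₂ ∉ C → q₂ ∈ C →
      HasExtension 3 6 G C := by
    intro p₂ q₂ h₂ hp₂ hq₂
    refine hasExtension_of_edges h.nbrs_r.adj₁ h₂.nbrs_a.adj₁ hrC ha ha₂ hp₂
      (ne_of_mem_fullOutside hr h₂.nbrs_a.adj₂ hq₂) (ne_of_mem_fullOutside hr h₂.nbrs_p.adj₂ hb₂)
      (ne_of_mem_fullOutside haf h₂.nbrs_a.adj₂ hq₂) (ne_of_mem_fullOutside haf h₂.nbrs_p.adj₂ hb₂)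
      hr' h₂.nbrs_r.adj₃ h.nbrs_r.ne₁₃.symm h₂.nbrs_r.adj₁.ne h₂.nbrs_a.ne₁₃.symm
      (fun w hw => ?_) [a, b, p, q, r] (by simp) fun v hv hv' => ?_
    · rcases (h₂.nbrs_r.adj_iff w).1 hw with rfl | rfl | rfl <;> simp [*]
    · have := nr' v hv; have := nb₂ v hv; have := ne_of_mem hv hq₂
      have := ne_of_mem_fullOutside hv h₂.nbrs_a.adj₂ hq₂
      have := ne_of_mem_fullOutside hv h₂.nbrs_p.adj₂ hb₂
      have := ne_of_mem_fullOutside hv h₂.nbrs_c.adj₂ hq₂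
      rw [h.nbrs_r.adj_iff, h.nbrs_a.adj_iff, h₂.nbrs_a.adj_iff, h₂.nbrs_p.adj_iff] at hv'
      simp only [List.mem_cons]
      tauto
  by_cases hp₂ : p₂ ∈ C <;> by_cases hq₂ : q₂ ∈ C
  · refine hasExtension_of_edge h.nbrs_r.adj₃.symm hr' hrC ha₂ h₂.nbrs_a.adj₃
      (ne_of_mem_fullOutside hr h₂.nbrs_a.adj₂ hq₂).symm
      (fun w hw => ?_) [a, b, r] (by simp) fun v hv hv' => ?_
    · rcases (h₂.nbrs_a.adj_iff w).1 hw with rfl | rfl | rfl <;> simp [*]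
    · have := nr' v hv; have := nb₂ v hv
      have := ne_of_mem_fullOutside hv h₂.nbrs_a.adj₂ hq₂
      rw [h.nbrs_r.adj_iff, h₂.nbrs_r.adj_iff] at hv'
      simp only [List.mem_cons]
      tauto
  · exact key h₂.swap_pq hq₂ hp₂
  · exact key h₂ hp₂ hq₂
  · exact h₂.dual.hasExtension_of_mem_q (h₂.nbrs_a.mem_fullOutside ha₂ hp₂ hq₂ hr') hb₂

/-- Once `p`, `q`, `c` are known to avoid `C`, the only candidate for `x` is `r'`. The block of `x`
turns out to be attached to the given one by the edge `rx`, so the case of two joined blocks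
applies. -/
theorem hasExtension_of_r_full (h : IsBlock G p q r a b c r' c')
    (hcub : ∀ v, ∃ a b c, HasNeighbors G v a b c) (hB : ∀ v, InBlock G v)
    (hr : r ∈ fullOutside G C) {x : V} (hx : x ∉ C) (hxf : x ∉ fullOutside G C)
    (hxr : G.Adj x r) : HasExtension 3 6 G C := by
  by_cases hq : q ∈ C
  · exact h.hasExtension_of_r_full_of_mem_q hcub hr hq
  by_cases hp : p ∈ C
  · exact h.swap_pq.hasExtension_of_r_full_of_mem_q hcub hr hp
  by_cases hc : c ∈ C
  · exact h.hasExtension_of_r_full_of_mem_c hr hp hq hc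
  have hrC := (mem_fullOutside.1 hr).1
  rcases (h.nbrs_r.adj_iff x).1 hxr.symm with rfl | rfl | rfl
  · exact absurd (h.nbrs_a.mem_fullOutside hx hp hq hrC) hxf
  · exact absurd (h.nbrs_b.mem_fullOutside hx hp hq hrC) hxf
  have hxpq : ∀ z, G.Adj x z → z = p ∨ z = q → False := by
    have key : ∀ w, w = a ∨ w = b ∨ w = c → w = x → False := by
      rintro w (rfl | rfl | rfl) rfl
      · exact h.nbrs_r.ne₁₃ rfl
      · exact h.nbrs_r.ne₂₃ rfl
      · obtain rfl := h.nbrs_c.eq_third hxr h.nbrs_a.ne₁₃.symm h.nbrs_a.ne₂₃.symm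
        exact hxf (h.nbrs_c.mem_fullOutside hc hp hq hrC)
    rintro z hz (rfl | rfl)
    · exact key x ((h.nbrs_p.adj_iff x).1 hz.symm) rfl
    · exact key x ((h.nbrs_q.adj_iff x).1 hz.symm) rfl
  have hab : ∀ z, z ≠ x → G.Adj r z → ∀ w, G.Adj z w → w = p ∨ w = q ∨ w = r := by
    intro z hzx hz w hw
    rcases (h.nbrs_r.adj_iff z).1 hz with rfl | rfl | rfl
    exacts [(h.nbrs_a.adj_iff w).1 hw, (h.nbrs_b.adj_iff w).1 hw, absurd rfl hzx]
  have htwin : ∀ z, z ≠ x → G.Adj r z → (∀ w, G.Adj z w → G.Adj x w) → False := by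
    intro z hzx hz hzw
    refine hxpq p (hzw p ?_) (.inl rfl)
    rcases (h.nbrs_r.adj_iff z).1 hz with rfl | rfl | rfl
    exacts [h.nbrs_a.adj₁, h.nbrs_b.adj₁, absurd rfl hzx]
  have hend : ∀ {p₂ q₂ b₂ c₂ r₂' c₂'}, IsBlock G p₂ q₂ x r b₂ c₂ r₂' c₂' → False := by
    intro p₂ q₂ b₂ c₂ r₂' c₂' h₂
    rcases hab p₂ h₂.nbrs_a.ne₁₃ h₂.nbrs_a.adj₁ b₂ h₂.nbrs_p.adj₂ with hb | hb | hb
    exacts [hxpq b₂ h₂.nbrs_r.adj₂ (.inl hb), hxpq b₂ h₂.nbrs_r.adj₂ (.inr hb), h₂.nbrs_p.ne₁₂ hb.symm]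
  -- If `x` had a twin in its block, the twin would be `a` or `b`, and then `x` would be adjacent to
  -- `p`. So `x` is the attachment vertex, and by `hend` its edge to `r` leaves the block.
  obtain ⟨p₂, q₂, r₂, a₂, b₂, c₂, r₂', c₂', h₂, rfl | rfl | rfl⟩ := hB x
  · have hadj : ∀ w, G.Adj q₂ w ↔ G.Adj x w := fun w => by
      rw [h₂.nbrs_p.adj_iff, h₂.nbrs_q.adj_iff]
    exact (htwin q₂ h₂.nbrs_a.ne₁₂.symm ((hadj r).2 hxr).symm fun w => (hadj w).1).elim
  · have hadj : ∀ w, G.Adj p₂ w ↔ G.Adj x w := fun w => by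
      rw [h₂.nbrs_p.adj_iff, h₂.nbrs_q.adj_iff]
    exact (htwin p₂ h₂.nbrs_a.ne₁₂ ((hadj r).2 hxr).symm fun w => (hadj w).1).elim
  · rcases (h₂.nbrs_r.adj_iff r).1 hxr with rfl | rfl | rfl
    · exact (hend h₂).elim
    · exact (hend h₂.swap_ab).elim
    · rcases h₂.nbrs_r.exists_mem hx hxf with h' | h' | h'
      · exact h.hasExtension_of_joined h₂.swap_ab hr hp hq h'
      · exact h.hasExtension_of_joined h₂ hr hp hq h'
      · exact absurd h' hrC

end IsBlock

theorem hasExtension_of_inBlock (hcub : ∀ v, ∃ a b c, HasNeighbors G v a b c)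
    (hB : ∀ v, InBlock G v) {x y : V} (hx : x ∉ C) (hxf : x ∉ fullOutside G C)
    (hy : y ∈ fullOutside G C) (hxy : G.Adj x y) : HasExtension 3 6 G C := by
  obtain ⟨p, q, r, a, b, c, r', c', h, rfl | rfl | rfl⟩ := hB y
  · exact h.hasExtension_of_p_full hy hx hxf hxy
  · exact h.swap_pq.hasExtension_of_p_full hy hx hxf hxy
  · exact h.hasExtension_of_r_full hcub hB hy hx hxf hxy

end BlockExtend

/-! ### The approximation ratios -/

open Classical in
theorem ConnectedRegular.card_neighborFinset {d n : ℕ} {G : SimpleGraph (Fin n)}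
    (h : ConnectedRegular d n G) (v : Fin n) : (G.neighborFinset v).card = d := by
  rw [SimpleGraph.card_neighborFinset_eq_degree]
  convert h.2 v

theorem ConnectedRegular.greedyExtendable {d n : ℕ} (hd : 3 ≤ d) {G : SimpleGraph (Fin n)}
    (h : ConnectedRegular d n G) : GreedyExtendable d ((2 * d - 1) * (d - 1)) (2 * d) G := by
  classical
  exact greedyExtendable_of_hasExtension (by omega) h.1 h.card_neighborFinset
    fun _ _ _ hx hxf hy hxy => hasExtension_of_regular hd h.card_neighborFinset hx hxf hy hxy

theorem ConnectedCubicBipartiteTStarFree.greedyExtendable {n : ℕ} (hn : 9 ≤ n)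
    {G : SimpleGraph (Fin n)} (h : ConnectedCubicBipartiteTStarFree n G) :
    GreedyExtendable 3 6 (2 * 3) G := by
  classical
  obtain ⟨hreg, ⟨col⟩, hT⟩ := h
  have hcub : ∀ v, ∃ a b c, HasNeighbors G v a b c := by
    intro v
    obtain ⟨a, b, c, hab, hac, hbc, hS⟩ := Finset.card_eq_three.1 (hreg.card_neighborFinset v)
    refine ⟨a, b, c, hab, hac, hbc, fun w => ?_⟩
    rw [← SimpleGraph.mem_neighborFinset, hS]
    simp
  have hf : ∀ u v, G.Adj u v → decide (col u = 0) ≠ decide (col v = 0) := by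
    intro u v huv
    have := col.valid huv
    rw [Ne, decide_eq_decide]
    omega
  exact greedyExtendable_of_hasExtension (by omega) hreg.1 hreg.card_neighborFinset
    fun _ _ _ hx hxf hy hxy => hasExtension_of_inBlock hcub
      (inBlock_of_tStarFree hf hT hreg.1 hcub (by rw [Fintype.card_fin]; omega)) hx hxf hy hxy

theorem mainTheorem5 (Δ : ℕ) (hΔ : 3 ≤ Δ) (ε : ℝ) (hε : 0 < ε) :
    HasPolyTimeApproximation ConnectedCubicBipartiteTStarFree (25 / 18 + ε) ∧
    HasPolyTimeApproximation (ConnectedRegular Δ) (2 - 1 / ((Δ : ℝ) - 1) + ε) ∧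
    HasPolyTimeApproximation (ConnectedClawFreeRegular Δ)
      (1 + (4 * (Δ : ℝ) - 7) / (2 * (Δ : ℝ) ^ 2 - 3 * (Δ : ℝ) + 1) + ε) := by

  classical
  have hΔ' : (3 : ℝ) ≤ Δ := by exact_mod_cast hΔ
  -- This is the weight `c` of isolated vertices in both regular cases: `Δ - 1` edges, each
  -- destroying at most `2 * Δ - 1` full vertices.
  have hc : 0 < (2 * Δ - 1) * (Δ - 1) := Nat.mul_pos (by omega) (by omega)
  have hc' : (((2 * Δ - 1) * (Δ - 1) : ℕ) : ℝ) = (2 * Δ - 1) * (Δ - 1) := by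
    rw [Nat.cast_mul, Nat.cast_sub (by omega), Nat.cast_sub (by omega)]
    push_cast
    rfl
  have h1 : (Δ : ℝ) - 1 ≠ 0 := by linarith
  refine ⟨?_, ?_, ?_⟩
  -- The ratio is `(6 - 1) * (3 + 2) / (6 * 3) = 25 / 18`. The bound `n₀ = 9` excludes `K_{3,3}` and
  -- the cube.
  · exact hasPolyTimeApproximation_of_greedyExtendable (k := 3) (c := 6) (D := 2 * 3) (d := 3)
      (b := 2) (n₀ := 9) (by omega) (by omega) (by norm_num) hε
      (fun n G hG v => by convert hG.1.card_neighborFinset v)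
      (fun n G hn hG => hG.greedyExtendable hn)
      (fun n G hG M hM v hv S hS => hM.card_uncovered_neighbors_le hG.1.card_neighborFinset hv hS)
      (by omega) (by norm_num)
  · refine hasPolyTimeApproximation_of_greedyExtendable (d := Δ) (b := Δ - 1) (n₀ := 0) (by omega)
      (by omega) ?_ hε (fun n G hG v => by convert hG.card_neighborFinset v)
      (fun n G _ hG => hG.greedyExtendable hΔ)
      (fun n G hG M hM v hv S hS => hM.card_uncovered_neighbors_le hG.card_neighborFinset hv hS)
      hc ?_
    · have : 1 / ((Δ : ℝ) - 1) ≤ 1 := by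
        rw [div_le_one (by linarith)]
        linarith
      linarith
    · rw [hc', Nat.cast_sub (by omega)]
      field_simp
      push_cast
      ring
  · refine hasPolyTimeApproximation_of_greedyExtendable (d := Δ) (b := 2) (n₀ := 0) (by omega)
      (by omega) ?_ hε (fun n G hG v => by convert hG.1.card_neighborFinset v)
      (fun n G _ hG => hG.1.greedyExtendable hΔ)
      (fun n G hG M hM v hv S hS => hM.card_uncovered_neighbors_le_two hG.2 hS) hc ?_
    · have : 0 ≤ (4 * (Δ : ℝ) - 7) / (2 * (Δ : ℝ) ^ 2 - 3 * (Δ : ℝ) + 1) :=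
        div_nonneg (by linarith) (by nlinarith)
      linarith
    · have h2 : 2 * (Δ : ℝ) - 1 ≠ 0 := by linarith
      rw [hc', show 2 * (Δ : ℝ) ^ 2 - 3 * Δ + 1 = (2 * Δ - 1) * (Δ - 1) by ring]
      field_simp
      push_cast
      ring
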